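/- **Setting.** Let $\Phi$ be a countably Hilbertian nuclear space: a separable Fréchet space whose topology is given by an increasing sequence of compatible Hilbertian norms $\|\cdot\|_n$, $n\in\mathbb N_0$, such that, $\Phi_n$ denoting the completion of $\Phi$ under $\|\cdot\|_n$, for each $n$ there is $m>n$ for which $\Phi_m\to\Phi_n$ is Hilbert–Schmidt. Let $\Phi_{-n}\subset\Phi'$ be the space of functionals bounded with respect to $\|\cdot\|_n$, with dual norm $\|\cdot\|_{-n}$ and inner product $\langle\cdot,\cdot\rangle_{-n}$; $\Phi$ is embedded in $\Phi'$ by $\phi\mapsto\langle\phi,\cdot\rangle_0$, and $u[\phi]$ denotes the value of $u\in\Phi'$ at $\phi\in\Phi$. Assume that there is a sequence $\{\phi_j\}\subset\Phi$ that is a complete orthonormal system in $\Phi_0$ and a complete orthogonal system in every $\Phi_n$, $n\in\mathbb Z$. Let $\theta_p:\Phi_{-p}\to\Phi_p$ be the isometry with $\theta_p(\phi_j/\|\phi_j\|_{-p})=\phi_j/\|\phi_j\|_p$; it maps $\Phi$ into $\Phi$. Let $\mathbb X$ be a locally compact Polish space, $\nu$ a Borel measure on $\mathbb X$ that is finite on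 compact sets, $T\in(0,\infty)$, $\mathbb X_T=[0,T]\times\mathbb X$ and $\nu_T=\mathrm{Leb}_{[0,T]}\otimes\nu$. With $l(r)=r\log r-r+1$ put, for $N\in\mathbb N$, $$S^N=\Big\{g:\mathbb X_T\to[0,\infty)\ \text{measurable}:\ \int_{\mathbb X_T} l(g)\,d\nu_T\le N\Big\},\qquad \mathbb S=\bigcup_{N\ge1}S^N .$$ Let $A:[0,T]\times\Phi'\to\Phi'$ and $G:[0,T]\times\Phi'\times\mathbb X\to\Phi'$ be measurable. Suppose that there is $p_0$ such that for every $r\ge p_0$ there are $q(r)\ge r$ and a constant $K(r)$ for which, writing $q=q(r)$, $K=K(r)$, for all $t\in[0,T]$: 1. (Continuity) for $u\in\Phi_{-r}$, $A(t,u)\in\Phi_{-q}$ and $G(t,u,\cdot)\in L^2(\mathbb X,\nu;\Phi_{-r})$, and the maps $u\mapsto A(t,u)$, $\Phi_{-r}\to\Phi_{-q}$, and $u\mapsto G(t,u,\cdot)$, $\Phi_{-r}\to L^2(\mathbb X,\nu;\Phi_{-r})$, are continuous; 2. (Coercivity) $2A(t,\phi)[\theta_r\phi]\le K(1+\|\phi\|_{-r}^2)$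 for all $\phi\in\Phi$; 3. (Growth) $\|A(t,u)\|_{-q}^2\le K(1+\|u\|_{-r}^2)$ and $\int_{\mathbb X}\|G(t,u,v)\|_{-r}^2\,\nu(dv)\le K(1+\|u\|_{-r}^2)$ for all $u\in\Phi_{-r}$; 4. (Monotonicity) for all $u_1,u_2\in\Phi_{-r}$, $$2\langle A(t,u_1)-A(t,u_2),u_1-u_2\rangle_{-q}+\int_{\mathbb X}\|G(t,u_1,v)-G(t,u_2,v)\|_{-q}^2\,\nu(dv)\le K\|u_1-u_2\|_{-q}^2 .$$ Fix $p\ge p_0$ and $p_1\ge p$ such that the canonical injection $\Phi_{-p}\to\Phi_{-p_1}$ is Hilbert–Schmidt, and let $$\|G(t,v)\|_{0,-p}=\sup_{u\in\Phi_{-p}}\frac{\|G(t,u,v)\|_{-p}}{1+\|u\|_{-p}},\qquad \|G(t,v)\|_{1,-q}=\sup_{u_1\ne u_2\in\Phi_{-q}}\frac{\|G(t,u_1,v)-G(t,u_2,v)\|_{-q}}{\|u_1-u_2\|_{-q}} .$$ Suppose that there are $\delta_1,\delta>0$ such that for every Borel set $E\subset\mathbb X_T$ with $\nu_T(E)<\infty$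 $$\int_E e^{\delta_1\|G(s,v)\|_{0,-p}^2}\,d\nu_T<\infty\qquad\text{and}\qquad \int_E e^{\delta\|G(s,v)\|_{1,-q}^2}\,d\nu_T<\infty\ \text{ with } q=q(p_1).$$ **Theorem.** Let $X_0\in\Phi_{-p}$. For every $g\in\mathbb S$ there exists a unique $\tilde X^g\in C([0,T]:\Phi_{-p_1})$ such that for every $\phi\in\Phi$ and $t\in[0,T]$ $$\tilde X^g_t[\phi]=X_0[\phi]+\int_0^tA(s,\tilde X^g_s)[\phi]\,ds+\int_0^t\int_{\mathbb X}G(s,\tilde X^g_s,v)[\phi]\,(g(s,v)-1)\,\nu(dv)\,ds$$ (both integrals being absolutely convergent on $[0,T]$, respectively $\mathbb X_T$). Furthermore, for every $N\in\mathbb N$, $\tilde X^g_t\in\Phi_{-p}$ for all $g\in S^N$ and $t\in[0,T]$, and $$\sup_{t\in[0,T]}\sup_{g\in S^N}\|\tilde X^g_t\|_{-p}<\infty .$$ -/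

import Mathlib

open MeasureTheory Set Filter Topology
open scoped ENNReal NNReal

noncomputable section

/-- A countably Hilbertian nuclear space `Φ` (a separable Fréchet space topologised by an
increasing sequence of compatible Hilbertian norms, with Hilbert-Schmidt connecting maps), together
with a sequence `φ_j` in `Φ` that is a complete orthonormal system for `‖·‖_0` and a complete
orthogonal system for every `‖·‖_n`.  Since `Φ` is dense in its `‖·‖_n`-completion `Φ_n`,
orthogonality, completeness and the Hilbert-Schmidt norm are expressed inside `Φ`.  (Complete
orthogonality in the dual spaces `Φ_{-n}` is a consequence.) -/
structure CHNS (Φ : Type*) [AddCommGroup Φ] [Module ℝ Φ] [UniformSpace Φ]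
    [IsUniformAddGroup Φ] where
  /-- the norms `‖·‖_n` -/
  nrm : SeminormFamily ℝ Φ ℕ
  /-- the inner products `⟨·,·⟩_n` -/
  ip : ℕ → LinearMap.BilinForm ℝ Φ
  ip_symm : ∀ n x y, ip n x y = ip n y x
  ip_self : ∀ n x, ip n x x = nrm n x ^ 2
  definite : ∀ n x, nrm n x = 0 → x = 0
  increasing : ∀ m n, m ≤ n → ∀ x, nrm m x ≤ nrm n x
  /-- compatibility: a sequence that is Cauchy for `‖·‖_m` and `‖·‖_n` and tends to `0` for
  `‖·‖_m` tends to `0` for `‖·‖_n` -/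
  compatible : ∀ (m n : ℕ) (x : ℕ → Φ),
    (∀ ε > 0, ∃ k₀, ∀ k ≥ k₀, ∀ l ≥ k₀, nrm m (x k - x l) < ε) →
    (∀ ε > 0, ∃ k₀, ∀ k ≥ k₀, ∀ l ≥ k₀, nrm n (x k - x l) < ε) →
    Tendsto (fun k => nrm m (x k)) atTop (𝓝 0) → Tendsto (fun k => nrm n (x k)) atTop (𝓝 0)
  withSeminorms : WithSeminorms nrm
  completeSpace : CompleteSpace Φ
  separableSpace : TopologicalSpace.SeparableSpace Φ
  /-- the sequence `φ_j` -/
  basis : ℕ → Φ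
  basis_norm : ∀ j, nrm 0 (basis j) = 1
  basis_orthogonal : ∀ n i j, i ≠ j → ip n (basis i) (basis j) = 0
  basis_complete : ∀ n x, ∀ ε > 0, ∃ y ∈ Submodule.span ℝ (range basis), nrm n (x - y) < ε
  /-- nuclearity: for every `n` some `Φ_m → Φ_n`, `m > n`, is Hilbert-Schmidt, i.e.
  `∑_j ‖φ_j / ‖φ_j‖_m‖_n ^ 2 < ∞` -/
  nuclear : ∀ n, ∃ m, n < m ∧ Summable fun j => nrm n ((nrm m (basis j))⁻¹ • basis j) ^ 2

namespace CHNS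

variable {Φ : Type*} [AddCommGroup Φ] [Module ℝ Φ] [UniformSpace Φ] [IsUniformAddGroup Φ]

theorem abs_ip_le (D : CHNS Φ) (n : ℕ) (x y : Φ) : |D.ip n x y| ≤ D.nrm n x * D.nrm n y := by
  have h := LinearMap.BilinForm.apply_mul_apply_le_of_forall_zero_le (D.ip n)
    (fun z => by rw [D.ip_self]; positivity) x y
  rw [D.ip_symm n y x, D.ip_self, D.ip_self] at h
  refine abs_le_of_sq_le_sq ?_ (mul_nonneg (apply_nonneg _ _) (apply_nonneg _ _))
  nlinarith [h]

/-- The identification of `Φ` with a subspace of `Φ'` through `Φ_0' = Φ_0`: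
`φ ↦ ⟨φ, ·⟩_0`. -/
def embed (D : CHNS Φ) (φ : Φ) : Φ →L[ℝ] ℝ where
  toLinearMap := D.ip 0 φ
  cont := by
    refine WithSeminorms.continuous_normedSpace_rng ℝ D.withSeminorms (D.ip 0 φ)
      ⟨{0}, ⟨D.nrm 0 φ, apply_nonneg _ _⟩, ?_⟩
    intro x
    rw [Finset.sup_singleton]
    exact D.abs_ip_le 0 φ x

/-- The norm `‖u‖_{-p}` dual to `‖·‖_p`, for `u ∈ Φ'`; it is `∞` when `u ∉ Φ_{-p}`. -/
def dualNorm (D : CHNS Φ) (p : ℕ) (u : Φ →L[ℝ] ℝ) : ℝ≥0∞ :=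
  ⨆ (φ : Φ) (_ : D.nrm p φ ≤ 1), ENNReal.ofReal |u φ|

/-- `Φ_{-p}`, as a subset of `Φ'`. -/
def neg (D : CHNS Φ) (p : ℕ) : Set (Φ →L[ℝ] ℝ) := {u | D.dualNorm p u < ∞}

/-- The inner product `⟨u, w⟩_{-p}` for `u, w ∈ Φ_{-p}`, by polarization of the (Hilbertian)
norm. -/
def dualInner (D : CHNS Φ) (p : ℕ) (u w : Φ →L[ℝ] ℝ) : ℝ :=
  ((D.dualNorm p (u + w)).toReal ^ 2 - (D.dualNorm p (u - w)).toReal ^ 2) / 4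

/-- `φ_j^{-p} = φ_j / ‖φ_j‖_{-p}`, a complete orthonormal system of `Φ_{-p}`. -/
def negBasis (D : CHNS Φ) (p j : ℕ) : Φ →L[ℝ] ℝ :=
  (D.dualNorm p (D.embed (D.basis j))).toReal⁻¹ • D.embed (D.basis j)

/-- The canonical injection `Φ_{-p} → Φ_{-r}` is Hilbert-Schmidt. -/
def InjectionHS (D : CHNS Φ) (p r : ℕ) : Prop :=
  ∑' j, D.dualNorm r (D.negBasis p j) ^ 2 < ∞

/-- The restriction to `Φ` of the isometry `θ_p : Φ_{-p} → Φ_p` with `θ_p (φ_j^{-p}) = φ_j^p`.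
Since `φ_j^{-p} = ‖φ_j‖_p φ_j` and `φ_j^p = φ_j / ‖φ_j‖_p`, it sends
`φ = ∑_j ⟨φ, φ_j⟩_0 φ_j` to `∑_j ⟨φ, φ_j⟩_0 ‖φ_j‖_p⁻² φ_j`; the series converges in `Φ`. -/
def theta (D : CHNS Φ) (p : ℕ) (φ : Φ) : Φ :=
  ∑' j, (D.ip 0 φ (D.basis j) / D.nrm p (D.basis j) ^ 2) • D.basis j

end CHNS

/-- The σ-field on `Φ'` generated by the evaluations `u ↦ u[φ]`.  For the dual of a countably
Hilbertian nuclear space it is the Borel σ-field, and it induces the Borel σ-field on each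
`Φ_{-p}`. -/
@[reducible]
def cylinderSigma (Φ : Type*) [AddCommGroup Φ] [Module ℝ Φ] [UniformSpace Φ] :
    MeasurableSpace (Φ →L[ℝ] ℝ) :=
  MeasurableSpace.comap (fun (u : Φ →L[ℝ] ℝ) (φ : Φ) => u φ) MeasurableSpace.pi

section Equation

variable {Φ : Type*} [AddCommGroup Φ] [Module ℝ Φ] [UniformSpace Φ] [IsUniformAddGroup Φ]
variable {𝕏 : Type*} [MeasurableSpace 𝕏]

/-- `ν_T = λ_T ⊗ ν`, with `λ_T` the Lebesgue measure on `[0,T]`. -/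
def nuT (T : ℝ) (ν : Measure 𝕏) : Measure (ℝ × 𝕏) := (volume.restrict (Icc 0 T)).prod ν

/-- `l(r) = r log r - r + 1`. -/
def entropyFn (r : ℝ) : ℝ := r * Real.log r - r + 1

/-- `L_T(g) = ∫ l(g) dν_T`. -/
def costT (T : ℝ) (ν : Measure 𝕏) (g : ℝ × 𝕏 → ℝ≥0) : ℝ≥0∞ :=
  ∫⁻ z, ENNReal.ofReal (entropyFn (g z)) ∂(nuT T ν)

/-- The set of controls `S^N = {g : L_T(g) ≤ N}`. -/
def controlSet (T : ℝ) (ν : Measure 𝕏) (N : ℕ) : Set (ℝ × 𝕏 → ℝ≥0) :=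
  {g | Measurable g ∧ costT T ν g ≤ N}

/-- `𝕊 = ⋃_{N ≥ 1} S^N`. -/
def controls (T : ℝ) (ν : Measure 𝕏) : Set (ℝ × 𝕏 → ℝ≥0) :=
  ⋃ (N : ℕ) (_ : 1 ≤ N), controlSet T ν N

/-- Joint measurability of the coefficients `A` and `G`.  (Their values at times outside `[0,T]`
play no role elsewhere and can be taken to be `0`.) -/
def MeasurableCoeffs (A : ℝ → (Φ →L[ℝ] ℝ) → (Φ →L[ℝ] ℝ))
    (G : ℝ → (Φ →L[ℝ] ℝ) → 𝕏 → (Φ →L[ℝ] ℝ)) : Prop :=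
  letI := cylinderSigma Φ
  (Measurable fun z : ℝ × (Φ →L[ℝ] ℝ) => A z.1 z.2) ∧
    (Measurable fun z : ℝ × (Φ →L[ℝ] ℝ) × 𝕏 => G z.1 z.2.1 z.2.2)

/-- Continuity, coercivity, growth and monotonicity of the coefficients on `Φ_{-p}`, with the
index `q ≥ p` and the constant `K`. -/
structure CoeffConditionAt (D : CHNS Φ) (ν : Measure 𝕏) (T : ℝ)
    (A : ℝ → (Φ →L[ℝ] ℝ) → (Φ →L[ℝ] ℝ)) (G : ℝ → (Φ →L[ℝ] ℝ) → 𝕏 → (Φ →L[ℝ] ℝ))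
    (p q : ℕ) (K : ℝ) : Prop where
  le : p ≤ q
  A_mem : ∀ t ∈ Icc 0 T, ∀ u ∈ D.neg p, A t u ∈ D.neg q
  G_mem : ∀ t ∈ Icc 0 T, ∀ u ∈ D.neg p, ∀ v, G t u v ∈ D.neg p
  G_sq_integrable : ∀ t ∈ Icc 0 T, ∀ u ∈ D.neg p, ∫⁻ v, D.dualNorm p (G t u v) ^ 2 ∂ν < ∞
  /-- `A(t,·) : Φ_{-p} → Φ_{-q}` is continuous -/
  A_cont : ∀ t ∈ Icc 0 T, ∀ u ∈ D.neg p, ∀ ε > 0, ∃ δ > 0, ∀ w ∈ D.neg p,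
    D.dualNorm p (w - u) < δ → D.dualNorm q (A t w - A t u) < ε
  /-- `u ↦ G(t,u,·)`, `Φ_{-p} → L²(𝕏,ν;Φ_{-p})`, is continuous -/
  G_cont : ∀ t ∈ Icc 0 T, ∀ u ∈ D.neg p, ∀ ε > 0, ∃ δ > 0, ∀ w ∈ D.neg p,
    D.dualNorm p (w - u) < δ → ∫⁻ v, D.dualNorm p (G t w v - G t u v) ^ 2 ∂ν < ε
  coercive : ∀ t ∈ Icc 0 T, ∀ φ : Φ,
    2 * A t (D.embed φ) (D.theta p φ) ≤ K * (1 + (D.dualNorm p (D.embed φ)).toReal ^ 2)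
  A_growth : ∀ t ∈ Icc 0 T, ∀ u ∈ D.neg p,
    D.dualNorm q (A t u) ^ 2 ≤ ENNReal.ofReal K * (1 + D.dualNorm p u ^ 2)
  G_growth : ∀ t ∈ Icc 0 T, ∀ u ∈ D.neg p,
    ∫⁻ v, D.dualNorm p (G t u v) ^ 2 ∂ν ≤ ENNReal.ofReal K * (1 + D.dualNorm p u ^ 2)
  /-- the integral is finite, because `‖·‖_{-q} ≤ ‖·‖_{-p}` -/
  monotone : ∀ t ∈ Icc 0 T, ∀ u₁ ∈ D.neg p, ∀ u₂ ∈ D.neg p,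
    2 * D.dualInner q (A t u₁ - A t u₂) (u₁ - u₂)
      + (∫⁻ v, D.dualNorm q (G t u₁ v - G t u₂ v) ^ 2 ∂ν).toReal
      ≤ K * (D.dualNorm q (u₁ - u₂)).toReal ^ 2

/-- `‖G(t,v)‖_{0,-p} = sup_{u ∈ Φ_{-p}} ‖G(t,u,v)‖_{-p} / (1 + ‖u‖_{-p})`. -/
def growthNorm (D : CHNS Φ) (G : ℝ → (Φ →L[ℝ] ℝ) → 𝕏 → (Φ →L[ℝ] ℝ)) (p : ℕ)
    (z : ℝ × 𝕏) : ℝ≥0∞ :=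
  ⨆ u ∈ D.neg p, D.dualNorm p (G z.1 u z.2) / (1 + D.dualNorm p u)

/-- `‖G(t,v)‖_{1,-q} = sup_{u₁ ≠ u₂ ∈ Φ_{-q}} ‖G(t,u₁,v) - G(t,u₂,v)‖_{-q} / ‖u₁ - u₂‖_{-q}`. -/
def lipNorm (D : CHNS Φ) (G : ℝ → (Φ →L[ℝ] ℝ) → 𝕏 → (Φ →L[ℝ] ℝ)) (q : ℕ)
    (z : ℝ × 𝕏) : ℝ≥0∞ :=
  ⨆ u₁ ∈ D.neg q, ⨆ u₂ ∈ D.neg q, ⨆ (_ : u₁ ≠ u₂),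
    D.dualNorm q (G z.1 u₁ z.2 - G z.1 u₂ z.2) / D.dualNorm q (u₁ - u₂)

/-- There is `δ > 0` with `∫_E exp(δ h²) dμ < ∞` for every measurable `E` with `μ(E) < ∞`.
(Measurability of `h` up to null sets is part of the meaning of the integral.) -/
def ExpSqIntegrable {Z : Type*} [MeasurableSpace Z] (μ : Measure Z) (h : Z → ℝ≥0∞) : Prop :=
  ∃ δ : ℝ, 0 < δ ∧ ∀ E, MeasurableSet E → μ E < ∞ →
    AEMeasurable h (μ.restrict E) ∧
      ∫⁻ z in E, EReal.exp ((ENNReal.ofReal δ * h z ^ 2 : ℝ≥0∞) : EReal) ∂μ < ∞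

/-- `X` restricted to `[0,T]` belongs to `C([0,T] : Φ_{-r})` and solves, for every `φ ∈ Φ`,
`X_t[φ] = X₀[φ] + ∫_0^t A(s,X_s)[φ] ds + ∫_0^t ∫ G(s,X_s,v)[φ] (g(s,v) - 1) ν(dv) ds`,
both integrals being absolutely convergent. -/
structure IsSkeletonSolution (D : CHNS Φ) (ν : Measure 𝕏) (T : ℝ)
    (A : ℝ → (Φ →L[ℝ] ℝ) → (Φ →L[ℝ] ℝ)) (G : ℝ → (Φ →L[ℝ] ℝ) → 𝕏 → (Φ →L[ℝ] ℝ))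
    (X₀ : Φ →L[ℝ] ℝ) (g : ℝ × 𝕏 → ℝ≥0) (r : ℕ) (X : ℝ → (Φ →L[ℝ] ℝ)) : Prop where
  mem : ∀ t ∈ Icc 0 T, X t ∈ D.neg r
  cont : ∀ t ∈ Icc 0 T, Tendsto (fun s => D.dualNorm r (X s - X t)) (𝓝[Icc 0 T] t) (𝓝 0)
  A_integrable : ∀ φ, IntegrableOn (fun s => A s (X s) φ) (Icc 0 T)
  G_integrable : ∀ φ,
    Integrable (fun z : ℝ × 𝕏 => G z.1 (X z.1) z.2 φ * ((g z : ℝ) - 1)) (nuT T ν)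
  eqn : ∀ t ∈ Icc 0 T, ∀ φ, X t φ = X₀ φ + (∫ s in (0 : ℝ)..t, A s (X s) φ)
    + ∫ s in (0 : ℝ)..t, ∫ v, G s (X s) v φ * ((g (s, v) : ℝ) - 1) ∂ν

end Equation

end

/-! The control is absorbed into the drift: the equation reads `X_t = X₀ + ∫ F(s, X_s) ds` with
`F(s,u) = A(s,u) + ∫ G(s,u,v) (g(s,v) - 1) ν(dv)`. The plan is to show that `F` inherits growth,
coercivity, monotonicity and continuity from `A` and `G`, with a constant `χ(s)` that is integrable
in time and whose integral is bounded uniformly over `g ∈ S^N`, and then to solve such equations in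
general.

The jump term is estimated by splitting at `g = 4` (`two_mul_lintegral_mul_deviation_le`). Where `g
≤ 4`, `(g - 1)² ≤ 9 l(g)`, so Young's inequality bounds the term by the `L²(ν)` norm of `G` and the
entropy of `g`. Where `g > 4`, the pointwise bounds by `‖G‖_{0,-p}` and `‖G‖_{1,-q}` leave integrals
of `h g`, and `h g ≤ exp(δ h²) + (1 + 1/δ) l(g)`. The set `{g > 4}` depends on `g`, but its measure
is at most `N`. Since `ν_T` can be halved continuously in time, finiteness of `∫_E exp(δ h²)` on
every set of finite measure is automatically uniform over the sets of measure at most `N`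
(`exists_uniform_setLIntegral_bound`). In the monotonicity estimate, the term `∫ ‖G(u₁) - G(u₂)‖²`
of the hypothesis is exactly what pays for the quadratic part of Young's inequality
(`skeletonDrift_monotone`).

For the abstract equation (`DriftConditions`), all norms are diagonal in the basis `φ_j`, so
everything is computed on the coefficients `u[φ_j]`: `‖u‖_{-r}² = ∑ u[φ_j]² / ‖φ_j‖_r²`. The
equation is truncated to `d` coefficients and solved approximately by Euler's scheme. Coercivity
gives a bound in `Φ_{-p}` (`IsGalerkin.energy`). Monotonicity in `Φ_{-q}`, together with the small
Hilbert-Schmidt tails of `Φ_{-p} → Φ_{-p₁}`, makes the approximations Cauchy without any compactness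
argument (`IsGalerkin.rnorm_sub_sq_le`). Boundedness in `Φ_{-p}` and convergence of coefficients
yield convergence in `Φ_{-p₁}`, where `F` is continuous enough to pass to the limit. Uniqueness is
monotonicity and Grönwall in `Φ_{-q}`. The bound in `Φ_{-p}` depends on `g` only through `∫ χ`,
which gives the uniform estimate. -/

noncomputable section

/-! ### The Hilbert scale in coordinates -/

namespace CHNS

variable {Φ : Type*} [AddCommGroup Φ] [Module ℝ Φ] [UniformSpace Φ] [IsUniformAddGroup Φ]

/-- The norm `‖φ_j‖_n` of a basis vector. -/
def wt (D : CHNS Φ) (n j : ℕ) : ℝ := D.nrm n (D.basis j)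

theorem wt_mono (D : CHNS Φ) {m n : ℕ} (h : m ≤ n) (j : ℕ) : D.wt m j ≤ D.wt n j :=
  D.increasing m n h _

theorem one_le_wt (D : CHNS Φ) (n j : ℕ) : 1 ≤ D.wt n j := by
  rw [← D.basis_norm j]; exact D.increasing 0 n (Nat.zero_le n) _

theorem wt_pos (D : CHNS Φ) (n j : ℕ) : 0 < D.wt n j := zero_lt_one.trans_le (D.one_le_wt n j)

theorem ip_basis_self (D : CHNS Φ) (n j : ℕ) : D.ip n (D.basis j) (D.basis j) = D.wt n j ^ 2 :=
  D.ip_self n _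

theorem ip_sum_basis (D : CHNS Φ) (n : ℕ) (s : Finset ℕ) (c : ℕ → ℝ) (i : ℕ) :
    D.ip n (∑ j ∈ s, c j • D.basis j) (D.basis i) = if i ∈ s then c i * D.wt n i ^ 2 else 0 := by
  simp only [map_sum, map_smul, LinearMap.sum_apply, LinearMap.smul_apply, smul_eq_mul]
  rw [← Finset.sum_ite_eq s i (fun j => c j * D.wt n j ^ 2)]
  refine Finset.sum_congr rfl fun j _ => ?_
  split_ifs with h
  · subst h; rw [ip_basis_self]
  · rw [D.basis_orthogonal n j i (Ne.symm h), mul_zero]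

theorem nrm_sum_basis_sq (D : CHNS Φ) (n : ℕ) (s : Finset ℕ) (c : ℕ → ℝ) :
    D.nrm n (∑ j ∈ s, c j • D.basis j) ^ 2 = ∑ j ∈ s, c j ^ 2 * D.wt n j ^ 2 := by
  rw [← D.ip_self]
  conv_lhs => rw [map_sum]
  refine Finset.sum_congr rfl fun i hi => ?_
  rw [map_smul, ip_sum_basis, if_pos hi, smul_eq_mul]; ring

/-- Density of the span: `φ` is approximated so closely in `‖·‖_n` that boundedness of `L` would
give `|L φ| < |L φ|`. This is the tool for extending identities from the basis to all of `Φ`. -/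
theorem eq_zero_of_basis_eq_zero (D : CHNS Φ) (n : ℕ) (L : Φ →ₗ[ℝ] ℝ) (C : ℝ)
    (hC : ∀ φ, |L φ| ≤ C * D.nrm n φ) (hL : ∀ j, L (D.basis j) = 0) (φ : Φ) : L φ = 0 := by
  have hspan : ∀ y ∈ Submodule.span ℝ (range D.basis), L y = 0 := by
    intro y hy
    have : Submodule.span ℝ (range D.basis) ≤ LinearMap.ker L := by
      rw [Submodule.span_le]; rintro _ ⟨j, rfl⟩; exact hL j
    exact this hy
  by_contra h
  have hpos : 0 < |L φ| := abs_pos.2 h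
  obtain ⟨y, hy, hlt⟩ := D.basis_complete n φ (|L φ| / (|C| + 1)) (by positivity)
  have h1 : L φ = L (φ - y) := by rw [map_sub, hspan y hy, sub_zero]
  have h2 : |L φ| ≤ |C| * D.nrm n (φ - y) := by
    conv_lhs => rw [h1]
    exact (hC _).trans (mul_le_mul_of_nonneg_right (le_abs_self C) (apply_nonneg _ _))
  rw [lt_div_iff₀ (by positivity)] at hlt
  have : 0 ≤ D.nrm n (φ - y) := apply_nonneg _ _
  nlinarith

/-- Both sides are `‖·‖_n`-bounded functionals of `φ` that agree on the basis. Hence a single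
sequence of coefficients, those for `⟨·,·⟩_0`, describes `φ` in every norm. -/
theorem ip_basis (D : CHNS Φ) (n : ℕ) (φ : Φ) (j : ℕ) :
    D.ip n φ (D.basis j) = D.ip 0 φ (D.basis j) * D.wt n j ^ 2 := by
  let L : Φ →ₗ[ℝ] ℝ := D.ip n (D.basis j) - D.wt n j ^ 2 • D.ip 0 (D.basis j)
  have hL : ∀ x, L x = D.ip n x (D.basis j) - D.wt n j ^ 2 * D.ip 0 x (D.basis j) := by
    intro x
    simp [L, D.ip_symm n x, D.ip_symm 0 x]
  have := D.eq_zero_of_basis_eq_zero n L (D.wt n j + D.wt n j ^ 2) (fun x => ?_) (fun i => ?_) φ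
  · rw [hL] at this; linarith
  · rw [hL]
    have h1 := D.abs_ip_le n x (D.basis j)
    have h2 := D.abs_ip_le 0 x (D.basis j)
    rw [D.basis_norm, mul_one] at h2
    have h3 := D.increasing 0 n (Nat.zero_le n) x
    refine (abs_sub _ _).trans ?_
    rw [abs_mul, abs_of_nonneg (sq_nonneg (D.wt n j))]
    have : D.wt n j ^ 2 * |D.ip 0 x (D.basis j)| ≤ D.wt n j ^ 2 * D.nrm n x := by
      gcongr; exact h2.trans h3
    have h4 : D.nrm n (D.basis j) = D.wt n j := rfl
    rw [h4] at h1
    nlinarith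
  · rw [hL]
    by_cases h : i = j
    · subst h; rw [ip_basis_self, ip_basis_self]; simp [wt, D.basis_norm]
    · rw [D.basis_orthogonal n i j h, D.basis_orthogonal 0 i j h]; simp

/-- Bessel's inequality for `‖·‖_n`. -/
theorem bessel (D : CHNS Φ) (n : ℕ) (φ : Φ) (s : Finset ℕ) :
    ∑ j ∈ s, D.ip 0 φ (D.basis j) ^ 2 * D.wt n j ^ 2 ≤ D.nrm n φ ^ 2 := by
  set y := ∑ j ∈ s, D.ip 0 φ (D.basis j) • D.basis j with hy
  have h1 : D.ip n (φ - y) (φ - y) = D.ip n φ φ - 2 * D.ip n φ y + D.ip n y y := by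
    simp only [map_sub, LinearMap.sub_apply, D.ip_symm n y φ]; ring
  have h2 : D.ip n φ y = ∑ j ∈ s, D.ip 0 φ (D.basis j) ^ 2 * D.wt n j ^ 2 := by
    rw [hy, map_sum]
    refine Finset.sum_congr rfl fun j _ => ?_
    rw [map_smul, D.ip_basis n φ j, smul_eq_mul]; ring
  have h3 := D.nrm_sum_basis_sq n s fun j => D.ip 0 φ (D.basis j)
  rw [← hy] at h3
  rw [h2, D.ip_self, D.ip_self, D.ip_self, h3] at h1
  nlinarith [sq_nonneg (D.nrm n (φ - y))]

theorem dualNorm_mono (D : CHNS Φ) {m n : ℕ} (h : m ≤ n) (u : Φ →L[ℝ] ℝ) :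
    D.dualNorm n u ≤ D.dualNorm m u := by
  refine iSup₂_le fun φ hφ => ?_
  exact le_iSup₂_of_le φ ((D.increasing m n h φ).trans hφ) le_rfl

theorem neg_mono (D : CHNS Φ) {m n : ℕ} (h : m ≤ n) : D.neg m ⊆ D.neg n :=
  fun u hu => (D.dualNorm_mono h u).trans_lt hu

theorem ofReal_abs_le (D : CHNS Φ) (r : ℕ) (u : Φ →L[ℝ] ℝ) (φ : Φ) :
    ENNReal.ofReal |u φ| ≤ D.dualNorm r u * ENNReal.ofReal (D.nrm r φ) := by
  by_cases h : D.nrm r φ = 0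
  · rw [D.definite r φ h]; simp
  have hpos : 0 < D.nrm r φ := lt_of_le_of_ne (apply_nonneg _ _) (Ne.symm h)
  have h1 : ENNReal.ofReal |u ((D.nrm r φ)⁻¹ • φ)| ≤ D.dualNorm r u := by
    refine le_iSup₂_of_le (f := fun φ (_ : D.nrm r φ ≤ 1) => ENNReal.ofReal |u φ|) _ ?_ le_rfl
    rw [map_smul_eq_mul, norm_inv, Real.norm_of_nonneg hpos.le, inv_mul_cancel₀ h]
  calc ENNReal.ofReal |u φ|
      = ENNReal.ofReal |u ((D.nrm r φ)⁻¹ • φ)| * ENNReal.ofReal (D.nrm r φ) := by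
        rw [← ENNReal.ofReal_mul (abs_nonneg _), map_smul, smul_eq_mul, abs_mul, abs_inv,
          abs_of_pos hpos]
        congr 1; field_simp
    _ ≤ _ := by gcongr

theorem dualNorm_le (D : CHNS Φ) (r : ℕ) (u : Φ →L[ℝ] ℝ) (C : ℝ≥0∞)
    (h : ∀ φ, ENNReal.ofReal |u φ| ≤ C * ENNReal.ofReal (D.nrm r φ)) : D.dualNorm r u ≤ C := by
  refine iSup₂_le fun φ hφ => (h φ).trans ?_
  calc C * ENNReal.ofReal (D.nrm r φ) ≤ C * 1 := by
        gcongr; exact ENNReal.ofReal_le_one.2 hφ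
    _ = C := mul_one C

/-- The real-valued norm `‖u‖_{-r}` (meaningful for `u ∈ Φ_{-r}`). -/
def rnorm (D : CHNS Φ) (r : ℕ) (u : Φ →L[ℝ] ℝ) : ℝ := (D.dualNorm r u).toReal

theorem rnorm_nonneg (D : CHNS Φ) (r : ℕ) (u : Φ →L[ℝ] ℝ) : 0 ≤ D.rnorm r u :=
  ENNReal.toReal_nonneg

theorem ofReal_rnorm (D : CHNS Φ) {r : ℕ} {u : Φ →L[ℝ] ℝ} (hu : u ∈ D.neg r) :
    ENNReal.ofReal (D.rnorm r u) = D.dualNorm r u := ENNReal.ofReal_toReal (ne_of_lt hu)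

theorem rnorm_mono (D : CHNS Φ) {m n : ℕ} (h : m ≤ n) {u : Φ →L[ℝ] ℝ} (hu : u ∈ D.neg m) :
    D.rnorm n u ≤ D.rnorm m u :=
  ENNReal.toReal_mono (ne_of_lt hu) (D.dualNorm_mono h u)

theorem abs_le_rnorm (D : CHNS Φ) {r : ℕ} {u : Φ →L[ℝ] ℝ} (hu : u ∈ D.neg r) (φ : Φ) :
    |u φ| ≤ D.rnorm r u * D.nrm r φ := by
  have h := D.ofReal_abs_le r u φ
  rw [← D.ofReal_rnorm hu, ← ENNReal.ofReal_mul (D.rnorm_nonneg r u)] at h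
  exact (ENNReal.ofReal_le_ofReal_iff
    (mul_nonneg (D.rnorm_nonneg r u) (apply_nonneg _ _))).1 h

theorem dualNorm_le_ofReal (D : CHNS Φ) (r : ℕ) (u : Φ →L[ℝ] ℝ) {C : ℝ} (hC : 0 ≤ C)
    (h : ∀ φ, |u φ| ≤ C * D.nrm r φ) : D.dualNorm r u ≤ ENNReal.ofReal C := by
  refine D.dualNorm_le r u _ fun φ => ?_
  rw [← ENNReal.ofReal_mul hC]; exact ENNReal.ofReal_le_ofReal (h φ)

theorem mem_neg_of_bound (D : CHNS Φ) (r : ℕ) (u : Φ →L[ℝ] ℝ) {C : ℝ} (hC : 0 ≤ C)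
    (h : ∀ φ, |u φ| ≤ C * D.nrm r φ) : u ∈ D.neg r :=
  (D.dualNorm_le_ofReal r u hC h).trans_lt ENNReal.ofReal_lt_top

theorem rnorm_le (D : CHNS Φ) (r : ℕ) (u : Φ →L[ℝ] ℝ) {C : ℝ} (hC : 0 ≤ C)
    (h : ∀ φ, |u φ| ≤ C * D.nrm r φ) : D.rnorm r u ≤ C :=
  ENNReal.toReal_le_of_le_ofReal hC (D.dualNorm_le_ofReal r u hC h)

theorem dualNorm_add_le (D : CHNS Φ) (r : ℕ) (u w : Φ →L[ℝ] ℝ) :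
    D.dualNorm r (u + w) ≤ D.dualNorm r u + D.dualNorm r w := by
  refine D.dualNorm_le r _ _ fun φ => ?_
  rw [add_mul]
  refine le_trans ?_ (add_le_add (D.ofReal_abs_le r u φ) (D.ofReal_abs_le r w φ))
  rw [← ENNReal.ofReal_add (abs_nonneg _) (abs_nonneg _)]
  exact ENNReal.ofReal_le_ofReal (abs_add_le _ _)

theorem dualNorm_neg (D : CHNS Φ) (r : ℕ) (u : Φ →L[ℝ] ℝ) :
    D.dualNorm r (-u) = D.dualNorm r u := by
  simp [dualNorm]

theorem dualNorm_sub_le (D : CHNS Φ) (r : ℕ) (u w : Φ →L[ℝ] ℝ) :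
    D.dualNorm r (u - w) ≤ D.dualNorm r u + D.dualNorm r w := by
  rw [sub_eq_add_neg, ← D.dualNorm_neg r w]; exact D.dualNorm_add_le r u (-w)

theorem dualNorm_sub_comm (D : CHNS Φ) (r : ℕ) (u w : Φ →L[ℝ] ℝ) :
    D.dualNorm r (u - w) = D.dualNorm r (w - u) := by
  rw [← D.dualNorm_neg, neg_sub]

@[simp] theorem dualNorm_zero (D : CHNS Φ) (r : ℕ) : D.dualNorm r 0 = 0 := by
  simp [dualNorm]

theorem zero_mem_neg (D : CHNS Φ) (r : ℕ) : (0 : Φ →L[ℝ] ℝ) ∈ D.neg r := by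
  simp [neg]

theorem add_mem_neg (D : CHNS Φ) {r : ℕ} {u w : Φ →L[ℝ] ℝ} (hu : u ∈ D.neg r) (hw : w ∈ D.neg r) :
    u + w ∈ D.neg r :=
  (D.dualNorm_add_le r u w).trans_lt (ENNReal.add_lt_top.2 ⟨hu, hw⟩)

theorem sub_mem_neg (D : CHNS Φ) {r : ℕ} {u w : Φ →L[ℝ] ℝ} (hu : u ∈ D.neg r) (hw : w ∈ D.neg r) :
    u - w ∈ D.neg r :=
  (D.dualNorm_sub_le r u w).trans_lt (ENNReal.add_lt_top.2 ⟨hu, hw⟩)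

theorem rnorm_add_le (D : CHNS Φ) {r : ℕ} {u w : Φ →L[ℝ] ℝ} (hu : u ∈ D.neg r)
    (hw : w ∈ D.neg r) : D.rnorm r (u + w) ≤ D.rnorm r u + D.rnorm r w := by
  rw [rnorm, rnorm, rnorm, ← ENNReal.toReal_add (ne_of_lt hu) (ne_of_lt hw)]
  exact ENNReal.toReal_mono (ENNReal.add_ne_top.2 ⟨ne_of_lt hu, ne_of_lt hw⟩)
    (D.dualNorm_add_le r u w)

theorem rnorm_sub_le (D : CHNS Φ) {r : ℕ} {u w : Φ →L[ℝ] ℝ} (hu : u ∈ D.neg r)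
    (hw : w ∈ D.neg r) : D.rnorm r (u - w) ≤ D.rnorm r u + D.rnorm r w := by
  rw [rnorm, rnorm, rnorm, ← ENNReal.toReal_add (ne_of_lt hu) (ne_of_lt hw)]
  exact ENNReal.toReal_mono (ENNReal.add_ne_top.2 ⟨ne_of_lt hu, ne_of_lt hw⟩)
    (D.dualNorm_sub_le r u w)

theorem rnorm_sub_comm (D : CHNS Φ) (r : ℕ) (u w : Φ →L[ℝ] ℝ) :
    D.rnorm r (u - w) = D.rnorm r (w - u) := by
  rw [rnorm, rnorm, dualNorm_sub_comm]

/-- Every continuous functional is bounded for one of the norms. -/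
theorem exists_bound (D : CHNS Φ) (u : Φ →L[ℝ] ℝ) : ∃ n C, 0 ≤ C ∧ ∀ φ, |u φ| ≤ C * D.nrm n φ := by
  obtain ⟨s, C, -, h⟩ := Seminorm.bound_of_continuous D.withSeminorms
    (Seminorm.comp (normSeminorm ℝ ℝ) u.toLinearMap) (continuous_norm.comp u.continuous)
  refine ⟨s.sup id, C, C.2, fun φ => ?_⟩
  have h1 : |u φ| ≤ (C : ℝ) * (s.sup D.nrm) φ := h φ
  refine h1.trans (mul_le_mul_of_nonneg_left ?_ C.2)
  exact Seminorm.finset_sup_apply_le (apply_nonneg _ _)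
    fun i hi => D.increasing i _ (Finset.le_sup (f := id) hi) φ

theorem exists_clm (D : CHNS Φ) (r : ℕ) (L : Φ →ₗ[ℝ] ℝ) {C : ℝ} (hC : 0 ≤ C)
    (h : ∀ φ, |L φ| ≤ C * D.nrm r φ) : ∃ u : Φ →L[ℝ] ℝ, ∀ φ, u φ = L φ := by
  refine ⟨⟨L, WithSeminorms.continuous_normedSpace_rng ℝ D.withSeminorms L
    ⟨{r}, ⟨C, hC⟩, fun φ => ?_⟩⟩, fun φ => rfl⟩
  rw [Finset.sup_singleton]
  exact h φ

/-- The element of `Φ` representing the truncated inner product with `u` in `Φ_{-r}`. -/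
def trunc (D : CHNS Φ) (r m : ℕ) (u : Φ →L[ℝ] ℝ) : Φ :=
  ∑ j ∈ Finset.range m, (u (D.basis j) / D.wt r j ^ 2) • D.basis j

theorem apply_trunc (D : CHNS Φ) (r m : ℕ) (u w : Φ →L[ℝ] ℝ) :
    w (D.trunc r m u) =
      ∑ j ∈ Finset.range m, w (D.basis j) * u (D.basis j) / D.wt r j ^ 2 := by
  rw [trunc, map_sum]
  refine Finset.sum_congr rfl fun j _ => ?_
  rw [map_smul, smul_eq_mul]; ring

theorem nrm_trunc_sq (D : CHNS Φ) (r m : ℕ) (u : Φ →L[ℝ] ℝ) :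
    D.nrm r (D.trunc r m u) ^ 2 = ∑ j ∈ Finset.range m, u (D.basis j) ^ 2 / D.wt r j ^ 2 := by
  rw [trunc, nrm_sum_basis_sq]
  refine Finset.sum_congr rfl fun j _ => ?_
  have := (D.wt_pos r j).ne'
  field_simp

theorem apply_trunc_self (D : CHNS Φ) (r m : ℕ) (u : Φ →L[ℝ] ℝ) :
    u (D.trunc r m u) = D.nrm r (D.trunc r m u) ^ 2 := by
  rw [apply_trunc, nrm_trunc_sq]
  refine Finset.sum_congr rfl fun j _ => by ring

theorem nrm_trunc_le (D : CHNS Φ) {r : ℕ} (m : ℕ) {u : Φ →L[ℝ] ℝ} (hu : u ∈ D.neg r) :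
    D.nrm r (D.trunc r m u) ≤ D.rnorm r u := by
  have h := D.abs_le_rnorm hu (D.trunc r m u)
  rw [apply_trunc_self, abs_of_nonneg (sq_nonneg _), sq] at h
  by_contra hc
  push Not at hc
  have := mul_lt_mul_of_pos_right hc ((D.rnorm_nonneg r u).trans_lt hc)
  linarith

/-- Cauchy-Schwarz on the span, followed by density. Membership of `u` in `Φ_{-r}` is a conclusion
here, so this supplies the half of Parseval's identity that testing on truncations does not give. -/
theorem abs_le_of_sum_le (D : CHNS Φ) (r : ℕ) (u : Φ →L[ℝ] ℝ) {S : ℝ} (hS : 0 ≤ S)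
    (h : ∀ s : Finset ℕ, ∑ j ∈ s, u (D.basis j) ^ 2 / D.wt r j ^ 2 ≤ S ^ 2) (φ : Φ) :
    |u φ| ≤ S * D.nrm r φ := by
  have hfin : ∀ y ∈ Submodule.span ℝ (range D.basis), |u y| ≤ S * D.nrm r y := by
    intro y hy
    obtain ⟨c, rfl⟩ := (Finsupp.mem_span_range_iff_exists_finsupp).1 hy
    rw [Finsupp.sum]
    refine abs_le_of_sq_le_sq ?_ (mul_nonneg hS (apply_nonneg _ _))
    rw [mul_pow, nrm_sum_basis_sq, map_sum]
    calc (∑ i ∈ c.support, u (c i • D.basis i)) ^ 2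
        = (∑ i ∈ c.support, (u (D.basis i) / D.wt r i) * (c i * D.wt r i)) ^ 2 := by
          congr 1
          refine Finset.sum_congr rfl fun i _ => ?_
          have := (D.wt_pos r i).ne'
          rw [map_smul, smul_eq_mul]; field_simp
      _ ≤ (∑ i ∈ c.support, (u (D.basis i) / D.wt r i) ^ 2) *
            ∑ i ∈ c.support, (c i * D.wt r i) ^ 2 := Finset.sum_mul_sq_le_sq_mul_sq _ _ _
      _ ≤ S ^ 2 * ∑ i ∈ c.support, c i ^ 2 * D.wt r i ^ 2 := by
          simp only [div_pow, mul_pow]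
          gcongr
          exact h _
  obtain ⟨n, C, hC, hbd⟩ := D.exists_bound u
  refine le_of_forall_pos_le_add fun ε hε => ?_
  -- The norm with index `max n r` dominates both the norm for which `u` is already known to be
  -- bounded and the target norm.
  obtain ⟨y, hy, hlt⟩ := D.basis_complete (max n r) φ (ε / (C + S + 1)) (by positivity)
  rw [lt_div_iff₀ (by positivity)] at hlt
  have h1 := hbd (φ - y)
  have h2 := hfin y hy
  have h3 : D.nrm r y ≤ D.nrm r φ + D.nrm r (φ - y) := by
    have := map_sub_le_add (D.nrm r) φ (φ - y); rwa [sub_sub_cancel] at this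
  have h4 := D.increasing n _ (le_max_left n r) (φ - y)
  have h5 := D.increasing r _ (le_max_right n r) (φ - y)
  have h6 : |u φ| ≤ |u (φ - y)| + |u y| := by
    have := abs_add_le (u (φ - y)) (u y); rwa [← map_add, sub_add_cancel] at this
  have h7 : 0 ≤ D.nrm (max n r) (φ - y) := apply_nonneg _ _
  have h8 : C * D.nrm n (φ - y) ≤ C * D.nrm (max n r) (φ - y) := by gcongr
  have h9 : S * D.nrm r y ≤ S * (D.nrm r φ + D.nrm (max n r) (φ - y)) := by
    gcongr; linarith
  nlinarith

/-- Parseval in `Φ_{-r}`. Testing `u` on its own truncations bounds the partial sums by the norm;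
`abs_le_of_sum_le` gives the converse inequality. -/
theorem hasSum_rnorm_sq (D : CHNS Φ) {r : ℕ} {u : Φ →L[ℝ] ℝ} (hu : u ∈ D.neg r) :
    HasSum (fun j => u (D.basis j) ^ 2 / D.wt r j ^ 2) (D.rnorm r u ^ 2) := by
  have hle : ∀ m, ∑ j ∈ Finset.range m, u (D.basis j) ^ 2 / D.wt r j ^ 2 ≤ D.rnorm r u ^ 2 := by
    intro m
    rw [← nrm_trunc_sq]
    exact pow_le_pow_left₀ (apply_nonneg _ _) (D.nrm_trunc_le m hu) 2
  have hnn : ∀ j, 0 ≤ u (D.basis j) ^ 2 / D.wt r j ^ 2 := fun j => by positivity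
  have hs := summable_of_sum_range_le hnn hle
  have h1 : ∑' j, u (D.basis j) ^ 2 / D.wt r j ^ 2 ≤ D.rnorm r u ^ 2 :=
    hs.tsum_le_of_sum_range_le hle
  have h2 : D.rnorm r u ≤ √(∑' j, u (D.basis j) ^ 2 / D.wt r j ^ 2) := by
    refine D.rnorm_le r u (Real.sqrt_nonneg _) (D.abs_le_of_sum_le r u (Real.sqrt_nonneg _) ?_)
    intro s
    rw [Real.sq_sqrt (tsum_nonneg hnn)]
    exact hs.sum_le_tsum s fun j _ => hnn j
  have h3 := pow_le_pow_left₀ (D.rnorm_nonneg r u) h2 2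
  rw [Real.sq_sqrt (tsum_nonneg hnn)] at h3
  rw [le_antisymm h3 h1]
  exact hs.hasSum

theorem hasSum_dualInner (D : CHNS Φ) {r : ℕ} {u w : Φ →L[ℝ] ℝ} (hu : u ∈ D.neg r)
    (hw : w ∈ D.neg r) :
    HasSum (fun j => u (D.basis j) * w (D.basis j) / D.wt r j ^ 2) (D.dualInner r u w) := by
  have h := ((D.hasSum_rnorm_sq (D.add_mem_neg hu hw)).sub
    (D.hasSum_rnorm_sq (D.sub_mem_neg hu hw))).div_const 4
  have hfun : (fun j => u (D.basis j) * w (D.basis j) / D.wt r j ^ 2) = fun j =>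
      ((u + w) (D.basis j) ^ 2 / D.wt r j ^ 2 - (u - w) (D.basis j) ^ 2 / D.wt r j ^ 2) / 4 := by
    funext j
    rw [add_apply, sub_apply]
    ring
  rw [hfun]
  exact h

theorem tendsto_apply_trunc (D : CHNS Φ) {r : ℕ} {u w : Φ →L[ℝ] ℝ} (hu : u ∈ D.neg r)
    (hw : w ∈ D.neg r) :
    Tendsto (fun m => u (D.trunc r m w)) atTop (𝓝 (D.dualInner r u w)) := by
  simp_rw [apply_trunc]
  exact (D.hasSum_dualInner hu hw).tendsto_sum_nat

theorem apply_trunc_eq_dualInner (D : CHNS Φ) {r m : ℕ} {u w : Φ →L[ℝ] ℝ} (hu : u ∈ D.neg r)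
    (hw : w ∈ D.neg r) (h : ∀ j, m ≤ j → w (D.basis j) = 0) :
    u (D.trunc r m w) = D.dualInner r u w := by
  rw [apply_trunc]
  refine (hasSum_sum_of_ne_finset_zero fun j hj => ?_).unique (D.hasSum_dualInner hu hw)
  rw [h j (by simpa using hj)]; simp

theorem abs_apply_trunc_le (D : CHNS Φ) {r : ℕ} (m : ℕ) {u w : Φ →L[ℝ] ℝ} (hu : u ∈ D.neg r)
    (hw : w ∈ D.neg r) : |u (D.trunc r m w)| ≤ D.rnorm r u * D.rnorm r w :=
  (D.abs_le_rnorm hu _).trans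
    (mul_le_mul_of_nonneg_left (D.nrm_trunc_le m hw) (D.rnorm_nonneg r u))

theorem abs_dualInner_le (D : CHNS Φ) {r : ℕ} {u w : Φ →L[ℝ] ℝ} (hu : u ∈ D.neg r)
    (hw : w ∈ D.neg r) : |D.dualInner r u w| ≤ D.rnorm r u * D.rnorm r w :=
  le_of_tendsto (D.tendsto_apply_trunc hu hw).abs
    (Eventually.of_forall fun m => D.abs_apply_trunc_le m hu hw)

theorem embed_apply_basis (D : CHNS Φ) (φ : Φ) (j : ℕ) :
    D.embed φ (D.basis j) = D.ip 0 φ (D.basis j) := rfl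

theorem embed_sum_apply_basis (D : CHNS Φ) (s : Finset ℕ) (c : ℕ → ℝ) (j : ℕ) :
    D.embed (∑ i ∈ s, c i • D.basis i) (D.basis j) = if j ∈ s then c j else 0 := by
  rw [embed_apply_basis, ip_sum_basis]
  simp [wt, D.basis_norm]

theorem embed_mem_neg (D : CHNS Φ) (r : ℕ) (φ : Φ) : D.embed φ ∈ D.neg r := by
  refine D.mem_neg_of_bound r _ (C := D.nrm 0 φ) (apply_nonneg _ _) fun x => ?_
  exact (D.abs_ip_le 0 φ x).trans
    (mul_le_mul_of_nonneg_left (D.increasing 0 r (Nat.zero_le r) x) (apply_nonneg _ _))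

/-- On finite combinations of the basis the series for `θ_r` is a finite sum. Through this identity
the coercivity hypothesis applies to Galerkin approximations. -/
theorem theta_eq_trunc (D : CHNS Φ) (r m : ℕ) (φ : Φ)
    (h : ∀ j, m ≤ j → D.ip 0 φ (D.basis j) = 0) : D.theta r φ = D.trunc r m (D.embed φ) := by
  rw [theta, trunc]
  exact tsum_eq_sum fun j hj => by rw [h j (by simpa using hj)]; simp

/-- A functional is determined by its values on the basis. -/
theorem ext_basis (D : CHNS Φ) {u w : Φ →L[ℝ] ℝ} (h : ∀ j, u (D.basis j) = w (D.basis j)) :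
    u = w := by
  obtain ⟨n, C, -, hb⟩ := D.exists_bound (u - w)
  ext φ
  have := D.eq_zero_of_basis_eq_zero n (u - w).toLinearMap C hb (fun j => by simp [h j]) φ
  exact sub_eq_zero.1 this

theorem sum_abs_coeff_mul_le (D : CHNS Φ) (r : ℕ) (x : ℕ → ℝ)
    (hx : Summable fun j => x j ^ 2 / D.wt r j ^ 2) (φ : Φ) (s : Finset ℕ) :
    ∑ j ∈ s, |D.ip 0 φ (D.basis j) * x j| ≤ √(∑' j, x j ^ 2 / D.wt r j ^ 2) * D.nrm r φ := by
  have hnn : ∀ j, 0 ≤ x j ^ 2 / D.wt r j ^ 2 := fun j => by positivity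
  refine le_of_sq_le_sq ?_ (mul_nonneg (Real.sqrt_nonneg _) (apply_nonneg _ _))
  rw [mul_pow, Real.sq_sqrt (tsum_nonneg hnn)]
  calc (∑ j ∈ s, |D.ip 0 φ (D.basis j) * x j|) ^ 2
      = (∑ j ∈ s, (|x j| / D.wt r j) * (|D.ip 0 φ (D.basis j)| * D.wt r j)) ^ 2 := by
        congr 1
        refine Finset.sum_congr rfl fun j _ => ?_
        have := (D.wt_pos r j).ne'
        rw [abs_mul]; field_simp
    _ ≤ (∑ j ∈ s, (|x j| / D.wt r j) ^ 2) *
          ∑ j ∈ s, (|D.ip 0 φ (D.basis j)| * D.wt r j) ^ 2 :=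
        Finset.sum_mul_sq_le_sq_mul_sq _ _ _
    _ ≤ (∑' j, x j ^ 2 / D.wt r j ^ 2) * D.nrm r φ ^ 2 := by
        simp only [div_pow, mul_pow, sq_abs]
        exact mul_le_mul (hx.sum_le_tsum s fun j _ => hnn j) (D.bessel r φ s)
          (Finset.sum_nonneg fun j _ => by positivity) (tsum_nonneg hnn)

/-- Riesz-Fischer: a square summable sequence of coefficients defines a functional. -/
theorem exists_functional (D : CHNS Φ) (r : ℕ) (x : ℕ → ℝ)
    (hx : Summable fun j => x j ^ 2 / D.wt r j ^ 2) :
    ∃ u : Φ →L[ℝ] ℝ, u ∈ D.neg r ∧ ∀ j, u (D.basis j) = x j := by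
  have hsum : ∀ φ, Summable fun j => D.ip 0 φ (D.basis j) * x j := fun φ =>
    (summable_of_sum_le (fun j => abs_nonneg _) (D.sum_abs_coeff_mul_le r x hx φ)).of_abs
  obtain ⟨L, hL⟩ : ∃ L : Φ →ₗ[ℝ] ℝ, ∀ φ, L φ = ∑' j, D.ip 0 φ (D.basis j) * x j := by
    refine ⟨⟨⟨fun φ => ∑' j, D.ip 0 φ (D.basis j) * x j, fun φ ψ => ?_⟩, fun c φ => ?_⟩,
      fun φ => rfl⟩
    · rw [← (hsum φ).tsum_add (hsum ψ)]
      refine tsum_congr fun j => ?_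
      rw [map_add, LinearMap.add_apply]; ring
    · simp only [RingHom.id_apply, smul_eq_mul]
      rw [← tsum_mul_left]
      refine tsum_congr fun j => ?_
      rw [map_smul, LinearMap.smul_apply, smul_eq_mul]; ring
  have hle : ∀ φ, |L φ| ≤ √(∑' j, x j ^ 2 / D.wt r j ^ 2) * D.nrm r φ := fun φ => by
    rw [hL]
    have h1 := norm_tsum_le_tsum_norm (hsum φ).norm
    simp only [Real.norm_eq_abs] at h1
    exact h1.trans (Real.tsum_le_of_sum_le (fun j => abs_nonneg _)
      (D.sum_abs_coeff_mul_le r x hx φ))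
  obtain ⟨u, hu⟩ := D.exists_clm r L (Real.sqrt_nonneg _) hle
  have hu' : u ∈ D.neg r :=
    D.mem_neg_of_bound r u (Real.sqrt_nonneg _) fun φ => by rw [hu φ]; exact hle φ
  refine ⟨u, hu', fun j => ?_⟩
  rw [hu, hL, tsum_eq_single j fun i hi => by
    rw [D.basis_orthogonal 0 j i (Ne.symm hi), zero_mul], ip_basis_self]
  have h0 : D.wt 0 j = 1 := D.basis_norm j
  rw [h0]; ring

theorem rnorm_embed_basis (D : CHNS Φ) (r j : ℕ) :
    D.rnorm r (D.embed (D.basis j)) = (D.wt r j)⁻¹ := by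
  have h := D.hasSum_rnorm_sq (D.embed_mem_neg r (D.basis j))
  have h2 := hasSum_single (f := fun i => D.embed (D.basis j) (D.basis i) ^ 2 / D.wt r i ^ 2) j
    (fun i hi => by
      rw [embed_apply_basis, D.basis_orthogonal 0 j i (Ne.symm hi)]; simp)
  have h3 := h.unique h2
  rw [embed_apply_basis, ip_basis_self] at h3
  have h4 : D.wt 0 j = 1 := D.basis_norm j
  rw [h4] at h3
  have hp := D.wt_pos r j
  refine (pow_left_inj₀ (D.rnorm_nonneg r _) (by positivity) two_ne_zero).1 ?_
  rw [h3]; simp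

/-- Evaluating the functional `φ_j^{-p}` at `φ_j` bounds its `‖·‖_{-r}` norm from below by `‖φ_j‖_p
/ ‖φ_j‖_r`; only this inequality is needed. -/
theorem summable_of_injectionHS (D : CHNS Φ) {p r : ℕ} (h : D.InjectionHS p r) :
    Summable fun j => D.wt p j ^ 2 / D.wt r j ^ 2 := by
  have key : ∀ j, ENNReal.ofReal (D.wt p j ^ 2 / D.wt r j ^ 2) ≤
      D.dualNorm r (D.negBasis p j) ^ 2 := by
    intro j
    have h1 := D.ofReal_abs_le r (D.negBasis p j) (D.basis j)
    have h2 : D.negBasis p j (D.basis j) = D.wt p j := by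
      rw [negBasis, smul_apply, embed_apply_basis, ip_basis_self]
      have := D.rnorm_embed_basis p j
      rw [rnorm] at this
      rw [this]; simp [wt, D.basis_norm]
    rw [h2, abs_of_pos (D.wt_pos p j)] at h1
    have h3 : ENNReal.ofReal (D.wt p j / D.wt r j) ≤ D.dualNorm r (D.negBasis p j) := by
      rw [ENNReal.ofReal_div_of_pos (D.wt_pos r j)]
      exact ENNReal.div_le_of_le_mul h1
    rw [← div_pow, ENNReal.ofReal_pow (by have := D.wt_pos p j; have := D.wt_pos r j; positivity)]
    gcongr
  have h2 : ∑' j, ENNReal.ofReal (D.wt p j ^ 2 / D.wt r j ^ 2) ≠ ∞ :=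
    ne_of_lt ((ENNReal.tsum_le_tsum key).trans_lt h)
  have h3 := ENNReal.summable_toReal h2
  refine (summable_congr fun j => ?_).1 h3
  exact ENNReal.toReal_ofReal (by positivity)

/-- In a ball of `Φ_{-p}`, coefficientwise convergence implies convergence in `Φ_{-r}` when the
injection `Φ_{-p} → Φ_{-r}` is Hilbert-Schmidt. -/
theorem tendsto_rnorm_of_coeff (D : CHNS Φ) {p r : ℕ}
    (hHS : Summable fun j => D.wt p j ^ 2 / D.wt r j ^ 2) (hpr : p ≤ r) {ι : Type*}
    {l : Filter ι} {u : ι → Φ →L[ℝ] ℝ} {R : ℝ}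
    (hu : ∀ᶠ i in l, u i ∈ D.neg p ∧ D.rnorm p (u i) ≤ R)
    (hc : ∀ j, Tendsto (fun i => u i (D.basis j)) l (𝓝 0)) :
    Tendsto (fun i => D.rnorm r (u i)) l (𝓝 0) := by
  have h1 : Tendsto (fun i => ∑' j, u i (D.basis j) ^ 2 / D.wt r j ^ 2) l
      (𝓝 (∑' _ : ℕ, (0 : ℝ))) := by
    -- In the ball of radius `R` of `Φ_{-p}` the `j`-th coefficient is at most `R ‖φ_j‖_p`, so the
    -- Hilbert-Schmidt sum, multiplied by `R²`, dominates.
    refine tendsto_tsum_of_dominated_convergence (bound := fun j =>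
      R ^ 2 * (D.wt p j ^ 2 / D.wt r j ^ 2)) (hHS.mul_left _) (fun j => ?_) ?_
    · simpa using ((hc j).pow 2).div_const (D.wt r j ^ 2)
    · filter_upwards [hu] with i ⟨hi, hR⟩ j
      rw [Real.norm_of_nonneg (by positivity)]
      have h2 := D.abs_le_rnorm hi (D.basis j)
      have h3 : |u i (D.basis j)| ≤ R * D.wt p j :=
        h2.trans (mul_le_mul_of_nonneg_right hR (apply_nonneg _ _))
      have h4 := pow_le_pow_left₀ (abs_nonneg _) h3 2
      rw [sq_abs, mul_pow] at h4
      rw [← mul_div_assoc]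
      gcongr
  rw [tsum_zero] at h1
  have h2 := (Real.continuous_sqrt.tendsto 0).comp h1
  rw [Real.sqrt_zero] at h2
  refine h2.congr' ?_
  filter_upwards [hu] with i ⟨hi, _⟩
  rw [Function.comp_apply, (D.hasSum_rnorm_sq (D.neg_mono hpr hi)).tsum_eq,
    Real.sqrt_sq (D.rnorm_nonneg _ _)]

end CHNS
end

/-! ### Calculus for primitives of integrable functions: chain rule, Grönwall, Euler's scheme -/

noncomputable section

theorem intervalIntegrable_of_Icc {V : Type*} [NormedAddCommGroup V] {f : ℝ → V} {T a b : ℝ}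
    (hf : IntegrableOn f (Icc 0 T)) (ha : a ∈ Icc 0 T) (hb : b ∈ Icc 0 T) :
    IntervalIntegrable f volume a b :=
  (hf.mono_set (uIcc_subset_Icc ha hb)).intervalIntegrable

theorem integral_mono_endpoint {f : ℝ → ℝ} {T t : ℝ} (hf : IntegrableOn f (Icc 0 T))
    (h0 : ∀ s, 0 ≤ f s) (ht : t ∈ Icc 0 T) : ∫ s in (0 : ℝ)..t, f s ≤ ∫ s in (0 : ℝ)..T, f s := by
  have hT : 0 ≤ T := ht.1.trans ht.2
  rw [← intervalIntegral.integral_add_adjacent_intervals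
    (intervalIntegrable_of_Icc hf ⟨le_rfl, hT⟩ ht) (intervalIntegrable_of_Icc hf ht ⟨hT, le_rfl⟩)]
  linarith [intervalIntegral.integral_nonneg (μ := volume) ht.2 fun s _ => h0 s]

/-- Integrals over `[0,t]` are monotone under a bound valid almost everywhere on `[0,T]`. -/
theorem integral_mono_Icc {f g : ℝ → ℝ} {T t : ℝ} (hf : IntegrableOn f (Icc 0 T))
    (hg : IntegrableOn g (Icc 0 T)) (ht : t ∈ Icc 0 T)
    (h : ∀ᵐ s ∂(volume.restrict (Icc 0 T)), f s ≤ g s) :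
    ∫ s in (0 : ℝ)..t, f s ≤ ∫ s in (0 : ℝ)..t, g s := by
  have h0 : (0 : ℝ) ∈ Icc 0 T := ⟨le_rfl, ht.1.trans ht.2⟩
  refine intervalIntegral.integral_mono_ae_restrict ht.1 (intervalIntegrable_of_Icc hf h0 ht)
    (intervalIntegrable_of_Icc hg h0 ht) ?_
  exact ae_restrict_of_ae_restrict_of_subset (Icc_subset_Icc_right ht.2) h

theorem continuousOn_primitive_Icc {V : Type*} [NormedAddCommGroup V] [NormedSpace ℝ V]
    {f : ℝ → V} {T : ℝ} (hf : IntegrableOn f (Icc 0 T)) :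
    ContinuousOn (fun t => ∫ s in (0 : ℝ)..t, f s) (Icc 0 T) := by
  rcases lt_or_ge T 0 with h | h
  · rw [Icc_eq_empty (not_le.2 h)]; exact continuousOn_empty _
  · have := intervalIntegral.continuousOn_primitive_interval (a := 0) (b := T) (μ := volume)
      (f := f) (by rwa [uIcc_of_le h])
    rwa [uIcc_of_le h] at this

/-- The chain rule for the square of a primitive of an integrable function. -/
theorem sq_eq_add_integral {T x₀ : ℝ} {f x : ℝ → ℝ} (hf : IntegrableOn f (Icc 0 T))
    (hx : ∀ t ∈ Icc 0 T, x t = x₀ + ∫ s in (0 : ℝ)..t, f s) {t : ℝ} (ht : t ∈ Icc 0 T) :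
    x t ^ 2 = x₀ ^ 2 + ∫ s in (0 : ℝ)..t, 2 * (f s * x s) := by
  have h0 : (0 : ℝ) ∈ Icc 0 T := ⟨le_rfl, ht.1.trans ht.2⟩
  have hi := intervalIntegrable_of_Icc hf h0 ht
  let y : ℝ → ℝ := fun r => x₀ + ∫ s in (0 : ℝ)..r, f s
  have hac : AbsolutelyContinuousOnInterval (fun r => ∫ s in (0 : ℝ)..r, f s) 0 t :=
    hi.absolutelyContinuousOnInterval_intervalIntegral (by simp)
  have hc : AbsolutelyContinuousOnInterval (fun _ : ℝ => x₀) 0 t :=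
    ((LipschitzWith.const x₀).lipschitzOnWith (s := uIcc 0 t)).absolutelyContinuousOnInterval
  have hy : AbsolutelyContinuousOnInterval y 0 t := hc.add hac
  have h := hy.integral_deriv_mul_eq_sub hy
  have hd : ∀ᵐ r, r ∈ uIcc 0 t → HasDerivAt y (f r) r := by
    filter_upwards [hi.ae_hasDerivAt_integral] with r hr hr'
    exact (hr hr' 0 (by simp)).const_add x₀
  have hcongr : ∫ r in (0 : ℝ)..t, 2 * (f r * x r) =
      ∫ r in (0 : ℝ)..t, deriv y r * y r + y r * deriv y r := by
    refine intervalIntegral.integral_congr_ae ?_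
    filter_upwards [hd] with r hr hr'
    have hrt := uIoc_subset_uIcc hr'
    rw [(hr hrt).deriv, hx r ⟨?_, ?_⟩]
    · change 2 * (f r * y r) = _; ring
    · rw [uIcc_of_le ht.1] at hrt; exact hrt.1
    · rw [uIcc_of_le ht.1] at hrt; exact hrt.2.trans ht.2
  rw [hcongr, h, hx t ht]
  simp only [y, intervalIntegral.integral_same]
  ring

/-- Grönwall's inequality with an integrable coefficient. -/
theorem le_mul_exp_of_le_add_integral {T c : ℝ} {φ ψ : ℝ → ℝ} (hφ : ContinuousOn φ (Icc 0 T))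
    (hφ0 : ∀ t ∈ Icc 0 T, 0 ≤ φ t) (hψ : IntegrableOn ψ (Icc 0 T)) (hψ0 : ∀ s, 0 ≤ ψ s)
    (h : ∀ t ∈ Icc 0 T, φ t ≤ c + ∫ s in (0 : ℝ)..t, ψ s * φ s) {t : ℝ} (ht : t ∈ Icc 0 T) :
    φ t ≤ c * Real.exp (2 * ∫ s in (0 : ℝ)..T, ψ s) := by
  have hT : 0 ≤ T := ht.1.trans ht.2
  have h0 : (0 : ℝ) ∈ Icc 0 T := ⟨le_rfl, hT⟩
  have hc : 0 ≤ c := by have := h 0 h0; simp at this; exact (hφ0 0 h0).trans this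
  set Ψ : ℝ → ℝ := fun t => ∫ s in (0 : ℝ)..t, ψ s with hΨ
  have hint : IntegrableOn (fun s => ψ s * φ s) (Icc 0 T) :=
    hψ.mul_continuousOn hφ isCompact_Icc
  set v : ℝ → ℝ := fun t => c + ∫ s in (0 : ℝ)..t, ψ s * φ s with hv
  have hdiff : ∀ a ∈ Icc 0 T, ∀ b ∈ Icc 0 T, a ≤ b →
      v b - v a = ∫ s in a..b, ψ s * φ s := by
    intro a ha b hb _
    have := intervalIntegral.integral_add_adjacent_intervals
      (intervalIntegrable_of_Icc hint h0 ha) (intervalIntegrable_of_Icc hint ha hb)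
    simp only [hv]; linarith
  have hΨdiff : ∀ a ∈ Icc 0 T, ∀ b ∈ Icc 0 T, Ψ b - Ψ a = ∫ s in a..b, ψ s := by
    intro a ha b hb
    have := intervalIntegral.integral_add_adjacent_intervals
      (intervalIntegrable_of_Icc hψ h0 ha) (intervalIntegrable_of_Icc hψ ha hb)
    simp only [hΨ]; linarith
  have hvmono : ∀ a ∈ Icc 0 T, ∀ b ∈ Icc 0 T, a ≤ b → v a ≤ v b := by
    intro a ha b hb hab
    have h1 := hdiff a ha b hb hab
    have h2 : 0 ≤ ∫ s in a..b, ψ s * φ s := intervalIntegral.integral_nonneg hab fun s hs =>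
      mul_nonneg (hψ0 s) (hφ0 s ⟨ha.1.trans hs.1, hs.2.trans hb.2⟩)
    linarith
  -- With `x = ∫_a^b ψ ≤ 1/2` and `v` monotone, `v b - v a ≤ x v b`. Since `(1 + 2x)(1 - x) ≥ 1`,
  -- this gives `v b ≤ (1 + 2x) v a ≤ e^{2x} v a`, which is the origin of the factor `2` in the
  -- exponent. The estimate is then iterated over a partition so fine that each step has `x ≤ 1/2`.
  have hstep : ∀ a ∈ Icc 0 T, ∀ b ∈ Icc 0 T, a ≤ b → Ψ b - Ψ a ≤ 1 / 2 →
      v b ≤ v a * Real.exp (2 * (Ψ b - Ψ a)) := by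
    intro a ha b hb hab hle
    have h1 : v b - v a ≤ (Ψ b - Ψ a) * v b := by
      rw [hdiff a ha b hb hab, hΨdiff a ha b hb, ← intervalIntegral.integral_mul_const]
      refine intervalIntegral.integral_mono_on hab (intervalIntegrable_of_Icc hint ha hb)
        ((intervalIntegrable_of_Icc hψ ha hb).mul_const _) fun s hs => ?_
      have hs' : s ∈ Icc 0 T := ⟨ha.1.trans hs.1, hs.2.trans hb.2⟩
      exact mul_le_mul_of_nonneg_left ((h s hs').trans (hvmono s hs' b hb hs.2)) (hψ0 s)
    have h2 : 0 ≤ Ψ b - Ψ a := by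
      rw [hΨdiff a ha b hb]; exact intervalIntegral.integral_nonneg hab fun s _ => hψ0 s
    set x := Ψ b - Ψ a
    have hva : 0 ≤ v a := by
      have := hvmono 0 h0 a ha ha.1
      simp only [hv, intervalIntegral.integral_same] at this
      simp only [hv]; linarith
    have h3 : v b ≤ v a * (1 + 2 * x) := by
      by_contra hcon
      have h4 := mul_lt_mul_of_pos_right (not_le.1 hcon) (by linarith : 0 < 1 - x)
      nlinarith [mul_nonneg (mul_nonneg hva h2) (by linarith : 0 ≤ 1 - 2 * x)]
    refine h3.trans (mul_le_mul_of_nonneg_left ?_ hva)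
    linarith [Real.add_one_le_exp (2 * x)]
  have huc : UniformContinuousOn Ψ (Icc 0 T) :=
    isCompact_Icc.uniformContinuousOn_of_continuous (continuousOn_primitive_Icc hψ)
  obtain ⟨δ, hδ, hδ'⟩ := Metric.uniformContinuousOn_iff.1 huc (1 / 2) (by norm_num)
  obtain ⟨n, hn⟩ := exists_nat_gt (t / δ)
  have hn0 : 0 < (n : ℝ) := lt_of_le_of_lt (div_nonneg ht.1 hδ.le) hn
  have hmem : ∀ k : ℕ, k ≤ n → (k : ℝ) * (t / n) ∈ Icc 0 T := by
    intro k hk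
    have : 0 ≤ t / n := div_nonneg ht.1 hn0.le
    refine ⟨by positivity, le_trans ?_ ht.2⟩
    calc (k : ℝ) * (t / n) ≤ n * (t / n) := by gcongr
      _ = t := by field_simp
  have hind : ∀ k : ℕ, k ≤ n → v (k * (t / n)) ≤ c * Real.exp (2 * Ψ (k * (t / n))) := by
    intro k
    induction k with
    | zero => intro _; simp [hv, hΨ]
    | succ k ih =>
      intro hk
      have ha := hmem k (by omega)
      have hb := hmem (k + 1) hk
      have htn : 0 ≤ t / n := div_nonneg ht.1 hn0.le
      have hab : (k : ℝ) * (t / n) ≤ ((k + 1 : ℕ) : ℝ) * (t / n) := by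
        push_cast; nlinarith
      have hd : dist (((k + 1 : ℕ) : ℝ) * (t / n)) ((k : ℝ) * (t / n)) < δ := by
        rw [Real.dist_eq]; push_cast
        have : ((k : ℝ) + 1) * (t / n) - k * (t / n) = t / n := by ring
        rw [this, abs_of_nonneg htn, div_lt_iff₀ hn0]
        rw [div_lt_iff₀ hδ] at hn; linarith
      have h1 := hδ' _ hb _ ha hd
      rw [Real.dist_eq] at h1
      have h2 := hstep _ ha _ hb hab ((le_abs_self _).trans h1.le)
      refine h2.trans ((mul_le_mul_of_nonneg_right (ih (by omega)) (Real.exp_pos _).le).trans ?_)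
      rw [mul_assoc, ← Real.exp_add]
      apply le_of_eq; congr 2; ring
  have hfin := hind n le_rfl
  have htt : (n : ℝ) * (t / n) = t := by field_simp
  rw [htt] at hfin
  refine (h t ht).trans (hfin.trans ?_)
  gcongr
  exact integral_mono_endpoint hψ hψ0 ht

/-- A step function takes finitely many values on `[0,T]`, so the composition is glued from finitely
many integrable pieces. -/
theorem integrableOn_comp_step {V W : Type*} [NormedAddCommGroup V] {T : ℝ}
    {F : ℝ → W → V} (hF : ∀ x, IntegrableOn (fun s => F s x) (Icc 0 T)) (k : ℝ → ℕ)
    (hk : Measurable k) {n : ℕ} (hkn : ∀ s ∈ Icc 0 T, k s ≤ n) (x : ℕ → W) :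
    IntegrableOn (fun s => F s (x (k s))) (Icc 0 T) := by
  have h1 : Icc 0 T = ⋃ i ∈ Finset.range (n + 1), (Icc 0 T ∩ k ⁻¹' {i}) := by
    ext s
    simp only [Finset.mem_range, mem_iUnion, mem_inter_iff, mem_preimage, mem_singleton_iff,
      exists_prop]
    constructor
    · intro hs; exact ⟨k s, Nat.lt_succ_of_le (hkn s hs), hs, rfl⟩
    · rintro ⟨i, _, hs, _⟩; exact hs
  rw [h1, integrableOn_finset_iUnion]
  intro i _
  have hm : MeasurableSet (Icc 0 T ∩ k ⁻¹' {i}) :=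
    measurableSet_Icc.inter (hk (measurableSet_singleton i))
  refine IntegrableOn.congr_fun ((hF (x i)).mono_set inter_subset_left) ?_ hm
  rintro s ⟨_, hs⟩
  simp only [mem_preimage, mem_singleton_iff] at hs
  simp only [hs]

/-- Euler's scheme for a drift of linear growth that is merely integrable in time. -/
theorem exists_euler {V : Type*} [NormedAddCommGroup V] [NormedSpace ℝ V] [CompleteSpace V]
    {T : ℝ} (hT : 0 < T) {F : ℝ → V → V} (hF : ∀ x, IntegrableOn (fun s => F s x) (Icc 0 T))
    {χ : ℝ → ℝ} (hχ : IntegrableOn χ (Icc 0 T)) (hχ0 : ∀ s, 0 ≤ χ s)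
    (hgrow : ∀ᵐ s ∂(volume.restrict (Icc 0 T)), ∀ x, ‖F s x‖ ≤ χ s * (1 + ‖x‖))
    (x₀ : V) {ε : ℝ} (hε : 0 < ε) :
    ∃ X Y : ℝ → V, StronglyMeasurable Y ∧ IntegrableOn (fun s => F s (Y s)) (Icc 0 T) ∧
      (∀ t ∈ Icc 0 T, X t = x₀ + ∫ s in (0 : ℝ)..t, F s (Y s)) ∧
      ∃ η, 0 ≤ η ∧ η ≤ ε ∧ (∀ t ∈ Icc 0 T, ‖X t - Y t‖ ≤ η) ∧
        η * ∫ s in (0 : ℝ)..T, ‖F s (Y s)‖ ≤ ε := by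
  have h0 : (0 : ℝ) ∈ Icc 0 T := ⟨le_rfl, hT.le⟩
  set Ψ : ℝ → ℝ := fun t => ∫ s in (0 : ℝ)..t, χ s with hΨ
  have hΨT : 0 ≤ Ψ T := intervalIntegral.integral_nonneg hT.le fun s _ => hχ0 s
  set B : ℝ := (1 + ‖x₀‖) * Real.exp (Ψ T) with hB
  have hBpos : 0 < B := by positivity
  have huc : UniformContinuousOn Ψ (Icc 0 T) :=
    isCompact_Icc.uniformContinuousOn_of_continuous (continuousOn_primitive_Icc hχ)
  -- `B` will bound `1 + ‖x_k‖` at all nodes, and `ω` bounds the integral of `χ` over one time step.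
  -- The freezing error is then `η = B ω`, while `∫ ‖F‖ ≤ B Ψ(T)`; this choice makes both `η` and `η
  -- ∫ ‖F‖` at most `ε`.
  set ω : ℝ := ε / (B * (1 + B * Ψ T)) with hω
  have hωpos : 0 < ω := by positivity
  obtain ⟨δ, hδ, hδ'⟩ := Metric.uniformContinuousOn_iff.1 huc ω hωpos
  obtain ⟨n, hn⟩ := exists_nat_gt (T / δ)
  have hn0 : 0 < (n : ℝ) := lt_of_le_of_lt (div_nonneg hT.le hδ.le) hn
  set h : ℝ := T / n with hh
  have hpos : 0 < h := by positivity
  have hhδ : h < δ := by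
    rw [hh, div_lt_iff₀ hn0]; rw [div_lt_iff₀ hδ] at hn; linarith
  have hnh : (n : ℝ) * h = T := by rw [hh]; field_simp
  let x : ℕ → V := fun k => Nat.rec x₀
    (fun k y => y + ∫ s in (k * h : ℝ)..((k + 1 : ℕ) * h : ℝ), F s y) k
  have hx_succ : ∀ k, x (k + 1) =
      x k + ∫ s in (k * h : ℝ)..((k + 1 : ℕ) * h : ℝ), F s (x k) := fun k => rfl
  let κ : ℝ → ℕ := fun s => ⌊s / h⌋₊
  have hκm : Measurable κ := Nat.measurable_floor.comp (measurable_id.div_const h)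
  have hκn : ∀ s ∈ Icc 0 T, κ s ≤ n := by
    intro s hs
    refine Nat.floor_le_of_le ?_
    rw [div_le_iff₀ hpos, hnh]; exact hs.2
  have hκlow : ∀ s ∈ Icc 0 T, (κ s : ℝ) * h ≤ s := by
    intro s hs
    rw [← le_div_iff₀ hpos]; exact Nat.floor_le (div_nonneg hs.1 hpos.le)
  have hκup : ∀ s, s < (κ s + 1) * h := by
    intro s
    rw [← div_lt_iff₀ hpos]; exact Nat.lt_floor_add_one _
  have hκeq : ∀ (k : ℕ) s, k * h ≤ s → s < (k + 1) * h → κ s = k := by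
    intro k s h1 h2
    have hs0 : 0 ≤ s := le_trans (by positivity) h1
    rw [← le_div_iff₀ hpos] at h1
    rw [← div_lt_iff₀ hpos] at h2
    exact (Nat.floor_eq_iff (div_nonneg hs0 hpos.le)).2 ⟨h1, h2⟩
  have hkmem : ∀ k : ℕ, k ≤ n → (k : ℝ) * h ∈ Icc 0 T := by
    intro k hk
    refine ⟨by positivity, ?_⟩
    rw [← hnh]; gcongr
  have hint := integrableOn_comp_step hF κ hκm hκn x
  let Y : ℝ → V := fun s => x (κ s)
  let X : ℝ → V := fun t => x₀ + ∫ s in (0 : ℝ)..t, F s (Y s)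
  have hXk : ∀ k : ℕ, k ≤ n → X (k * h) = x k := by
    intro k
    induction k with
    | zero => intro _; simp [X, x]
    | succ k ih =>
      intro hk
      have ha := hkmem k (by omega)
      have hb := hkmem (k + 1) hk
      have h1 := intervalIntegral.integral_add_adjacent_intervals
        (intervalIntegrable_of_Icc hint h0 ha) (intervalIntegrable_of_Icc hint ha hb)
      -- At the right endpoint `κ` has already jumped to `k + 1`, so the integrands are compared on
      -- the open interval.
      have h2 : ∫ s in (k * h : ℝ)..((k + 1 : ℕ) * h : ℝ), F s (x (κ s)) =
          ∫ s in (k * h : ℝ)..((k + 1 : ℕ) * h : ℝ), F s (x k) := by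
        have hle : (k : ℝ) * h ≤ ((k + 1 : ℕ) : ℝ) * h := by push_cast; nlinarith
        rw [intervalIntegral.integral_of_le hle, intervalIntegral.integral_of_le hle,
          integral_Ioc_eq_integral_Ioo, integral_Ioc_eq_integral_Ioo]
        refine setIntegral_congr_fun measurableSet_Ioo fun s hs => ?_
        have := hκeq k s hs.1.le (by have := hs.2; push_cast at this; exact this)
        simp only [this]
      have h3 := ih (by omega)
      simp only [X, Y] at h3 ⊢
      rw [← h1, ← add_assoc, h3, h2, hx_succ]
  have hdΨ : ∀ a ∈ Icc 0 T, ∀ b ∈ Icc 0 T, Ψ b - Ψ a = ∫ s in a..b, χ s := by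
    intro a ha b hb
    have := intervalIntegral.integral_add_adjacent_intervals
      (intervalIntegrable_of_Icc hχ h0 ha) (intervalIntegrable_of_Icc hχ ha hb)
    simp only [hΨ]; linarith
  have hseg : ∀ y : V, ∀ a ∈ Icc 0 T, ∀ b ∈ Icc 0 T, a ≤ b →
      ‖∫ s in a..b, F s y‖ ≤ (Ψ b - Ψ a) * (1 + ‖y‖) := by
    intro y a ha b hb hab
    rw [hdΨ a ha b hb, ← intervalIntegral.integral_mul_const]
    refine intervalIntegral.norm_integral_le_of_norm_le hab ?_
      ((intervalIntegrable_of_Icc hχ ha hb).mul_const _)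
    have := (ae_restrict_iff' measurableSet_Icc).1 hgrow
    filter_upwards [this] with s hs hs'
    exact hs ⟨ha.1.trans hs'.1.le, hs'.2.trans hb.2⟩ y
  -- Discrete Grönwall: each step multiplies `1 + ‖x_k‖` by at most `1 + ΔΨ ≤ e^{ΔΨ}`, and the
  -- exponents telescope.
  have hxbd : ∀ k : ℕ, k ≤ n → 1 + ‖x k‖ ≤ (1 + ‖x₀‖) * Real.exp (Ψ (k * h)) := by
    intro k
    induction k with
    | zero => intro _; simp [x, hΨ]
    | succ k ih =>
      intro hk
      have ha := hkmem k (by omega)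
      have hb := hkmem (k + 1) hk
      have hle : (k : ℝ) * h ≤ ((k + 1 : ℕ) : ℝ) * h := by push_cast; nlinarith
      have h1 := hseg (x k) _ ha _ hb hle
      have h2 : ‖x (k + 1)‖ ≤ ‖x k‖ + (Ψ ((k + 1 : ℕ) * h) - Ψ (k * h)) * (1 + ‖x k‖) := by
        rw [hx_succ]; exact (norm_add_le _ _).trans (by gcongr)
      have h3 := Real.add_one_le_exp (Ψ ((k + 1 : ℕ) * h) - Ψ (k * h))
      calc 1 + ‖x (k + 1)‖
          ≤ (1 + ‖x k‖) * ((Ψ ((k + 1 : ℕ) * h) - Ψ (k * h)) + 1) := by linarith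
        _ ≤ ((1 + ‖x₀‖) * Real.exp (Ψ (k * h))) *
              Real.exp (Ψ ((k + 1 : ℕ) * h) - Ψ (k * h)) := by
            refine mul_le_mul (ih (by omega)) h3 ?_ (by positivity)
            have : 0 ≤ Ψ ((k + 1 : ℕ) * h) - Ψ (k * h) := by
              rw [hdΨ _ ha _ hb]
              exact intervalIntegral.integral_nonneg hle fun s _ => hχ0 s
            linarith
        _ = _ := by rw [mul_assoc, ← Real.exp_add]; congr 2; ring
  have hxB : ∀ k : ℕ, k ≤ n → 1 + ‖x k‖ ≤ B := by
    intro k hk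
    refine (hxbd k hk).trans ?_
    rw [hB]; gcongr
    exact integral_mono_endpoint hχ hχ0 (hkmem k hk)
  have hXY : ∀ t ∈ Icc 0 T, ‖X t - Y t‖ ≤ B * ω := by
    intro t ht
    have hk := hκn t ht
    have ha := hkmem _ hk
    have hle := hκlow t ht
    have h1 := intervalIntegral.integral_add_adjacent_intervals
      (intervalIntegrable_of_Icc hint h0 ha) (intervalIntegrable_of_Icc hint ha ht)
    have h2 : ∫ s in ((κ t : ℝ) * h)..t, F s (x (κ s)) =
        ∫ s in ((κ t : ℝ) * h)..t, F s (x (κ t)) := by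
      refine intervalIntegral.integral_congr fun s hs => ?_
      rw [uIcc_of_le hle] at hs
      have := hκeq (κ t) s hs.1 (hs.2.trans_lt (hκup t))
      simp only [this]
    have h3 : X t - Y t = ∫ s in ((κ t : ℝ) * h)..t, F s (x (κ t)) := by
      rw [← h2]
      have h4 := hXk _ hk
      simp only [X, Y] at h4 ⊢
      rw [← h4, ← h1]; abel
    rw [h3]
    refine (hseg _ _ ha _ ht hle).trans ?_
    rw [mul_comm]
    have h5 : dist t ((κ t : ℝ) * h) < δ := by
      rw [Real.dist_eq, abs_of_nonneg (by linarith)]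
      have := hκup t
      nlinarith
    have h6 := hδ' _ ht _ ha h5
    rw [Real.dist_eq] at h6
    have h7 : 0 ≤ Ψ t - Ψ ((κ t : ℝ) * h) := by
      rw [hdΨ _ ha _ ht]; exact intervalIntegral.integral_nonneg hle fun s _ => hχ0 s
    exact mul_le_mul (hxB _ hk) ((le_abs_self _).trans h6.le) h7 hBpos.le
  have hFn : ∫ s in (0 : ℝ)..T, ‖F s (Y s)‖ ≤ B * Ψ T := by
    rw [mul_comm, hΨ, ← intervalIntegral.integral_mul_const]
    refine integral_mono_Icc hint.norm (hχ.mul_const B) ⟨hT.le, le_rfl⟩ ?_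
    filter_upwards [hgrow, ae_restrict_mem measurableSet_Icc] with s hs hs'
    exact (hs _).trans (mul_le_mul_of_nonneg_left (hxB _ (hκn s hs')) (hχ0 s))
  have hle1 : B * ω = ε / (1 + B * Ψ T) := by rw [hω]; field_simp
  refine ⟨X, Y, ?_, hint, fun t _ => rfl, B * ω, by positivity, ?_, hXY, ?_⟩
  · have hx : StronglyMeasurable x := StronglyMeasurable.of_discrete
    exact hx.comp_measurable hκm
  · rw [hle1]; exact div_le_self hε.le (by nlinarith [mul_nonneg hBpos.le hΨT])
  · rw [hle1, div_mul_eq_mul_div, div_le_iff₀ (by positivity)]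
    refine mul_le_mul_of_nonneg_left (hFn.trans (by linarith)) hε.le

end

/-! ### Abstract drift equations and their Galerkin approximations -/

noncomputable section

variable {Φ : Type*} [AddCommGroup Φ] [Module ℝ Φ] [UniformSpace Φ] [IsUniformAddGroup Φ]

/-- A drift `F` on the scale `Φ_{-p} ⊂ Φ_{-p₁} ⊂ Φ_{-q}`: for almost every time it has linear
growth, is coercive in `Φ_{-p}`, one-sided Lipschitz in `Φ_{-q}` and demicontinuous on `Φ_{-p₁}`,
with constants that are integrable in time. -/
structure DriftConditions (D : CHNS Φ) (T : ℝ) (p p₁ q : ℕ)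
    (F : ℝ → (Φ →L[ℝ] ℝ) → (Φ →L[ℝ] ℝ)) (χ : ℝ → ℝ) : Prop where
  pos : 0 < T
  le₁ : p ≤ p₁
  le₂ : p₁ ≤ q
  hilbertSchmidt : Summable fun j => D.wt p j ^ 2 / D.wt p₁ j ^ 2
  integrable : IntegrableOn χ (Icc 0 T)
  nonneg : ∀ s, 0 ≤ χ s
  measurable : ∀ Y : ℝ → (Φ →L[ℝ] ℝ), (∀ φ, Measurable fun s => Y s φ) → (∀ s, Y s ∈ D.neg p₁) →
    ∀ φ, AEStronglyMeasurable (fun s => F s (Y s) φ) (volume.restrict (Icc 0 T))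
  growth : ∀ᵐ s ∂(volume.restrict (Icc 0 T)), ∀ u ∈ D.neg p₁,
    F s u ∈ D.neg q ∧ D.rnorm q (F s u) ≤ χ s * (1 + D.rnorm p₁ u)
  coercive : ∀ᵐ s ∂(volume.restrict (Icc 0 T)), ∀ (m : ℕ) (φ : Φ),
    (∀ j, m ≤ j → D.ip 0 φ (D.basis j) = 0) →
    2 * F s (D.embed φ) (D.trunc p m (D.embed φ)) ≤ χ s * (1 + D.rnorm p (D.embed φ) ^ 2)
  monotone : ∀ᵐ s ∂(volume.restrict (Icc 0 T)), ∀ u₁ ∈ D.neg p₁, ∀ u₂ ∈ D.neg p₁,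
    2 * D.dualInner q (F s u₁ - F s u₂) (u₁ - u₂) ≤ χ s * D.rnorm q (u₁ - u₂) ^ 2
  continuous : ∀ᵐ s ∂(volume.restrict (Icc 0 T)), ∀ u ∈ D.neg p₁, ∀ w : ℕ → (Φ →L[ℝ] ℝ),
    (∀ n, w n ∈ D.neg p₁) → Tendsto (fun n => D.rnorm p₁ (w n - u)) atTop (𝓝 0) →
    ∀ φ, Tendsto (fun n => F s (w n) φ) atTop (𝓝 (F s u φ))

/-- A continuous `Φ_{-r}`-valued solution of `X_t = X₀ + ∫_0^t F(s, X_s) ds` on `[0,T]`. -/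
structure IsDriftSolution (D : CHNS Φ) (T : ℝ) (r : ℕ)
    (F : ℝ → (Φ →L[ℝ] ℝ) → (Φ →L[ℝ] ℝ)) (X₀ : Φ →L[ℝ] ℝ) (X : ℝ → (Φ →L[ℝ] ℝ)) : Prop where
  mem : ∀ t ∈ Icc 0 T, X t ∈ D.neg r
  cont : ∀ t ∈ Icc 0 T, Tendsto (fun s => D.rnorm r (X s - X t)) (𝓝[Icc 0 T] t) (𝓝 0)
  integrable : ∀ φ, IntegrableOn (fun s => F s (X s) φ) (Icc 0 T)
  eqn : ∀ t ∈ Icc 0 T, ∀ φ, X t φ = X₀ φ + ∫ s in (0 : ℝ)..t, F s (X s) φ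

/-- A Galerkin approximation of level `d` with a frozen state `Y` within `ε` of the solution `X`. -/
structure IsGalerkin (D : CHNS Φ) (T : ℝ) (p : ℕ)
    (F : ℝ → (Φ →L[ℝ] ℝ) → (Φ →L[ℝ] ℝ)) (X₀ : Φ →L[ℝ] ℝ) (d : ℕ) (ε : ℝ)
    (X Y : ℝ → (Φ →L[ℝ] ℝ)) : Prop where
  mem_X : ∀ t r, X t ∈ D.neg r
  mem_Y : ∀ t r, Y t ∈ D.neg r
  embed_Y : ∀ t, ∃ φ, Y t = D.embed φ
  zero_X : ∀ t j, d ≤ j → X t (D.basis j) = 0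
  zero_Y : ∀ t j, d ≤ j → Y t (D.basis j) = 0
  measurable_Y : ∀ φ, Measurable fun t => Y t φ
  integrable : ∀ j < d, IntegrableOn (fun s => F s (Y s) (D.basis j)) (Icc 0 T)
  eqn : ∀ t ∈ Icc 0 T, ∀ j, j < d →
    X t (D.basis j) = X₀ (D.basis j) + ∫ s in (0 : ℝ)..t, F s (Y s) (D.basis j)
  close : ∀ t ∈ Icc 0 T, D.rnorm p (X t - Y t) ≤ ε
  small : ∃ η, (∀ t ∈ Icc 0 T, ∀ j, |X t (D.basis j) - Y t (D.basis j)| ≤ η) ∧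
    η * ∫ s in (0 : ℝ)..T, ∑ j ∈ Finset.range d, |F s (Y s) (D.basis j)| ≤ ε

/-- The energy identity. With `c j = ‖φ_j‖_r²`, the left side is the squared norm in `Φ_{-r}` of a
functional with finitely many coefficients, or a partial sum of it. -/
theorem sum_sq_eq_add_integral {T : ℝ} (m : ℕ) (c x₀ : ℕ → ℝ) {f x : ℕ → ℝ → ℝ}
    (hf : ∀ j < m, IntegrableOn (f j) (Icc 0 T))
    (hx : ∀ j < m, ∀ t ∈ Icc 0 T, x j t = x₀ j + ∫ s in (0 : ℝ)..t, f j s)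
    {t : ℝ} (ht : t ∈ Icc 0 T) :
    ∑ j ∈ Finset.range m, x j t ^ 2 / c j = ∑ j ∈ Finset.range m, x₀ j ^ 2 / c j +
      ∫ s in (0 : ℝ)..t, 2 * ∑ j ∈ Finset.range m, f j s * x j s / c j := by
  have h0 : (0 : ℝ) ∈ Icc 0 T := ⟨le_rfl, ht.1.trans ht.2⟩
  simp only [Finset.mul_sum]
  rw [intervalIntegral.integral_finsetSum, ← Finset.sum_add_distrib]
  · refine Finset.sum_congr rfl fun j hj => ?_
    have hj' := Finset.mem_range.1 hj
    rw [sq_eq_add_integral (hf j hj') (hx j hj') ht, add_div, ← intervalIntegral.integral_div]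
    congr 1
    refine intervalIntegral.integral_congr fun s _ => by ring
  · intro j hj
    have hj' := Finset.mem_range.1 hj
    have hc : ContinuousOn (x j) (Icc 0 T) :=
      (continuousOn_const.add (continuousOn_primitive_Icc (hf j hj'))).congr (hx j hj')
    have := (intervalIntegrable_of_Icc ((hf j hj').mul_continuousOn hc isCompact_Icc) h0 ht)
    exact (this.div_const (c j)).const_mul 2

namespace DriftConditions

variable {D : CHNS Φ} {T : ℝ} {p p₁ q : ℕ} {F : ℝ → (Φ →L[ℝ] ℝ) → (Φ →L[ℝ] ℝ)} {χ : ℝ → ℝ}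

theorem abs_apply_le (h : DriftConditions D T p p₁ q F χ) : ∀ᵐ s ∂(volume.restrict (Icc 0 T)),
    ∀ u ∈ D.neg p₁, ∀ φ, |F s u φ| ≤ χ s * (1 + D.rnorm p₁ u) * D.nrm q φ := by
  filter_upwards [h.growth] with s hs u hu φ
  obtain ⟨h1, h2⟩ := hs u hu
  exact (D.abs_le_rnorm h1 φ).trans (mul_le_mul_of_nonneg_right h2 (apply_nonneg _ _))

theorem integrableOn_comp (h : DriftConditions D T p p₁ q F χ) {Y : ℝ → (Φ →L[ℝ] ℝ)}
    (hY : ∀ φ, Measurable fun s => Y s φ) (hm : ∀ s, Y s ∈ D.neg p₁) {R : ℝ}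
    (hR : ∀ s ∈ Icc 0 T, D.rnorm p₁ (Y s) ≤ R) (φ : Φ) :
    IntegrableOn (fun s => F s (Y s) φ) (Icc 0 T) := by
  refine Integrable.mono' ((h.integrable.mul_const (1 + R)).mul_const (D.nrm q φ))
    (h.measurable Y hY hm φ) ?_
  filter_upwards [h.abs_apply_le, ae_restrict_mem measurableSet_Icc] with s hs hsT
  refine (hs _ (hm s) φ).trans ?_
  have := hR s hsT
  have := h.nonneg s
  have : 0 ≤ D.nrm q φ := apply_nonneg _ _
  gcongr

/-- Euler's scheme in `ℝ^d` for the first `d` coefficients. An approximate solution suffices,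
because the errors it produces are integrated against `F` and are controlled by the two smallness
properties of the scheme. -/
theorem exists_galerkin (h : DriftConditions D T p p₁ q F χ) (X₀ : Φ →L[ℝ] ℝ) (d : ℕ) {ε : ℝ}
    (hε : 0 < ε) : ∃ X Y, IsGalerkin D T p F X₀ d ε X Y := by
  let e : (Fin d → ℝ) → ℕ → ℝ := fun v i => if hi : i < d then v ⟨i, hi⟩ else 0
  let st : (Fin d → ℝ) → (Φ →L[ℝ] ℝ) := fun v =>
    D.embed (∑ i ∈ Finset.range d, e v i • D.basis i)
  have hst : ∀ v j, st v (D.basis j) = e v j := by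
    intro v j
    simp only [st]
    rw [D.embed_sum_apply_basis]
    by_cases hj : j < d <;> simp [e, hj]
  have he_abs : ∀ v j, |e v j| ≤ ‖v‖ := by
    intro v j
    by_cases hj : j < d
    · simp only [e, hj, dif_pos]; exact norm_le_pi_norm v _
    · simp only [e, hj, dif_neg, not_false_iff, abs_zero]; exact norm_nonneg v
  have hmem : ∀ v r, st v ∈ D.neg r := fun v r => D.embed_mem_neg r _
  have hnorm : ∀ v r, D.rnorm r (st v) ≤ d * ‖v‖ := by
    intro v r
    refine le_of_sq_le_sq ?_ (by positivity)
    have h1 := D.hasSum_rnorm_sq (hmem v r)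
    have h2 : HasSum (fun j => st v (D.basis j) ^ 2 / D.wt r j ^ 2)
        (∑ j ∈ Finset.range d, st v (D.basis j) ^ 2 / D.wt r j ^ 2) :=
      hasSum_sum_of_ne_finset_zero fun j hj => by
        rw [hst]; simp [e, (by simpa using hj : ¬ j < d)]
    rw [h1.unique h2]
    calc ∑ j ∈ Finset.range d, st v (D.basis j) ^ 2 / D.wt r j ^ 2
        ≤ ∑ j ∈ Finset.range d, ‖v‖ ^ 2 := by
          refine Finset.sum_le_sum fun j _ => ?_
          rw [hst]
          have h3 := pow_le_pow_left₀ (abs_nonneg _) (he_abs v j) 2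
          rw [sq_abs] at h3
          exact (div_le_self (sq_nonneg _) (one_le_pow₀ (D.one_le_wt r j))).trans h3
      _ = d * ‖v‖ ^ 2 := by simp
      _ ≤ (d * ‖v‖) ^ 2 := by
          rw [mul_pow]
          refine mul_le_mul_of_nonneg_right ?_ (sq_nonneg _)
          norm_cast
          exact Nat.le_self_pow two_ne_zero d
  have hlin : ∀ v w, st (v - w) = st v - st w := by
    intro v w
    refine D.ext_basis fun j => ?_
    rw [sub_apply, hst, hst, hst]
    by_cases hj : j < d <;> simp [e, hj]
  have hmeas : ∀ Y : ℝ → (Fin d → ℝ), Measurable Y → ∀ φ, Measurable fun t => st (Y t) φ := by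
    intro Y hY φ
    have : (fun t => st (Y t) φ) =
        fun t => ∑ i ∈ Finset.range d, e (Y t) i * D.ip 0 (D.basis i) φ := by
      funext t
      change D.ip 0 (∑ i ∈ Finset.range d, e (Y t) i • D.basis i) φ = _
      simp only [map_sum, map_smul, LinearMap.sum_apply, LinearMap.smul_apply, smul_eq_mul]
    rw [this]
    refine Finset.measurable_sum _ fun i hi => Measurable.mul_const ?_ _
    simp only [e, Finset.mem_range.1 hi, dif_pos]
    exact (measurable_pi_apply _).comp hY
  let FV : ℝ → (Fin d → ℝ) → (Fin d → ℝ) := fun s v i => F s (st v) (D.basis i)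
  set c : ℝ := ∑ i ∈ Finset.range d, D.wt q i with hc
  have hc0 : 0 ≤ c := Finset.sum_nonneg fun i _ => (D.wt_pos q i).le
  have hgrow : ∀ᵐ s ∂(volume.restrict (Icc 0 T)), ∀ v,
      ‖FV s v‖ ≤ (χ s * (c * (1 + d))) * (1 + ‖v‖) := by
    filter_upwards [h.abs_apply_le] with s hs v
    have hχ := h.nonneg s
    refine (pi_norm_le_iff_of_nonneg (by positivity)).2 fun i => ?_
    refine (hs _ (hmem v p₁) (D.basis i)).trans ?_
    have h1 : D.nrm q (D.basis i) ≤ c :=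
      Finset.single_le_sum (f := fun i => D.wt q i) (fun i _ => (D.wt_pos q i).le)
        (Finset.mem_range.2 i.2)
    have h2 := hnorm v p₁
    have h3 : 1 + D.rnorm p₁ (st v) ≤ (1 + d) * (1 + ‖v‖) := by
      have : 0 ≤ (d : ℝ) := by positivity
      nlinarith [norm_nonneg v]
    calc χ s * (1 + D.rnorm p₁ (st v)) * D.nrm q (D.basis i)
        ≤ χ s * ((1 + d) * (1 + ‖v‖)) * c := by
          gcongr
      _ = _ := by ring
  have hFj : ∀ v i, IntegrableOn (fun s => F s (st v) (D.basis i)) (Icc 0 T) := fun v i =>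
    h.integrableOn_comp (fun _ => measurable_const) (fun _ => hmem v p₁)
      (fun _ _ => le_rfl) (D.basis i)
  have hFV : ∀ v, IntegrableOn (fun s => FV s v) (Icc 0 T) := fun v =>
    Integrable.of_eval fun i => hFj v i
  -- Passing from the sup norm of `ℝ^d` to the norm of `Φ_{-p}`, or to the sum of the coefficients
  -- of `F`, costs a factor `d`, which the tolerance `ε / (d + 1)` absorbs.
  obtain ⟨X, Y, hYm, hint, hX, η, hη0, hηε, hXY, hsmall⟩ := exists_euler h.pos hFV
    (h.integrable.mul_const (c * (1 + d)))
    (fun s => mul_nonneg (h.nonneg s) (by positivity)) hgrow (fun i => X₀ (D.basis i))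
    (ε := ε / (d + 1)) (by positivity)
  have hd1 : (d : ℝ) / (d + 1) ≤ 1 := by rw [div_le_one (by positivity)]; linarith
  have hintj : ∀ i : Fin d, IntegrableOn (fun s => F s (st (Y s)) (D.basis i)) (Icc 0 T) :=
    fun i => hint.eval i
  refine ⟨fun t => st (X t), fun t => st (Y t), fun t r => hmem _ r, fun t r => hmem _ r,
    fun t => ⟨_, rfl⟩, fun t j hj => ?_, fun t j hj => ?_, hmeas Y hYm.measurable,
    fun j hj => hintj ⟨j, hj⟩, ?_, ?_, η, ?_, ?_⟩
  · rw [hst]; simp [e, not_lt.2 hj]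
  · rw [hst]; simp [e, not_lt.2 hj]
  · intro t ht j hj
    have h1 : (∫ s in (0 : ℝ)..t, FV s (Y s)) ⟨j, hj⟩ =
        ∫ s in (0 : ℝ)..t, F s (st (Y s)) (D.basis j) := by
      rw [intervalIntegral.integral_of_le ht.1, intervalIntegral.integral_of_le ht.1,
        eval_integral]
      intro i
      exact (hintj i).mono_set (fun s hs => ⟨hs.1.le, hs.2.trans ht.2⟩)
    rw [hst]
    simp only [e, hj, dif_pos]
    rw [hX t ht, Pi.add_apply, h1]
  · intro t ht
    rw [← hlin]
    refine (hnorm _ p).trans ?_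
    calc (d : ℝ) * ‖X t - Y t‖ ≤ d * (ε / (d + 1)) := by
          have := (hXY t ht).trans hηε
          gcongr
      _ = (d / (d + 1)) * ε := by ring
      _ ≤ ε := by nlinarith
  · intro t ht j
    rw [← sub_apply, ← hlin, hst]
    exact (he_abs _ j).trans (hXY t ht)
  · have h1 : ∫ s in (0 : ℝ)..T, ∑ j ∈ Finset.range d, |F s (st (Y s)) (D.basis j)| ≤
        d * ∫ s in (0 : ℝ)..T, ‖FV s (Y s)‖ := by
      rw [← intervalIntegral.integral_const_mul]
      refine integral_mono_Icc ?_ (hint.norm.const_mul _) ⟨h.pos.le, le_rfl⟩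
        (Eventually.of_forall fun s => ?_)
      · exact integrable_finsetSum _ fun j hj => (hintj ⟨j, Finset.mem_range.1 hj⟩).abs
      · calc ∑ j ∈ Finset.range d, |F s (st (Y s)) (D.basis j)|
            ≤ ∑ j ∈ Finset.range d, ‖FV s (Y s)‖ := Finset.sum_le_sum fun j hj =>
              norm_le_pi_norm (FV s (Y s)) ⟨j, Finset.mem_range.1 hj⟩
          _ = _ := by simp
    calc η * ∫ s in (0 : ℝ)..T, ∑ j ∈ Finset.range d, |F s (st (Y s)) (D.basis j)|
        ≤ η * (d * ∫ s in (0 : ℝ)..T, ‖FV s (Y s)‖) := by gcongr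
      _ = d * (η * ∫ s in (0 : ℝ)..T, ‖FV s (Y s)‖) := by ring
      _ ≤ d * (ε / (d + 1)) := by gcongr
      _ = (d / (d + 1)) * ε := by ring
      _ ≤ ε := by nlinarith

end DriftConditions
end

/-! ### Energy estimate and comparison of Galerkin approximations -/

noncomputable section

variable {Φ : Type*} [AddCommGroup Φ] [Module ℝ Φ] [UniformSpace Φ] [IsUniformAddGroup Φ]

namespace CHNS

theorem rnorm_sq_eq_sum (D : CHNS Φ) {r m : ℕ} {u : Φ →L[ℝ] ℝ} (hu : u ∈ D.neg r)
    (h : ∀ j, m ≤ j → u (D.basis j) = 0) :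
    D.rnorm r u ^ 2 = ∑ j ∈ Finset.range m, u (D.basis j) ^ 2 / D.wt r j ^ 2 :=
  (D.hasSum_rnorm_sq hu).unique <| hasSum_sum_of_ne_finset_zero fun j hj => by
    rw [h j (by simpa using hj)]; simp

theorem sum_sq_le_rnorm_sq (D : CHNS Φ) {r : ℕ} {u : Φ →L[ℝ] ℝ} (hu : u ∈ D.neg r)
    (s : Finset ℕ) : ∑ j ∈ s, u (D.basis j) ^ 2 / D.wt r j ^ 2 ≤ D.rnorm r u ^ 2 :=
  sum_le_hasSum s (fun j _ => by positivity) (D.hasSum_rnorm_sq hu)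

/-- The `ℓ²` tail of the singular values of `Φ_{-p} → Φ_{-r}`. -/
def hsTail (D : CHNS Φ) (p r d : ℕ) : ℝ := ∑' j, D.wt p (j + d) ^ 2 / D.wt r (j + d) ^ 2

theorem hsTail_nonneg (D : CHNS Φ) (p r d : ℕ) : 0 ≤ D.hsTail p r d :=
  tsum_nonneg fun j => by positivity

theorem tendsto_hsTail (D : CHNS Φ) (p r : ℕ) : Tendsto (D.hsTail p r) atTop (𝓝 0) :=
  tendsto_sum_nat_add fun j => D.wt p j ^ 2 / D.wt r j ^ 2

/-- Elements of a ball of `Φ_{-p}` have uniformly small tails in `Φ_{-q}`: the `j`-th coefficient is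
at most `‖u‖_{-p} ‖φ_j‖_p`, and `‖φ_j‖_q ≥ ‖φ_j‖_r`. This replaces compactness in the comparison of
two Galerkin levels. -/
theorem sum_Ico_le_hsTail (D : CHNS Φ) {p r : ℕ}
    (hHS : Summable fun j => D.wt p j ^ 2 / D.wt r j ^ 2) {q : ℕ} (hrq : r ≤ q)
    {u : Φ →L[ℝ] ℝ} (hu : u ∈ D.neg p) (d e : ℕ) :
    ∑ j ∈ Finset.Ico d e, u (D.basis j) ^ 2 / D.wt q j ^ 2 ≤
      D.rnorm p u ^ 2 * D.hsTail p r d := by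
  have h1 : ∀ j, u (D.basis j) ^ 2 / D.wt q j ^ 2 ≤
      D.rnorm p u ^ 2 * (D.wt p j ^ 2 / D.wt r j ^ 2) := by
    intro j
    have h2 := pow_le_pow_left₀ (abs_nonneg _) (D.abs_le_rnorm hu (D.basis j)) 2
    rw [sq_abs, mul_pow] at h2
    rw [← mul_div_assoc]
    have := D.wt_pos r j
    have h3 := D.wt_mono hrq j
    have h4 : D.rnorm p u ^ 2 * D.nrm p (D.basis j) ^ 2 = D.rnorm p u ^ 2 * D.wt p j ^ 2 := rfl
    rw [h4] at h2
    gcongr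
  calc ∑ j ∈ Finset.Ico d e, u (D.basis j) ^ 2 / D.wt q j ^ 2
      ≤ ∑ j ∈ Finset.Ico d e, D.rnorm p u ^ 2 * (D.wt p j ^ 2 / D.wt r j ^ 2) :=
        Finset.sum_le_sum fun j _ => h1 j
    _ = D.rnorm p u ^ 2 * ∑ j ∈ Finset.range (e - d),
          (D.wt p (j + d) ^ 2 / D.wt r (j + d) ^ 2) := by
        rw [← Finset.mul_sum, Finset.sum_Ico_eq_sum_range]
        simp only [add_comm d]
    _ ≤ _ := by
        refine mul_le_mul_of_nonneg_left ?_ (sq_nonneg _)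
        exact ((summable_nat_add_iff d).2 hHS).sum_le_tsum _ fun j _ => by positivity

theorem nrm_trunc_sub_trunc_sq (D : CHNS Φ) (r : ℕ) {d e : ℕ} (hde : d ≤ e) (u : Φ →L[ℝ] ℝ) :
    D.nrm r (D.trunc r e u - D.trunc r d u) ^ 2 =
      ∑ j ∈ Finset.Ico d e, u (D.basis j) ^ 2 / D.wt r j ^ 2 := by
  rw [trunc, trunc, ← Finset.sum_Ico_eq_sub _ hde, nrm_sum_basis_sq]
  refine Finset.sum_congr rfl fun j _ => ?_
  have := (D.wt_pos r j).ne'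
  field_simp

theorem trunc_sub (D : CHNS Φ) (r m : ℕ) (u w : Φ →L[ℝ] ℝ) :
    D.trunc r m (u - w) = D.trunc r m u - D.trunc r m w := by
  simp only [trunc, ← Finset.sum_sub_distrib, ← sub_smul, sub_apply, sub_div]

end CHNS

namespace IsGalerkin

variable {D : CHNS Φ} {T : ℝ} {p p₁ q : ℕ} {F : ℝ → (Φ →L[ℝ] ℝ) → (Φ →L[ℝ] ℝ)} {χ : ℝ → ℝ}
  {X₀ : Φ →L[ℝ] ℝ} {d e : ℕ} {ε ε' : ℝ} {X Y X' Y' : ℝ → (Φ →L[ℝ] ℝ)}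

theorem continuousOn_coeff (hG : IsGalerkin D T p F X₀ d ε X Y) (j : ℕ) :
    ContinuousOn (fun t => X t (D.basis j)) (Icc 0 T) := by
  by_cases hj : j < d
  · exact (continuousOn_const.add (continuousOn_primitive_Icc (hG.integrable j hj))).congr
      fun t ht => hG.eqn t ht j hj
  · simp only [hG.zero_X _ j (not_lt.1 hj)]; exact continuousOn_const

/-- The energy estimate in `Φ_{-p}`. -/
theorem energy (hG : IsGalerkin D T p F X₀ d ε X Y) (h : DriftConditions D T p p₁ q F χ)
    (hε : ε ≤ 1) (hX₀ : X₀ ∈ D.neg p) {t : ℝ} (ht : t ∈ Icc 0 T) :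
    1 + D.rnorm p (X t) ^ 2 ≤
      (D.rnorm p X₀ ^ 2 + 3) * Real.exp (2 * ∫ s in (0 : ℝ)..T, 3 * χ s) := by
  have h0 : (0 : ℝ) ∈ Icc 0 T := ⟨le_rfl, h.pos.le⟩
  obtain ⟨η, hη, hsmall⟩ := hG.small
  have hη0 : 0 ≤ η := (abs_nonneg _).trans (hη 0 h0 0)
  have hsq : ∀ t, D.rnorm p (X t) ^ 2 =
      ∑ j ∈ Finset.range d, X t (D.basis j) ^ 2 / D.wt p j ^ 2 := fun t =>
    D.rnorm_sq_eq_sum (hG.mem_X t p) (hG.zero_X t)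
  have hcont : ContinuousOn (fun t => 1 + D.rnorm p (X t) ^ 2) (Icc 0 T) := by
    simp only [hsq]
    exact continuousOn_const.add (continuousOn_finsetSum _ fun j _ =>
      ((hG.continuousOn_coeff j).pow 2).div_const _)
  have hχ3 : IntegrableOn (fun s => 3 * χ s) (Icc 0 T) := h.integrable.const_mul 3
  have hFs : IntegrableOn (fun s => ∑ j ∈ Finset.range d, |F s (Y s) (D.basis j)|) (Icc 0 T) :=
    integrable_finsetSum _ fun j hj => (hG.integrable j (Finset.mem_range.1 hj)).abs
  refine le_mul_exp_of_le_add_integral (φ := fun t => 1 + D.rnorm p (X t) ^ 2) hcont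
    (fun t _ => by positivity) hχ3
    (fun s => mul_nonneg (by norm_num) (h.nonneg s)) (fun t ht => ?_) ht
  have hI1 : IntegrableOn (fun s => 3 * χ s * (1 + D.rnorm p (X s) ^ 2)) (Icc 0 T) :=
    hχ3.mul_continuousOn hcont isCompact_Icc
  have hE := sum_sq_eq_add_integral d (fun j => D.wt p j ^ 2) (fun j => X₀ (D.basis j))
    (f := fun j s => F s (Y s) (D.basis j)) (x := fun j t => X t (D.basis j))
    (fun j hj => hG.integrable j hj) (fun j hj t ht => hG.eqn t ht j hj) ht
  have hI2 : IntegrableOn (fun s => 2 * ∑ j ∈ Finset.range d,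
      F s (Y s) (D.basis j) * X s (D.basis j) / D.wt p j ^ 2) (Icc 0 T) := by
    refine Integrable.const_mul (integrable_finsetSum _ fun j hj => Integrable.div_const ?_ _) _
    exact (hG.integrable j (Finset.mem_range.1 hj)).mul_continuousOn (hG.continuousOn_coeff j)
      isCompact_Icc
  -- The drift `F(Y)` is paired with `X`, whereas coercivity controls its pairing with `Y`. The
  -- difference costs `2η ∫ ∑ |F_j| ≤ 2ε ≤ 2`; with the initial value `1 + ‖X₀‖²` this gives the
  -- constant `‖X₀‖² + 3`.
  have hmono := integral_mono_Icc (t := t) hI2 (hI1.add (hFs.const_mul (2 * η))) ht ?_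
  · simp only [Pi.add_apply] at hmono
    rw [intervalIntegral.integral_add (intervalIntegrable_of_Icc hI1 h0 ht)
      (intervalIntegrable_of_Icc (hFs.const_mul _) h0 ht),
      intervalIntegral.integral_const_mul (2 * η)] at hmono
    have h1 := integral_mono_endpoint hFs (fun s => Finset.sum_nonneg fun _ _ => abs_nonneg _) ht
    have h2 := mul_le_mul_of_nonneg_left h1 hη0
    have h3 := D.sum_sq_le_rnorm_sq hX₀ (Finset.range d)
    change 1 + D.rnorm p (X t) ^ 2 ≤ _
    rw [hsq t, hE]
    linarith
  · filter_upwards [h.coercive, ae_restrict_mem measurableSet_Icc] with s hs hsT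
    obtain ⟨φ, hφ⟩ := hG.embed_Y s
    have h1 := hs d φ fun j hj => by
      rw [← D.embed_apply_basis, ← hφ]; exact hG.zero_Y s j hj
    rw [← hφ, D.apply_trunc] at h1
    have h2 : ∑ j ∈ Finset.range d, F s (Y s) (D.basis j) * X s (D.basis j) / D.wt p j ^ 2 ≤
        ∑ j ∈ Finset.range d, F s (Y s) (D.basis j) * Y s (D.basis j) / D.wt p j ^ 2 +
          η * ∑ j ∈ Finset.range d, |F s (Y s) (D.basis j)| := by
      rw [Finset.mul_sum, ← Finset.sum_add_distrib]
      refine Finset.sum_le_sum fun j _ => ?_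
      have h3 : F s (Y s) (D.basis j) * (X s (D.basis j) - Y s (D.basis j)) / D.wt p j ^ 2 ≤
          η * |F s (Y s) (D.basis j)| := by
        refine (le_abs_self _).trans ?_
        rw [abs_div, abs_mul, abs_of_nonneg (sq_nonneg (D.wt p j)), mul_comm]
        refine (div_le_self (by positivity) (one_le_pow₀ (D.one_le_wt p j))).trans ?_
        exact mul_le_mul_of_nonneg_right (hη s hsT j) (abs_nonneg _)
      have h4 : F s (Y s) (D.basis j) * X s (D.basis j) / D.wt p j ^ 2 =
          F s (Y s) (D.basis j) * Y s (D.basis j) / D.wt p j ^ 2 +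
          F s (Y s) (D.basis j) * (X s (D.basis j) - Y s (D.basis j)) / D.wt p j ^ 2 := by ring
      linarith
    have h5 : D.rnorm p (Y s) ≤ D.rnorm p (X s) + 1 := by
      have h6 := D.rnorm_sub_le (hG.mem_X s p) (D.sub_mem_neg (hG.mem_X s p) (hG.mem_Y s p))
      rw [sub_sub_cancel] at h6
      linarith [hG.close s hsT]
    -- Coercivity is expressed through the frozen state; returning to `X`, which is within distance
    -- `1`, costs the factor `3`.
    have h7 : 1 + D.rnorm p (Y s) ^ 2 ≤ 3 * (1 + D.rnorm p (X s) ^ 2) := by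
      nlinarith [D.rnorm_nonneg p (Y s), D.rnorm_nonneg p (X s), sq_nonneg (D.rnorm p (X s) - 1)]
    have h8 := mul_le_mul_of_nonneg_left h7 (h.nonneg s)
    simp only [Pi.add_apply]
    linarith

/-- Two Galerkin approximations are close in `Φ_{-q}`. -/
theorem rnorm_sub_sq_le (hG : IsGalerkin D T p F X₀ d ε X Y)
    (hG' : IsGalerkin D T p F X₀ e ε' X' Y') (hde : d ≤ e)
    (h : DriftConditions D T p p₁ q F χ) (hX₀ : X₀ ∈ D.neg p) (hε : ε ≤ 1) (hε' : ε' ≤ ε)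
    {R : ℝ} (hR : ∀ t ∈ Icc 0 T, D.rnorm p (Y t) ≤ R)
    (hR' : ∀ t ∈ Icc 0 T, D.rnorm p (Y' t) ≤ R) {t : ℝ} (ht : t ∈ Icc 0 T) :
    D.rnorm q (X t - X' t) ^ 2 ≤
      (D.rnorm p X₀ ^ 2 * D.hsTail p p₁ d +
        (8 * ε + 8 * (1 + R) * ε + 2 * (1 + R) * (R * √(D.hsTail p p₁ d))) *
          ∫ s in (0 : ℝ)..T, χ s) * Real.exp (2 * ∫ s in (0 : ℝ)..T, 2 * χ s) := by
  have h0 : (0 : ℝ) ∈ Icc 0 T := ⟨le_rfl, h.pos.le⟩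
  have hpq : p ≤ q := h.le₁.trans h.le₂
  have hR0 : 0 ≤ R := (D.rnorm_nonneg _ _).trans (hR 0 h0)
  have hε0 : 0 ≤ ε := (D.rnorm_nonneg _ _).trans (hG.close 0 h0)
  set τ := D.hsTail p p₁ d with hτ
  have hτ0 : 0 ≤ τ := D.hsTail_nonneg _ _ _
  set M := 8 * ε + 8 * (1 + R) * ε + 2 * (1 + R) * (R * √τ) with hM
  have hM0 : 0 ≤ M := by positivity
  have hwmem : ∀ t r, X t - X' t ∈ D.neg r := fun t r =>
    D.sub_mem_neg (hG.mem_X t r) (hG'.mem_X t r)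
  have hymem : ∀ t r, Y t - Y' t ∈ D.neg r := fun t r =>
    D.sub_mem_neg (hG.mem_Y t r) (hG'.mem_Y t r)
  have hsq : ∀ t, D.rnorm q (X t - X' t) ^ 2 =
      ∑ j ∈ Finset.range e, (X t - X' t) (D.basis j) ^ 2 / D.wt q j ^ 2 := fun t =>
    D.rnorm_sq_eq_sum (hwmem t q) fun j hj => by
      rw [sub_apply, hG.zero_X t j (hde.trans hj), hG'.zero_X t j hj, sub_zero]
  have hwc : ∀ j, ContinuousOn (fun t => (X t - X' t) (D.basis j)) (Icc 0 T) := fun j =>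
    (hG.continuousOn_coeff j).sub (hG'.continuousOn_coeff j)
  have hcont : ContinuousOn (fun t => D.rnorm q (X t - X' t) ^ 2) (Icc 0 T) := by
    simp only [hsq]
    exact continuousOn_finsetSum _ fun j _ => ((hwc j).pow 2).div_const _
  have hχ2 : IntegrableOn (fun s => 2 * χ s) (Icc 0 T) := h.integrable.const_mul 2
  refine le_mul_exp_of_le_add_integral (φ := fun t => D.rnorm q (X t - X' t) ^ 2) hcont
    (fun t _ => by positivity) hχ2
    (fun s => mul_nonneg (by norm_num) (h.nonneg s)) (fun t ht => ?_) ht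
  have hI1 : IntegrableOn (fun s => 2 * χ s * D.rnorm q (X s - X' s) ^ 2) (Icc 0 T) :=
    hχ2.mul_continuousOn hcont isCompact_Icc
  -- The level-`d` approximation has no equation for `j ≥ d`; its coefficients vanish there. For
  -- those indices the difference carries only the drift of the finer approximation, with initial
  -- value `-X₀[φ_j]`, which is a tail of `X₀`.
  let f : ℕ → ℝ → ℝ := fun j s =>
    (if j < d then F s (Y s) (D.basis j) else 0) - F s (Y' s) (D.basis j)
  let x₀ : ℕ → ℝ := fun j => if j < d then 0 else -X₀ (D.basis j)
  have hfd : ∀ j, IntegrableOn (fun s => if j < d then F s (Y s) (D.basis j) else 0)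
      (Icc 0 T) := by
    intro j
    by_cases hj : j < d
    · simpa only [hj, if_true] using hG.integrable j hj
    · simp only [hj, if_false]; exact integrableOn_zero
  have hf : ∀ j < e, IntegrableOn (f j) (Icc 0 T) := fun j hj => (hfd j).sub (hG'.integrable j hj)
  have hx : ∀ j < e, ∀ t ∈ Icc 0 T,
      (X t - X' t) (D.basis j) = x₀ j + ∫ s in (0 : ℝ)..t, f j s := by
    intro j hj t ht
    simp only [f]
    rw [intervalIntegral.integral_sub (intervalIntegrable_of_Icc (hfd j) h0 ht)
      (intervalIntegrable_of_Icc (hG'.integrable j hj) h0 ht), sub_apply, hG'.eqn t ht j hj]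
    by_cases hjd : j < d
    · simp only [x₀, hjd, if_true]; rw [hG.eqn t ht j hjd]; ring
    · simp only [x₀, hjd, if_false]; rw [hG.zero_X t j (not_lt.1 hjd)]; simp [add_comm]
  have hE := sum_sq_eq_add_integral e (fun j => D.wt q j ^ 2) x₀ (f := f)
    (x := fun j t => (X t - X' t) (D.basis j)) hf hx ht
  have hx₀ : ∑ j ∈ Finset.range e, x₀ j ^ 2 / D.wt q j ^ 2 ≤ D.rnorm p X₀ ^ 2 * τ := by
    refine le_trans (le_of_eq ?_) (D.sum_Ico_le_hsTail h.hilbertSchmidt h.le₂ hX₀ d e)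
    rw [← Finset.sum_range_add_sum_Ico _ hde, Finset.sum_eq_zero, zero_add]
    · refine Finset.sum_congr rfl fun j hj => ?_
      simp only [x₀, not_lt.2 (Finset.mem_Ico.1 hj).1, if_false, neg_sq]
    · intro j hj; simp [x₀, Finset.mem_range.1 hj]
  have hI2 : IntegrableOn (fun s => 2 * ∑ j ∈ Finset.range e,
      f j s * (X s - X' s) (D.basis j) / D.wt q j ^ 2) (Icc 0 T) := by
    refine Integrable.const_mul (integrable_finsetSum _ fun j hj => Integrable.div_const ?_ _) _
    exact (hf j (Finset.mem_range.1 hj)).mul_continuousOn (hwc j) isCompact_Icc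
  have hmono := integral_mono_Icc (t := t) hI2 (hI1.add (h.integrable.const_mul M)) ht ?_
  · simp only [Pi.add_apply] at hmono
    rw [intervalIntegral.integral_add (intervalIntegrable_of_Icc hI1 h0 ht)
      (intervalIntegrable_of_Icc (h.integrable.const_mul M) h0 ht),
      intervalIntegral.integral_const_mul M] at hmono
    have h1 := mul_le_mul_of_nonneg_left (integral_mono_endpoint h.integrable h.nonneg ht) hM0
    change D.rnorm q (X t - X' t) ^ 2 ≤ _
    rw [hsq t, hE]
    linarith
  · filter_upwards [h.monotone, h.growth, ae_restrict_mem measurableSet_Icc] with s hmon hgr hsT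
    obtain ⟨hFm, hFb⟩ := hgr _ (hG.mem_Y s p₁)
    obtain ⟨hFm', hFb'⟩ := hgr _ (hG'.mem_Y s p₁)
    have hχ := h.nonneg s
    have hB : D.rnorm q (F s (Y s)) ≤ χ s * (1 + R) :=
      hFb.trans (mul_le_mul_of_nonneg_left (add_le_add_right
        ((D.rnorm_mono h.le₁ (hG.mem_Y s p)).trans (hR s hsT)) 1) hχ)
    have hB' : D.rnorm q (F s (Y' s)) ≤ χ s * (1 + R) :=
      hFb'.trans (mul_le_mul_of_nonneg_left (add_le_add_right
        ((D.rnorm_mono h.le₁ (hG'.mem_Y s p)).trans (hR' s hsT)) 1) hχ)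
    set w := X s - X' s with hw
    set y := Y s - Y' s with hy
    have hwy : w - y = (X s - Y s) - (X' s - Y' s) := by rw [hw, hy]; abel
    have hdm : X s - Y s ∈ D.neg p := D.sub_mem_neg (hG.mem_X s p) (hG.mem_Y s p)
    have hdm' : X' s - Y' s ∈ D.neg p := D.sub_mem_neg (hG'.mem_X s p) (hG'.mem_Y s p)
    have hwym : w - y ∈ D.neg q := D.sub_mem_neg (hwmem s q) (hymem s q)
    have hwyn : D.rnorm q (w - y) ≤ 2 * ε := by
      rw [hwy]
      refine (D.rnorm_mono hpq (D.sub_mem_neg hdm hdm')).trans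
        ((D.rnorm_sub_le hdm hdm').trans ?_)
      linarith [hG.close s hsT, hG'.close s hsT]
    have hsum : ∑ j ∈ Finset.range e, f j s * w (D.basis j) / D.wt q j ^ 2 =
        F s (Y s) (D.trunc q d w) - F s (Y' s) (D.trunc q e w) := by
      rw [D.apply_trunc, D.apply_trunc, ← Finset.sum_range_add_sum_Ico _ hde,
        ← Finset.sum_range_add_sum_Ico (fun j => F s (Y' s) (D.basis j) * w (D.basis j) /
          D.wt q j ^ 2) hde]
      have h1 : ∑ j ∈ Finset.range d, f j s * w (D.basis j) / D.wt q j ^ 2 =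
          ∑ j ∈ Finset.range d, F s (Y s) (D.basis j) * w (D.basis j) / D.wt q j ^ 2 -
          ∑ j ∈ Finset.range d, F s (Y' s) (D.basis j) * w (D.basis j) / D.wt q j ^ 2 := by
        rw [← Finset.sum_sub_distrib]
        refine Finset.sum_congr rfl fun j hj => ?_
        simp only [f, Finset.mem_range.1 hj, if_true]; ring
      have h2 : ∑ j ∈ Finset.Ico d e, f j s * w (D.basis j) / D.wt q j ^ 2 =
          -∑ j ∈ Finset.Ico d e, F s (Y' s) (D.basis j) * w (D.basis j) / D.wt q j ^ 2 := by
        rw [← Finset.sum_neg_distrib]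
        refine Finset.sum_congr rfl fun j hj => ?_
        simp only [f, not_lt.2 (Finset.mem_Ico.1 hj).1, if_false]; ring
      rw [h1, h2]; ring
    -- With `P_d`, `P_e` the truncations, `w = (w - y) + y` separates the freezing error, and `P_d Y
    -- = P_e Y` gives `P_d y = P_e y + (P_e - P_d) Y'`. The pairing becomes the monotone term `⟨F(Y)
    -- - F(Y'), y⟩_{-q}`, two freezing errors of size `χ (1 + R) 2ε`, and a tail error of size `χ (1
    -- + R) R √τ`; after doubling, these are the last two terms of `M`.
    have htd : D.trunc q d w = D.trunc q d (w - y) + D.trunc q d y := by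
      rw [D.trunc_sub q _ w y]; abel
    have hte : D.trunc q e w = D.trunc q e (w - y) + D.trunc q e y := by
      rw [D.trunc_sub q _ w y]; abel
    have hYd : D.trunc q d (Y s) = D.trunc q e (Y s) := by
      rw [CHNS.trunc, CHNS.trunc, ← Finset.sum_range_add_sum_Ico _ hde]
      rw [Finset.sum_eq_zero (s := Finset.Ico d e), add_zero]
      intro j hj
      rw [hG.zero_Y s j (Finset.mem_Ico.1 hj).1]; simp
    have hyd : D.trunc q d y = D.trunc q e y + (D.trunc q e (Y' s) - D.trunc q d (Y' s)) := by
      rw [hy, D.trunc_sub, D.trunc_sub, hYd]; abel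
    have hye : (F s (Y s) - F s (Y' s)) (D.trunc q e y) =
        D.dualInner q (F s (Y s) - F s (Y' s)) y :=
      D.apply_trunc_eq_dualInner (D.sub_mem_neg hFm hFm') (hymem s q) fun j hj => by
        rw [hy, sub_apply, hG.zero_Y s j (hde.trans hj), hG'.zero_Y s j hj, sub_zero]
    rw [sub_apply] at hye
    have hmon' := hmon _ (hG.mem_Y s p₁) _ (hG'.mem_Y s p₁)
    have e1 : F s (Y s) (D.trunc q d (w - y)) ≤ χ s * (1 + R) * (2 * ε) :=
      (le_abs_self _).trans ((D.abs_apply_trunc_le d hFm hwym).trans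
        (mul_le_mul hB hwyn (D.rnorm_nonneg _ _) (by positivity)))
    have e2 : -F s (Y' s) (D.trunc q e (w - y)) ≤ χ s * (1 + R) * (2 * ε) :=
      (neg_le_abs _).trans ((D.abs_apply_trunc_le e hFm' hwym).trans
        (mul_le_mul hB' hwyn (D.rnorm_nonneg _ _) (by positivity)))
    have hnt : D.nrm q (D.trunc q e (Y' s) - D.trunc q d (Y' s)) ≤ R * √τ := by
      refine le_of_sq_le_sq ?_ (by positivity)
      rw [D.nrm_trunc_sub_trunc_sq q hde, mul_pow, Real.sq_sqrt hτ0]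
      refine (D.sum_Ico_le_hsTail h.hilbertSchmidt h.le₂ (hG'.mem_Y s p) d e).trans ?_
      gcongr
      · exact D.rnorm_nonneg _ _
      · exact hR' s hsT
    have e3 : F s (Y s) (D.trunc q e (Y' s) - D.trunc q d (Y' s)) ≤
        χ s * (1 + R) * (R * √τ) :=
      (le_abs_self _).trans ((D.abs_le_rnorm hFm _).trans
        (mul_le_mul hB hnt (apply_nonneg _ _) (by positivity)))
    have hyw : D.rnorm q y ≤ D.rnorm q w + 2 * ε := by
      have := D.rnorm_sub_le (hwmem s q) hwym
      rw [sub_sub_cancel] at this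
      linarith
    -- Here `ε ≤ 1` turns `8ε²` into `8ε`. This accounts for the first term of `M` and for the
    -- coefficient `2χ` in Grönwall's inequality.
    have e4 : D.rnorm q y ^ 2 ≤ 2 * D.rnorm q w ^ 2 + 8 * ε := by
      have := D.rnorm_nonneg q y
      have := D.rnorm_nonneg q w
      nlinarith [sq_nonneg (D.rnorm q w - 2 * ε)]
    have e5 := mul_le_mul_of_nonneg_left e4 hχ
    simp only [Pi.add_apply]
    rw [hsum, htd, hte, hyd, map_add, map_add, map_add, hM]
    nlinarith

end IsGalerkin
end

/-! ### Existence and uniqueness for abstract drift equations -/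

noncomputable section

variable {Φ : Type*} [AddCommGroup Φ] [Module ℝ Φ] [UniformSpace Φ] [IsUniformAddGroup Φ]

namespace IsGalerkin

variable {D : CHNS Φ} {T : ℝ} {p p₁ q : ℕ} {F : ℝ → (Φ →L[ℝ] ℝ) → (Φ →L[ℝ] ℝ)} {χ : ℝ → ℝ}
  {X₀ : Φ →L[ℝ] ℝ} {ε : ℕ → ℝ} {X Y : ℕ → ℝ → (Φ →L[ℝ] ℝ)}

/-- The comparison bound between levels `d ≤ e` depends only on `d` and tends to `0` with `ε d` and
the Hilbert-Schmidt tail, so every coefficient is a Cauchy sequence. -/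
theorem exists_tendsto_coeff (hG : ∀ d, IsGalerkin D T p F X₀ d (ε d) (X d) (Y d))
    (h : DriftConditions D T p p₁ q F χ) (hX₀ : X₀ ∈ D.neg p) (hε : ∀ d, ε d ≤ 1)
    (hanti : Antitone ε) (hlim : Tendsto ε atTop (𝓝 0)) {R : ℝ}
    (hR : ∀ d, ∀ t ∈ Icc 0 T, D.rnorm p (Y d t) ≤ R) {t : ℝ} (ht : t ∈ Icc 0 T) (j : ℕ) :
    ∃ x, Tendsto (fun d => X d t (D.basis j)) atTop (𝓝 x) := by
  let b : ℕ → ℝ := fun d => (D.rnorm p X₀ ^ 2 * D.hsTail p p₁ d +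
        (8 * ε d + 8 * (1 + R) * ε d + 2 * (1 + R) * (R * √(D.hsTail p p₁ d))) *
          ∫ s in (0 : ℝ)..T, χ s) * Real.exp (2 * ∫ s in (0 : ℝ)..T, 2 * χ s)
  have hb : Tendsto b atTop (𝓝 0) := by
    have h1 := D.tendsto_hsTail p p₁
    have h2 := (Real.continuous_sqrt.tendsto 0).comp h1
    rw [Real.sqrt_zero] at h2
    have h3 := ((h1.const_mul (D.rnorm p X₀ ^ 2)).add ((((hlim.const_mul 8).add
      (hlim.const_mul (8 * (1 + R)))).add ((h2.const_mul R).const_mul (2 * (1 + R)))).mul_const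
      (∫ s in (0 : ℝ)..T, χ s))).mul_const (Real.exp (2 * ∫ s in (0 : ℝ)..T, 2 * χ s))
    simp only [mul_zero, add_zero, zero_mul] at h3
    exact h3
  have hb2 : Tendsto (fun d => 2 * (√(b d) * D.wt q j)) atTop (𝓝 0) := by
    have h2 := (((Real.continuous_sqrt.tendsto 0).comp hb).mul_const (D.wt q j)).const_mul 2
    rw [Real.sqrt_zero] at h2
    simpa using h2
  refine cauchySeq_tendsto_of_complete (cauchySeq_of_le_tendsto_0 _ ?_ hb2)
  -- The comparison needs ordered levels, so two indices beyond `N` are each compared with `N`;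
  -- hence the factor `2` in the bound.
  have key : ∀ N n, N ≤ n → |X N t (D.basis j) - X n t (D.basis j)| ≤ √(b N) * D.wt q j := by
    intro N n hNn
    have h1 := (hG N).rnorm_sub_sq_le (hG n) hNn h hX₀ (hε N) (hanti hNn) (hR N) (hR n) ht
    have h2 := D.abs_le_rnorm (D.sub_mem_neg ((hG N).mem_X t q) ((hG n).mem_X t q)) (D.basis j)
    rw [sub_apply] at h2
    refine h2.trans (mul_le_mul_of_nonneg_right (Real.le_sqrt_of_sq_le h1) (apply_nonneg _ _))
  intro n m N hn hm
  rw [Real.dist_eq]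
  have h1 := key N n hn
  have h2 := key N m hm
  rw [abs_le] at h1 h2 ⊢
  constructor <;> linarith [h1.1, h1.2, h2.1, h2.2]

end IsGalerkin

namespace DriftConditions

variable {D : CHNS Φ} {T : ℝ} {p p₁ q : ℕ} {F : ℝ → (Φ →L[ℝ] ℝ) → (Φ →L[ℝ] ℝ)} {χ : ℝ → ℝ}
  {X₀ : Φ →L[ℝ] ℝ}

/-- The coefficientwise limit of the Galerkin approximations solves the equation. It stays in the
ball of `Φ_{-p}` given by the energy estimate, and the Hilbert-Schmidt injection supplies the strong
convergence in `Φ_{-p₁}` required by the continuity of `F`. -/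
theorem exists_solution (h : DriftConditions D T p p₁ q F χ) (hX₀ : X₀ ∈ D.neg p) :
    ∃ X, IsDriftSolution D T p₁ F X₀ X ∧ (∀ t, X t ∈ D.neg p) ∧ (∀ φ, Measurable fun t => X t φ) ∧
      ∀ t ∈ Icc 0 T, D.rnorm p (X t) ≤
        √((D.rnorm p X₀ ^ 2 + 3) * Real.exp (2 * ∫ s in (0 : ℝ)..T, 3 * χ s)) := by
  have h0 : (0 : ℝ) ∈ Icc 0 T := ⟨le_rfl, h.pos.le⟩
  set B := √((D.rnorm p X₀ ^ 2 + 3) * Real.exp (2 * ∫ s in (0 : ℝ)..T, 3 * χ s)) with hB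
  have hB0 : 0 ≤ B := Real.sqrt_nonneg _
  let ε : ℕ → ℝ := fun d => 1 / ((d : ℝ) + 1)
  have hε0 : ∀ d, 0 < ε d := fun d => by simp only [ε]; positivity
  have hε1 : ∀ d, ε d ≤ 1 := fun d => by
    simp only [ε]; rw [div_le_one (by positivity)]; linarith [(Nat.cast_nonneg d : (0 : ℝ) ≤ d)]
  have hanti : Antitone ε := fun a b hab => one_div_le_one_div_of_le (by positivity)
    (by gcongr)
  have hlim : Tendsto ε atTop (𝓝 0) := tendsto_one_div_add_atTop_nhds_zero_nat
  choose X Y hG using fun d => h.exists_galerkin X₀ d (hε0 d)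
  have hXB : ∀ d, ∀ t ∈ Icc 0 T, D.rnorm p (X d t) ≤ B := fun d t ht =>
    Real.le_sqrt_of_sq_le (by linarith [(hG d).energy h (hε1 d) hX₀ ht])
  have hYB : ∀ d, ∀ t ∈ Icc 0 T, D.rnorm p (Y d t) ≤ B + 1 := by
    intro d t ht
    have h6 := D.rnorm_sub_le ((hG d).mem_X t p)
      (D.sub_mem_neg ((hG d).mem_X t p) ((hG d).mem_Y t p))
    rw [sub_sub_cancel] at h6
    linarith [(hG d).close t ht, hXB d t ht, hε1 d]
  -- The uniform bound `B` passes to the partial sums of the limiting coefficients, so Riesz-Fischer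
  -- yields a functional in the same ball of `Φ_{-p}`.
  have hlimX : ∀ t ∈ Icc 0 T, ∃ u : Φ →L[ℝ] ℝ, u ∈ D.neg p ∧ D.rnorm p u ≤ B ∧
      ∀ j, Tendsto (fun d => X d t (D.basis j)) atTop (𝓝 (u (D.basis j))) := by
    intro t ht
    choose x hx using fun j =>
      IsGalerkin.exists_tendsto_coeff hG h hX₀ hε1 hanti hlim hYB ht j
    have hsum : ∀ n, ∑ j ∈ Finset.range n, x j ^ 2 / D.wt p j ^ 2 ≤ B ^ 2 := by
      intro n
      have h1 : Tendsto (fun d => ∑ j ∈ Finset.range n,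
          X d t (D.basis j) ^ 2 / D.wt p j ^ 2) atTop
          (𝓝 (∑ j ∈ Finset.range n, x j ^ 2 / D.wt p j ^ 2)) :=
        tendsto_finsetSum _ fun j _ => ((hx j).pow 2).div_const _
      refine le_of_tendsto h1 (Eventually.of_forall fun d => ?_)
      exact (D.sum_sq_le_rnorm_sq ((hG d).mem_X t p) _).trans
        (pow_le_pow_left₀ (D.rnorm_nonneg _ _) (hXB d t ht) 2)
    have hs := summable_of_sum_range_le (fun j => by positivity) hsum
    obtain ⟨u, hu, hux⟩ := D.exists_functional p x hs
    refine ⟨u, hu, ?_, fun j => by rw [hux]; exact hx j⟩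
    refine le_of_sq_le_sq ?_ hB0
    refine le_of_tendsto' (D.hasSum_rnorm_sq hu).tendsto_sum_nat fun n => ?_
    simpa only [hux] using hsum n
  choose! U hUm hUB hUlim using hlimX
  -- The value `0` outside `[0,T]` makes `Z` measurable and `Φ_{-p}`-valued on the whole line, as
  -- the measurability condition on the drift requires.
  let Z : ℝ → (Φ →L[ℝ] ℝ) := (Icc 0 T).indicator U
  have hZ : ∀ t ∈ Icc 0 T, Z t = U t := fun t ht => indicator_of_mem ht U
  have hZm : ∀ t, Z t ∈ D.neg p := by
    intro t
    by_cases ht : t ∈ Icc 0 T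
    · rw [hZ t ht]; exact hUm t ht
    · simp only [Z, indicator_of_notMem ht]; exact D.zero_mem_neg p
  have hZm₁ : ∀ t, Z t ∈ D.neg p₁ := fun t => D.neg_mono h.le₁ (hZm t)
  have hZB : ∀ t ∈ Icc 0 T, D.rnorm p (Z t) ≤ B := fun t ht => by rw [hZ t ht]; exact hUB t ht
  -- The drift is evaluated at the frozen states. Their coefficients have the same limits as those
  -- of `X d`, the distance being at most `ε d` in `Φ_{-p}`, and boundedness in `Φ_{-p}` upgrades
  -- this to convergence in `Φ_{-p₁}`.
  have hYZ : ∀ t ∈ Icc 0 T, Tendsto (fun d => D.rnorm p₁ (Y d t - Z t)) atTop (𝓝 0) := by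
    intro t ht
    refine D.tendsto_rnorm_of_coeff h.hilbertSchmidt h.le₁ (R := B + 1 + B)
      (Eventually.of_forall fun d => ⟨D.sub_mem_neg ((hG d).mem_Y t p) (hZm t), ?_⟩) fun j => ?_
    · exact (D.rnorm_sub_le ((hG d).mem_Y t p) (hZm t)).trans
        (add_le_add (hYB d t ht) (hZB t ht))
    · have h1 : Tendsto (fun d => X d t (D.basis j) - Y d t (D.basis j)) atTop (𝓝 0) := by
        refine squeeze_zero_norm (a := fun d => ε d * D.wt p j) (fun d => ?_)
          (by simpa using hlim.mul_const (D.wt p j))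
        have h2 := D.abs_le_rnorm (D.sub_mem_neg ((hG d).mem_X t p) ((hG d).mem_Y t p))
          (D.basis j)
        exact h2.trans (mul_le_mul_of_nonneg_right ((hG d).close t ht) (apply_nonneg _ _))
      have h3 := (hUlim t ht j).sub_const (U t (D.basis j))
      have h4 := h3.sub h1
      simp only [sub_self] at h4
      refine h4.congr fun d => ?_
      rw [sub_apply, hZ t ht]; ring
  have hZmeas : ∀ φ, Measurable fun t => Z t φ := by
    intro φ
    refine measurable_of_tendsto_metrizable
      (f := fun d => (Icc 0 T).indicator fun t => Y d t φ)
      (fun d => ((hG d).measurable_Y φ).indicator measurableSet_Icc) ?_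
    rw [tendsto_pi_nhds]
    intro t
    by_cases ht : t ∈ Icc 0 T
    · simp only [indicator_of_mem ht]
      rw [tendsto_iff_norm_sub_tendsto_zero]
      refine squeeze_zero (g := fun d => D.rnorm p₁ (Y d t - Z t) * D.nrm p₁ φ)
        (fun _ => norm_nonneg _) (fun d => ?_)
        (by simpa using (hYZ t ht).mul_const (D.nrm p₁ φ))
      exact D.abs_le_rnorm (D.sub_mem_neg ((hG d).mem_Y t p₁) (hZm₁ t)) φ
    · simp only [Z, indicator_of_notMem ht]
      exact tendsto_const_nhds
  have hZB₁ : ∀ t ∈ Icc 0 T, D.rnorm p₁ (Z t) ≤ B := fun t ht =>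
    (D.rnorm_mono h.le₁ (hZm t)).trans (hZB t ht)
  have hYB₁ : ∀ d, ∀ t ∈ Icc 0 T, D.rnorm p₁ (Y d t) ≤ B + 1 := fun d t ht =>
    (D.rnorm_mono h.le₁ ((hG d).mem_Y t p)).trans (hYB d t ht)
  have hint : ∀ φ, IntegrableOn (fun s => F s (Z s) φ) (Icc 0 T) := fun φ =>
    h.integrableOn_comp hZmeas hZm₁ hZB₁ φ
  have heq_basis : ∀ t ∈ Icc 0 T, ∀ j, Z t (D.basis j) =
      X₀ (D.basis j) + ∫ s in (0 : ℝ)..t, F s (Z s) (D.basis j) := by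
    intro t ht j
    have hsub : uIoc 0 t ⊆ Icc 0 T := by
      rw [uIoc_of_le ht.1]; exact fun s hs => ⟨hs.1.le, hs.2.trans ht.2⟩
    have h1 : Tendsto (fun d => ∫ s in (0 : ℝ)..t, F s (Y d s) (D.basis j)) atTop
        (𝓝 (∫ s in (0 : ℝ)..t, F s (Z s) (D.basis j))) := by
      refine intervalIntegral.tendsto_integral_filter_of_dominated_convergence
        (fun s => χ s * (1 + (B + 1)) * D.wt q j) (Eventually.of_forall fun d => ?_)
        (Eventually.of_forall fun d => ?_) ?_ ?_
      · exact (h.measurable (Y d) (hG d).measurable_Y (fun s => (hG d).mem_Y s p₁)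
          (D.basis j)).mono_measure (Measure.restrict_mono hsub le_rfl)
      · filter_upwards [(ae_restrict_iff' measurableSet_Icc).1 h.abs_apply_le] with s hs hst
        have hsT := hsub hst
        refine (hs hsT _ ((hG d).mem_Y s p₁) (D.basis j)).trans ?_
        have := hYB₁ d s hsT
        have := h.nonneg s
        have hw : D.nrm q (D.basis j) = D.wt q j := rfl
        rw [hw]
        have := (D.wt_pos q j).le
        gcongr
      · exact ((intervalIntegrable_of_Icc h.integrable h0 ht).mul_const _).mul_const _
      · filter_upwards [(ae_restrict_iff' measurableSet_Icc).1 h.continuous] with s hs hst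
        exact hs (hsub hst) (Z s) (hZm₁ s) (fun d => Y d s) (fun d => (hG d).mem_Y s p₁)
          (hYZ s (hsub hst)) (D.basis j)
    have h2 := hUlim t ht j
    rw [hZ t ht]
    -- The equation for the `j`-th coefficient holds at every level `d > j`.
    refine tendsto_nhds_unique h2 ((h1.const_add (X₀ (D.basis j))).congr' ?_)
    filter_upwards [eventually_gt_atTop j] with d hd
    exact ((hG d).eqn t ht j hd).symm
  refine ⟨Z, ⟨fun t _ => hZm₁ t, fun t ht => ?_, hint, fun t ht φ => ?_⟩,
    hZm, hZmeas, hZB⟩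
  · refine D.tendsto_rnorm_of_coeff h.hilbertSchmidt h.le₁ (R := B + B) ?_ fun j => ?_
    · filter_upwards [self_mem_nhdsWithin] with s hs
      exact ⟨D.sub_mem_neg (hZm s) (hZm t), (D.rnorm_sub_le (hZm s) (hZm t)).trans
        (add_le_add (hZB s hs) (hZB t ht))⟩
    · have h1 : ContinuousOn (fun s => Z s (D.basis j)) (Icc 0 T) :=
        (continuousOn_const.add (continuousOn_primitive_Icc (hint (D.basis j)))).congr
          fun s hs => heq_basis s hs j
      have h2 := (h1 t ht).sub_const (Z t (D.basis j))
      rw [sub_self] at h2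
      exact h2
  · have hIlin : ∃ L : Φ →ₗ[ℝ] ℝ, ∀ φ, L φ = ∫ s in (0 : ℝ)..t, F s (Z s) φ := by
      refine ⟨⟨⟨fun φ => ∫ s in (0 : ℝ)..t, F s (Z s) φ, fun φ ψ => ?_⟩, fun c φ => ?_⟩,
        fun φ => rfl⟩
      · simp only [map_add]
        exact intervalIntegral.integral_add (intervalIntegrable_of_Icc (hint φ) h0 ht)
          (intervalIntegrable_of_Icc (hint ψ) h0 ht)
      · simp only [map_smul, smul_eq_mul, RingHom.id_apply]
        exact intervalIntegral.integral_const_mul _ _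
    obtain ⟨L, hL⟩ := hIlin
    have hLb : ∀ φ, |L φ| ≤ (∫ s in (0 : ℝ)..t, χ s * (1 + B)) * D.nrm q φ := by
      intro φ
      rw [hL, ← Real.norm_eq_abs, ← intervalIntegral.integral_mul_const]
      refine intervalIntegral.norm_integral_le_of_norm_le ht.1 ?_
        (((intervalIntegrable_of_Icc h.integrable h0 ht).mul_const _).mul_const _)
      filter_upwards [(ae_restrict_iff' measurableSet_Icc).1 h.abs_apply_le] with s hs hst
      have hsT : s ∈ Icc 0 T := ⟨hst.1.le, hst.2.trans ht.2⟩
      refine (hs hsT _ (hZm₁ s) φ).trans ?_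
      have := hZB₁ s hsT
      have := h.nonneg s
      have : 0 ≤ D.nrm q φ := apply_nonneg _ _
      gcongr
    have hpq := h.le₁.trans h.le₂
    -- The equation is known on the basis only. Both sides are `‖·‖_q`-bounded functionals, so it
    -- extends to every `φ` by density.
    have hz := D.eq_zero_of_basis_eq_zero q ((Z t - X₀).toLinearMap - L)
      (D.rnorm q (Z t - X₀) + ∫ s in (0 : ℝ)..t, χ s * (1 + B)) (fun ψ => ?_) (fun j => ?_) φ
    · rw [← hL]
      have : (Z t - X₀) φ - L φ = 0 := hz
      rw [sub_apply] at this
      linarith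
    · have h1 := D.abs_le_rnorm (D.neg_mono hpq (D.sub_mem_neg (hZm t) hX₀)) ψ
      have h2 : |(Z t - X₀) ψ - L ψ| ≤ |(Z t - X₀) ψ| + |L ψ| := abs_sub _ _
      have h3 := hLb ψ
      rw [add_mul]
      exact h2.trans (add_le_add h1 h3)
    · change (Z t - X₀) (D.basis j) - L (D.basis j) = 0
      rw [hL, sub_apply, heq_basis t ht j]; ring

theorem _root_.IsDriftSolution.continuousOn_rnorm {r : ℕ} {X : ℝ → (Φ →L[ℝ] ℝ)}
    (hX : IsDriftSolution D T r F X₀ X) : ContinuousOn (fun t => D.rnorm r (X t)) (Icc 0 T) := by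
  intro t ht
  rw [ContinuousWithinAt, tendsto_iff_norm_sub_tendsto_zero]
  refine squeeze_zero' (Eventually.of_forall fun _ => norm_nonneg _) ?_ (hX.cont t ht)
  filter_upwards [self_mem_nhdsWithin] with s hs
  have h1 := D.rnorm_add_le (D.sub_mem_neg (hX.mem s hs) (hX.mem t ht)) (hX.mem t ht)
  have h2 := D.rnorm_add_le (D.sub_mem_neg (hX.mem t ht) (hX.mem s hs)) (hX.mem s hs)
  rw [sub_add_cancel] at h1 h2
  rw [D.rnorm_sub_comm r (X t)] at h2
  rw [Real.norm_eq_abs, abs_le]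
  constructor <;> linarith

theorem _root_.IsDriftSolution.exists_bound {r : ℕ} {X : ℝ → (Φ →L[ℝ] ℝ)}
    (hX : IsDriftSolution D T r F X₀ X) : ∃ R, ∀ t ∈ Icc 0 T, D.rnorm r (X t) ≤ R := by
  obtain ⟨R, hR⟩ := isCompact_Icc.exists_bound_of_continuousOn hX.continuousOn_rnorm
  exact ⟨R, fun t ht => (le_abs_self _).trans (hR t ht)⟩

/-- The difference is expanded in coefficients: the partial sums of `‖X - Y‖_{-q}²` are integrals of
truncated pairings. These converge to `2⟨F(X) - F(Y), X - Y⟩_{-q}` and are dominated, since both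
solutions are bounded in `Φ_{-p₁}` and `F` has linear growth. Monotonicity and Grönwall with zero
initial value conclude. -/
theorem unique (h : DriftConditions D T p p₁ q F χ) {X Y : ℝ → (Φ →L[ℝ] ℝ)}
    (hX : IsDriftSolution D T p₁ F X₀ X) (hY : IsDriftSolution D T p₁ F X₀ Y) :
    EqOn X Y (Icc 0 T) := by
  have h0 : (0 : ℝ) ∈ Icc 0 T := ⟨le_rfl, h.pos.le⟩
  obtain ⟨R₁, hR₁⟩ := hX.exists_bound
  obtain ⟨R₂, hR₂⟩ := hY.exists_bound
  have hR₁0 : 0 ≤ R₁ := (D.rnorm_nonneg _ _).trans (hR₁ 0 h0)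
  have hR₂0 : 0 ≤ R₂ := (D.rnorm_nonneg _ _).trans (hR₂ 0 h0)
  let f : ℕ → ℝ → ℝ := fun j s => F s (X s) (D.basis j) - F s (Y s) (D.basis j)
  have hf : ∀ j, IntegrableOn (f j) (Icc 0 T) := fun j =>
    (hX.integrable (D.basis j)).sub (hY.integrable (D.basis j))
  have hw : ∀ j, ∀ t ∈ Icc 0 T,
      (X t - Y t) (D.basis j) = 0 + ∫ s in (0 : ℝ)..t, f j s := by
    intro j t ht
    simp only [f]
    rw [intervalIntegral.integral_sub (intervalIntegrable_of_Icc (hX.integrable _) h0 ht)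
      (intervalIntegrable_of_Icc (hY.integrable _) h0 ht), sub_apply, hX.eqn t ht, hY.eqn t ht]
    ring
  have hwc : ∀ j, ContinuousOn (fun t => (X t - Y t) (D.basis j)) (Icc 0 T) := fun j =>
    (continuousOn_const.add (continuousOn_primitive_Icc (hf j))).congr (hw j)
  have hm : ∀ t ∈ Icc 0 T, X t - Y t ∈ D.neg p₁ := fun t ht =>
    D.sub_mem_neg (hX.mem t ht) (hY.mem t ht)
  have hmq : ∀ t ∈ Icc 0 T, X t - Y t ∈ D.neg q := fun t ht => D.neg_mono h.le₂ (hm t ht)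
  have hwb : ∀ t ∈ Icc 0 T, D.rnorm q (X t - Y t) ≤ R₁ + R₂ := fun t ht =>
    (D.rnorm_mono h.le₂ (hm t ht)).trans ((D.rnorm_sub_le (hX.mem t ht) (hY.mem t ht)).trans
      (add_le_add (hR₁ t ht) (hR₂ t ht)))
  have hcont : ContinuousOn (fun t => D.rnorm q (X t - Y t) ^ 2) (Icc 0 T) := by
    refine ContinuousOn.pow (fun t ht => ?_) 2
    rw [ContinuousWithinAt, tendsto_iff_norm_sub_tendsto_zero]
    refine squeeze_zero' (Eventually.of_forall fun _ => norm_nonneg _) ?_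
      (by simpa using (hX.cont t ht).add (hY.cont t ht))
    filter_upwards [self_mem_nhdsWithin] with s hs
    have hd : X s - Y s - (X t - Y t) = (X s - X t) - (Y s - Y t) := by abel
    have hm1 := D.sub_mem_neg (hX.mem s hs) (hX.mem t ht)
    have hm2 := D.sub_mem_neg (hY.mem s hs) (hY.mem t ht)
    have h3 : D.rnorm q (X s - Y s - (X t - Y t)) ≤
        D.rnorm p₁ (X s - X t) + D.rnorm p₁ (Y s - Y t) := by
      rw [hd]
      exact (D.rnorm_mono h.le₂ (D.sub_mem_neg hm1 hm2)).trans (D.rnorm_sub_le hm1 hm2)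
    have h1 := D.rnorm_add_le (D.sub_mem_neg (hmq s hs) (hmq t ht)) (hmq t ht)
    have h2 := D.rnorm_add_le (D.sub_mem_neg (hmq t ht) (hmq s hs)) (hmq s hs)
    rw [sub_add_cancel] at h1 h2
    rw [D.rnorm_sub_comm q (X t - Y t)] at h2
    rw [Real.norm_eq_abs, abs_le]
    constructor <;> linarith
  let g : ℕ → ℝ → ℝ := fun m s =>
    2 * ∑ j ∈ Finset.range m, f j s * (X s - Y s) (D.basis j) / D.wt q j ^ 2
  have hgint : ∀ m, IntegrableOn (g m) (Icc 0 T) := fun m =>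
    Integrable.const_mul (integrable_finsetSum _ fun j _ =>
      (((hf j).mul_continuousOn (hwc j) isCompact_Icc).div_const _)) _
  let g' : ℝ → ℝ := fun s => 2 * D.dualInner q (F s (X s) - F s (Y s)) (X s - Y s)
  let b : ℝ → ℝ := fun s => 2 * (χ s * (2 + R₁ + R₂) * (R₁ + R₂))
  have hgood : ∀ᵐ s ∂(volume.restrict (Icc 0 T)), (∀ m, |g m s| ≤ b s) ∧
      Tendsto (fun m => g m s) atTop (𝓝 (g' s)) ∧ g' s ≤ χ s * D.rnorm q (X s - Y s) ^ 2 := by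
    filter_upwards [h.growth, h.monotone, ae_restrict_mem measurableSet_Icc] with s hgr hmon hsT
    obtain ⟨hF1, hB1⟩ := hgr _ (hX.mem s hsT)
    obtain ⟨hF2, hB2⟩ := hgr _ (hY.mem s hsT)
    have hgm : ∀ m, g m s = 2 * (F s (X s) - F s (Y s)) (D.trunc q m (X s - Y s)) := by
      intro m
      rw [D.apply_trunc]
      simp only [g, f, sub_apply]
    have hχ := h.nonneg s
    refine ⟨fun m => ?_, ?_, hmon _ (hX.mem s hsT) _ (hY.mem s hsT)⟩
    · rw [hgm, abs_mul, abs_two]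
      refine mul_le_mul_of_nonneg_left ?_ (by norm_num)
      refine (D.abs_apply_trunc_le m (D.sub_mem_neg hF1 hF2) (hmq s hsT)).trans ?_
      refine mul_le_mul ((D.rnorm_sub_le hF1 hF2).trans ?_) (hwb s hsT) (D.rnorm_nonneg _ _)
        (by positivity)
      nlinarith [mul_le_mul_of_nonneg_left (hR₁ s hsT) hχ, mul_le_mul_of_nonneg_left (hR₂ s hsT) hχ]
    · simp only [hgm]
      exact (D.tendsto_apply_trunc (D.sub_mem_neg hF1 hF2) (hmq s hsT)).const_mul 2
  have hb : IntegrableOn b (Icc 0 T) :=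
    ((h.integrable.mul_const _).mul_const _).const_mul 2
  have hg'int : IntegrableOn g' (Icc 0 T) := by
    refine Integrable.mono' hb (aestronglyMeasurable_of_tendsto_ae atTop
      (fun m => (hgint m).aestronglyMeasurable) (hgood.mono fun s hs => hs.2.1)) ?_
    filter_upwards [hgood] with s hs
    exact le_of_tendsto hs.2.1.abs (Eventually.of_forall hs.1)
  have hineq : ∀ t ∈ Icc 0 T, D.rnorm q (X t - Y t) ^ 2 ≤
      0 + ∫ s in (0 : ℝ)..t, χ s * D.rnorm q (X s - Y s) ^ 2 := by
    intro t ht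
    have hsub : uIoc 0 t ⊆ Icc 0 T := by
      rw [uIoc_of_le ht.1]; exact fun s hs => ⟨hs.1.le, hs.2.trans ht.2⟩
    have h1 := (D.hasSum_rnorm_sq (hmq t ht)).tendsto_sum_nat
    have h2 : ∀ m, ∑ j ∈ Finset.range m, (X t - Y t) (D.basis j) ^ 2 / D.wt q j ^ 2 =
        ∫ s in (0 : ℝ)..t, g m s := by
      intro m
      have := sum_sq_eq_add_integral m (fun j => D.wt q j ^ 2) (fun _ => 0) (f := f)
        (x := fun j t => (X t - Y t) (D.basis j)) (fun j _ => hf j) (fun j _ => hw j) ht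
      simp only [ne_eq, OfNat.ofNat_ne_zero, not_false_eq_true, zero_pow, zero_div,
        Finset.sum_const_zero, zero_add] at this
      exact this
    have h3 : Tendsto (fun m => ∫ s in (0 : ℝ)..t, g m s) atTop
        (𝓝 (∫ s in (0 : ℝ)..t, g' s)) := by
      have hgood' := (ae_restrict_iff' measurableSet_Icc).1 hgood
      refine intervalIntegral.tendsto_integral_filter_of_dominated_convergence b
        (Eventually.of_forall fun m => ?_) (Eventually.of_forall fun m => ?_)
        (intervalIntegrable_of_Icc hb h0 ht) ?_
      · exact (hgint m).aestronglyMeasurable.mono_measure (Measure.restrict_mono hsub le_rfl)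
      · filter_upwards [hgood'] with s hs hst using (hs (hsub hst)).1 m
      · filter_upwards [hgood'] with s hs hst using (hs (hsub hst)).2.1
    simp only [h2] at h1
    rw [tendsto_nhds_unique h1 h3, zero_add]
    exact integral_mono_Icc hg'int (h.integrable.mul_continuousOn hcont isCompact_Icc) ht
      (hgood.mono fun s hs => hs.2.2)
  intro t ht
  have hfin := le_mul_exp_of_le_add_integral (φ := fun t => D.rnorm q (X t - Y t) ^ 2) hcont
    (fun t _ => by positivity) h.integrable h.nonneg hineq ht
  rw [zero_mul] at hfin
  have hz : D.rnorm q (X t - Y t) = 0 := by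
    have := D.rnorm_nonneg q (X t - Y t)
    have h5 : D.rnorm q (X t - Y t) ^ 2 = 0 := le_antisymm hfin (sq_nonneg _)
    exact pow_eq_zero_iff (two_ne_zero) |>.1 h5
  refine D.ext_basis fun j => ?_
  have h6 := D.abs_le_rnorm (hmq t ht) (D.basis j)
  rw [hz, zero_mul] at h6
  have h7 := abs_nonpos_iff.1 h6
  rw [sub_apply] at h7
  exact sub_eq_zero.1 h7

end DriftConditions
end

/-! ### Entropy inequalities and uniform integrability over `S^N` -/

noncomputable section

/-- From `log s ≥ 1 - 1/s` at `s = √r`: `r log r = 2 r log √r ≥ 2r - 2√r`. The quadratic bound for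
`r ≤ 4` and the linear one for `r ≥ 4` both follow from this. -/
theorem sqrt_sub_one_sq_le_entropyFn {r : ℝ} (hr : 0 ≤ r) : (√r - 1) ^ 2 ≤ entropyFn r := by
  rcases hr.eq_or_lt with rfl | hr
  · simp [entropyFn]
  have hs : 0 < √r := Real.sqrt_pos.2 hr
  have hsq : √r ^ 2 = r := Real.sq_sqrt hr.le
  have h1 := Real.one_sub_inv_le_log_of_pos hs
  have h2 : Real.log r = 2 * Real.log √r := by
    conv_lhs => rw [← hsq, Real.log_pow]
    norm_num
  have h3 := mul_le_mul_of_nonneg_left h1 hr.le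
  have h4 : r * (1 - (√r)⁻¹) = r - √r := by
    rw [mul_sub, mul_one]
    congr 1
    nth_rewrite 1 [← hsq]
    field_simp
  rw [entropyFn, h2]
  nlinarith

theorem entropyFn_nonneg {r : ℝ} (hr : 0 ≤ r) : 0 ≤ entropyFn r :=
  (sq_nonneg _).trans (sqrt_sub_one_sq_le_entropyFn hr)

theorem sub_one_sq_le_entropyFn {r : ℝ} (hr : 0 ≤ r) (hr4 : r ≤ 4) :
    (r - 1) ^ 2 ≤ 9 * entropyFn r := by
  have h1 := sqrt_sub_one_sq_le_entropyFn hr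
  have hsq : √r ^ 2 = r := Real.sq_sqrt hr
  have h2 : √r ≤ 2 := by
    rw [show (2 : ℝ) = √4 by rw [show (4 : ℝ) = 2 ^ 2 by norm_num]; simp]
    exact Real.sqrt_le_sqrt hr4
  have h0 := Real.sqrt_nonneg r
  have h3 : (r - 1) ^ 2 = (√r - 1) ^ 2 * (√r + 1) ^ 2 := by
    rw [← mul_pow]; congr 1; nlinarith
  have h4 : (√r + 1) ^ 2 ≤ 9 := by nlinarith
  rw [h3]
  nlinarith [sq_nonneg (√r - 1)]

theorem le_four_mul_entropyFn {r : ℝ} (hr : 4 ≤ r) : r ≤ 4 * entropyFn r := by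
  have h1 := sqrt_sub_one_sq_le_entropyFn (by linarith : 0 ≤ r)
  have hsq : √r ^ 2 = r := Real.sq_sqrt (by linarith)
  have h2 : 2 ≤ √r := Real.le_sqrt_of_sq_le (by linarith)
  nlinarith

/-- Young's inequality for the conjugate pair `exp` and `l`. -/
theorem mul_le_exp_add_entropyFn (a : ℝ) {r : ℝ} (hr : 0 < r) :
    a * r ≤ Real.exp a + entropyFn r := by
  have h1 := Real.add_one_le_exp (a - Real.log r)
  rw [Real.exp_sub, Real.exp_log hr, le_div_iff₀ hr] at h1
  rw [entropyFn]
  linarith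

/-- Completing the square gives `h ≤ δ h² + 1/(4δ)`. Young's inequality handles `δ h² r`, and `r ≤ 4
l(r)` absorbs `r/(4δ)` into `l(r)/δ`. -/
theorem ENNReal.mul_le_exp_sq_add_entropyFn {δ : ℝ} (hδ : 0 < δ) (h : ℝ≥0∞) {r : ℝ≥0}
    (hr : 4 < r) : h * r ≤ EReal.exp ((ENNReal.ofReal δ * h ^ 2 : ℝ≥0∞) : EReal) +
      ENNReal.ofReal (1 + 1 / δ) * ENNReal.ofReal (entropyFn r) := by
  have hr' : (4 : ℝ) < r := by exact_mod_cast hr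
  rcases eq_or_ne h ∞ with rfl | hh
  · have : ENNReal.ofReal δ * ∞ ^ 2 = ∞ := by
      rw [ENNReal.top_pow two_ne_zero, ENNReal.mul_top (ENNReal.ofReal_pos.2 hδ).ne']
    rw [this, EReal.coe_ennreal_top, EReal.exp_top, top_add]
    exact le_top
  lift h to ℝ≥0 using hh
  have e1 : ENNReal.ofReal δ * (h : ℝ≥0∞) ^ 2 = ENNReal.ofReal (δ * (h : ℝ) ^ 2) := by
    rw [ENNReal.ofReal_mul hδ.le, ENNReal.ofReal_pow h.coe_nonneg, ENNReal.ofReal_coe_nnreal]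
  have hnn : 0 ≤ δ * (h : ℝ) ^ 2 := by positivity
  rw [e1, EReal.coe_ennreal_ofReal, max_eq_left hnn, EReal.exp_coe,
    ← ENNReal.ofReal_mul (by positivity), ← ENNReal.ofReal_add (Real.exp_pos _).le
      (mul_nonneg (by positivity) (entropyFn_nonneg r.coe_nonneg)), ← ENNReal.coe_mul,
    ← ENNReal.ofReal_coe_nnreal]
  refine ENNReal.ofReal_le_ofReal ?_
  push_cast
  have h1 := mul_le_exp_add_entropyFn (δ * (h : ℝ) ^ 2) (by linarith : (0 : ℝ) < r)
  have h2 := le_four_mul_entropyFn hr'.le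
  have h3 : (h : ℝ) ≤ δ * h ^ 2 + 1 / (4 * δ) := by
    have h4 : δ * h ^ 2 + 1 / (4 * δ) - h = (2 * δ * h - 1) ^ 2 / (4 * δ) := by field_simp; ring
    have h5 : 0 ≤ (2 * δ * h - 1) ^ 2 / (4 * δ) := by positivity
    linarith
  have h6 : (h : ℝ) * r ≤ (δ * h ^ 2 + 1 / (4 * δ)) * r :=
    mul_le_mul_of_nonneg_right h3 (by linarith)
  have h7 : 1 / (4 * δ) * (r : ℝ) ≤ 1 / δ * entropyFn r := by
    have : 1 / (4 * δ) * (r : ℝ) ≤ 1 / (4 * δ) * (4 * entropyFn r) := by gcongr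
    refine this.trans (le_of_eq ?_)
    field_simp
  nlinarith

section Halving

variable {𝕏 : Type*} [MeasurableSpace 𝕏]

/-- Intermediate value theorem in the time variable: Lebesgue measure has no atoms, so the measure
of the part of `E` before time `t` is continuous in `t`, whatever `ν` is. -/
theorem exists_nuT_inter_eq_half {ν : Measure 𝕏} [SFinite ν] {T : ℝ} (hT : 0 ≤ T)
    {E : Set (ℝ × 𝕏)} (hE : MeasurableSet E) (hfin : nuT T ν E < ∞) :
    ∃ t : ℝ, nuT T ν (E ∩ Prod.fst ⁻¹' Iic t) = nuT T ν E / 2 := by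
  let m : ℝ → ℝ≥0∞ := fun s => ν (Prod.mk s ⁻¹' E)
  have hm : Measurable m := measurable_measure_prodMk_left hE
  have hmE : nuT T ν E = ∫⁻ s in Icc 0 T, m s := Measure.prod_apply hE
  have hmt : ∀ t ∈ Icc 0 T, nuT T ν (E ∩ Prod.fst ⁻¹' Iic t) = ∫⁻ s in Icc 0 t, m s := by
    intro t ht
    rw [nuT, Measure.prod_apply (hE.inter (measurable_fst measurableSet_Iic))]
    have h1 : (fun s => ν (Prod.mk s ⁻¹' (E ∩ Prod.fst ⁻¹' Iic t))) = (Iic t).indicator m := by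
      funext s
      by_cases hs : s ∈ Iic t
      · rw [indicator_of_mem hs]
        congr 1; ext v
        simp only [mem_preimage, mem_inter_iff, and_iff_left_iff_imp]
        exact fun _ => hs
      · rw [indicator_of_notMem hs]
        have : Prod.mk s ⁻¹' (E ∩ Prod.fst ⁻¹' Iic t) = ∅ := by
          ext v; simp only [mem_preimage, mem_inter_iff, mem_empty_iff_false, iff_false, not_and]
          exact fun _ => hs
        rw [this, measure_empty]
    rw [h1, lintegral_indicator measurableSet_Iic, Measure.restrict_restrict measurableSet_Iic]
    congr 2
    ext s
    simp only [mem_inter_iff, mem_Iic, mem_Icc]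
    constructor
    · rintro ⟨a, b, _⟩; exact ⟨b, a⟩
    · rintro ⟨a, b⟩; exact ⟨b, a, b.trans ht.2⟩
  have hne : ∫⁻ s in Icc 0 T, m s ≠ ∞ := hmE ▸ hfin.ne
  have hint : IntegrableOn (fun s => (m s).toReal) (Icc 0 T) :=
    integrable_toReal_of_lintegral_ne_top hm.aemeasurable hne
  have hval : ∀ t ∈ Icc 0 T, ∫ s in (0 : ℝ)..t, (m s).toReal = (∫⁻ s in Icc 0 t, m s).toReal := by
    intro t ht
    rw [intervalIntegral.integral_of_le ht.1, ← integral_Icc_eq_integral_Ioc, integral_toReal]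
    · exact hm.aemeasurable
    · exact ae_restrict_of_ae_restrict_of_subset (Icc_subset_Icc_right ht.2)
        (ae_lt_top hm hne)
  have hc := continuousOn_primitive_Icc hint
  have hT' : T ∈ Icc 0 T := ⟨hT, le_rfl⟩
  have hivt := intermediate_value_Icc hT hc
  have hmem : (nuT T ν E / 2).toReal ∈
      Icc (∫ s in (0 : ℝ)..0, (m s).toReal) (∫ s in (0 : ℝ)..T, (m s).toReal) := by
    rw [intervalIntegral.integral_same, hval T hT', ← hmE]
    exact ⟨ENNReal.toReal_nonneg, ENNReal.toReal_mono hfin.ne ENNReal.half_le_self⟩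
  obtain ⟨t, ht, hteq⟩ := hivt hmem
  refine ⟨t, ?_⟩
  rw [hmt t ht]
  simp only [hval t ht] at hteq
  refine (ENNReal.toReal_eq_toReal_iff' ?_ ?_).1 hteq
  · exact ne_top_of_le_ne_top hne (lintegral_mono_set (Icc_subset_Icc_right ht.2))
  · exact ne_top_of_le_ne_top hfin.ne ENNReal.half_le_self

/-- Of the two pieces of equal measure, one carries at least half of the integral. -/
theorem exists_subset_half {ν : Measure 𝕏} [SFinite ν] {T : ℝ} (hT : 0 ≤ T)
    (f : ℝ × 𝕏 → ℝ≥0∞) {E : Set (ℝ × 𝕏)} (hE : MeasurableSet E) (hfin : nuT T ν E < ∞) :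
    ∃ E', MeasurableSet E' ∧ nuT T ν E' ≤ nuT T ν E / 2 ∧
      (∫⁻ z in E, f z ∂(nuT T ν)) / 2 ≤ ∫⁻ z in E', f z ∂(nuT T ν) := by
  obtain ⟨t, ht⟩ := exists_nuT_inter_eq_half hT hE hfin
  set B : Set (ℝ × 𝕏) := Prod.fst ⁻¹' Iic t
  have hB : MeasurableSet B := measurable_fst measurableSet_Iic
  have h1 := lintegral_inter_add_sdiff (μ := nuT T ν) f E hB
  by_cases hle : (∫⁻ z in E, f z ∂(nuT T ν)) / 2 ≤ ∫⁻ z in E ∩ B, f z ∂(nuT T ν)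
  · exact ⟨E ∩ B, hE.inter hB, ht.le, hle⟩
  · refine ⟨E \ B, hE.diff hB, ?_, ?_⟩
    · have h2 := measure_inter_add_sdiff (μ := nuT T ν) E hB
      rw [ht] at h2
      have h3 : nuT T ν E / 2 + nuT T ν (E \ B) = nuT T ν E / 2 + nuT T ν E / 2 := by
        rw [h2, ENNReal.add_halves]
      exact ((ENNReal.add_right_inj
        (ne_top_of_le_ne_top hfin.ne ENNReal.half_le_self)).1 h3).le
    · by_contra hcon
      push Not at hle hcon
      have h4 := ENNReal.add_lt_add hle hcon
      rw [h1, ENNReal.add_halves] at h4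
      exact lt_irrefl _ h4

theorem exists_subset_half_pow {ν : Measure 𝕏} [SFinite ν] {T : ℝ} (hT : 0 ≤ T)
    (f : ℝ × 𝕏 → ℝ≥0∞) (n : ℕ) : ∀ {E : Set (ℝ × 𝕏)}, MeasurableSet E → nuT T ν E < ∞ →
    ∃ E', MeasurableSet E' ∧ nuT T ν E' ≤ nuT T ν E / 2 ^ n ∧
      (∫⁻ z in E, f z ∂(nuT T ν)) / 2 ^ n ≤ ∫⁻ z in E', f z ∂(nuT T ν) := by
  induction n with
  | zero => intro E hE _; exact ⟨E, hE, by simp, by simp⟩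
  | succ n ih =>
    intro E hE hfin
    obtain ⟨E₁, h1, h2, h3⟩ := ih hE hfin
    have hfin₁ : nuT T ν E₁ < ∞ :=
      h2.trans_lt (ENNReal.div_lt_top hfin.ne (by positivity))
    obtain ⟨E₂, h4, h5, h6⟩ := exists_subset_half hT f h1 hfin₁
    have hdiv : ∀ a : ℝ≥0∞, a / 2 ^ (n + 1) = a / 2 ^ n / 2 := by
      intro a
      rw [pow_succ, div_eq_mul_inv, div_eq_mul_inv, div_eq_mul_inv, mul_assoc,
        ENNReal.mul_inv (Or.inl (by positivity)) (Or.inl (by finiteness))]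
    refine ⟨E₂, h4, ?_, ?_⟩
    · rw [hdiv]; exact h5.trans (ENNReal.div_le_div_right h2 2)
    · rw [hdiv]; exact (ENNReal.div_le_div_right h3 2).trans h6

/-- If `f` has finite integral over every set of finite `ν_T`-measure, then these integrals are
bounded uniformly over the sets of measure at most `c`. -/
theorem exists_uniform_setLIntegral_bound {ν : Measure 𝕏} [SFinite ν] {T : ℝ} (hT : 0 ≤ T)
    (f : ℝ × 𝕏 → ℝ≥0∞)
    (hf : ∀ E, MeasurableSet E → nuT T ν E < ∞ → ∫⁻ z in E, f z ∂(nuT T ν) < ∞)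
    {c : ℝ≥0∞} (hc : c < ∞) : ∃ C : ℝ≥0∞, C < ∞ ∧ ∀ E, MeasurableSet E → nuT T ν E ≤ c →
      ∫⁻ z in E, f z ∂(nuT T ν) ≤ C := by
  by_contra! hcon
  -- Start from a set of measure at most `c` with integral above `4^n` and halve it `n` times: the
  -- measure falls to `c / 2^n`, while the integral remains at least `2^n`. The union of these sets
  -- has finite measure but infinite integral.
  have hE : ∀ n : ℕ, ∃ E, MeasurableSet E ∧ nuT T ν E ≤ c / 2 ^ n ∧
      (2 : ℝ≥0∞) ^ n ≤ ∫⁻ z in E, f z ∂(nuT T ν) := by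
    intro n
    obtain ⟨E, hE, hEc, hlt⟩ := hcon (2 ^ n * 2 ^ n) (by finiteness)
    obtain ⟨E', h1, h2, h3⟩ := exists_subset_half_pow hT f n hE (hEc.trans_lt hc)
    refine ⟨E', h1, h2.trans (ENNReal.div_le_div_right hEc _), le_trans ?_ h3⟩
    rw [ENNReal.le_div_iff_mul_le (Or.inl (by positivity)) (Or.inl (by finiteness))]
    exact hlt.le
  choose E hEm hEc hEf using hE
  have h1 : nuT T ν (⋃ n, E n) < ∞ := by
    refine (measure_iUnion_le E).trans_lt ?_
    refine (ENNReal.tsum_le_tsum hEc).trans_lt ?_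
    simp only [div_eq_mul_inv]
    rw [ENNReal.tsum_mul_left]
    refine ENNReal.mul_lt_top hc ?_
    simp only [ENNReal.inv_pow]
    rw [ENNReal.tsum_geometric]
    simp
  have h2 := hf _ (MeasurableSet.iUnion hEm) h1
  obtain ⟨n, hn⟩ := ENNReal.exists_nat_gt h2.ne
  have h3 : (2 : ℝ≥0∞) ^ n ≤ ∫⁻ z in ⋃ n, E n, f z ∂(nuT T ν) :=
    (hEf n).trans (lintegral_mono_set (subset_iUnion E n))
  have h4 : (n : ℝ≥0∞) ≤ 2 ^ n := by exact_mod_cast (Nat.lt_two_pow_self (n := n)).le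
  exact absurd (h3.trans_lt hn) (not_lt.2 h4)

theorem measurableSet_four_lt {g : ℝ × 𝕏 → ℝ≥0} (hg : Measurable g) :
    MeasurableSet {z | 4 < g z} := measurableSet_lt measurable_const hg

theorem measurable_entropyFn : Measurable entropyFn := by
  unfold entropyFn
  exact ((measurable_id.mul Real.measurable_log).sub measurable_id).add_const 1

theorem nuT_four_lt_le {ν : Measure 𝕏} {T : ℝ} {g : ℝ × 𝕏 → ℝ≥0} (hg : Measurable g) :
    nuT T ν {z | 4 < g z} ≤ costT T ν g := by
  rw [← lintegral_indicator_one (measurableSet_four_lt hg)]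
  refine lintegral_mono fun z => ?_
  by_cases hz : 4 < g z
  · rw [indicator_of_mem (show z ∈ {z | 4 < g z} from hz), Pi.one_apply, ← ENNReal.ofReal_one]
    refine ENNReal.ofReal_le_ofReal ?_
    have hz' : (4 : ℝ) < g z := by exact_mod_cast hz
    linarith [le_four_mul_entropyFn hz'.le]
  · rw [indicator_of_notMem (show z ∉ {z | 4 < g z} from hz)]; exact zero_le

/-- Uniform integrability of `h · g` over the large values of the controls `g ∈ S^N`. -/
theorem ExpSqIntegrable.exists_uniform_bound {ν : Measure 𝕏} [SFinite ν] {T : ℝ} (hT : 0 ≤ T)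
    {h : ℝ × 𝕏 → ℝ≥0∞} (hh : ExpSqIntegrable (nuT T ν) h) (N : ℕ) :
    ∃ C : ℝ≥0∞, C < ∞ ∧ ∀ g ∈ controlSet T ν N,
      AEMeasurable h ((nuT T ν).restrict {z | 4 < g z}) ∧
      ∫⁻ z in {z | 4 < g z}, h z * g z ∂(nuT T ν) ≤ C := by
  obtain ⟨δ, hδ, hE⟩ := hh
  obtain ⟨C, hC, hCb⟩ := exists_uniform_setLIntegral_bound hT _ (fun E h1 h2 => (hE E h1 h2).2)
    (c := N) (by finiteness)
  refine ⟨C + ENNReal.ofReal (1 + 1 / δ) * N, by finiteness, fun g hg => ?_⟩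
  have hm := measurableSet_four_lt hg.1
  have hle : nuT T ν {z | 4 < g z} ≤ N := (nuT_four_lt_le hg.1).trans hg.2
  refine ⟨(hE _ hm (hle.trans_lt (by finiteness))).1, ?_⟩
  have hgm : Measurable fun z => ENNReal.ofReal (entropyFn (g z)) :=
    (measurable_entropyFn.comp (measurable_coe_nnreal_real.comp hg.1)).ennreal_ofReal
  calc ∫⁻ z in {z | 4 < g z}, h z * g z ∂(nuT T ν)
      ≤ ∫⁻ z in {z | 4 < g z}, (EReal.exp ((ENNReal.ofReal δ * h z ^ 2 : ℝ≥0∞) : EReal) +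
          ENNReal.ofReal (1 + 1 / δ) * ENNReal.ofReal (entropyFn (g z))) ∂(nuT T ν) :=
        setLIntegral_mono' hm fun z hz => ENNReal.mul_le_exp_sq_add_entropyFn hδ _ hz
    _ = ∫⁻ z in {z | 4 < g z}, EReal.exp ((ENNReal.ofReal δ * h z ^ 2 : ℝ≥0∞) : EReal)
          ∂(nuT T ν) + ENNReal.ofReal (1 + 1 / δ) *
          ∫⁻ z in {z | 4 < g z}, ENNReal.ofReal (entropyFn (g z)) ∂(nuT T ν) := by
        rw [lintegral_add_right _ (hgm.const_mul _), lintegral_const_mul _ hgm]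
    _ ≤ C + ENNReal.ofReal (1 + 1 / δ) * N := by
        gcongr
        · exact hCb _ hm hle
        · exact (setLIntegral_le_lintegral _ _).trans hg.2

end Halving
end

/-! ### Integrating against `g - 1`: the control rate and weak integrals -/

noncomputable section

theorem ENNReal.two_mul_mul_le (a b : ℝ≥0∞) {θ : ℝ} (hθ : 0 < θ) :
    2 * (a * b) ≤ ENNReal.ofReal θ⁻¹ * a ^ 2 + ENNReal.ofReal θ * b ^ 2 := by
  have h1 : ENNReal.ofReal θ ≠ 0 := (ENNReal.ofReal_pos.2 hθ).ne'
  have h2 : ENNReal.ofReal θ⁻¹ ≠ 0 := (ENNReal.ofReal_pos.2 (inv_pos.2 hθ)).ne'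
  rcases eq_or_ne a ∞ with rfl | ha
  · rw [ENNReal.top_pow two_ne_zero, ENNReal.mul_top h2, top_add]; exact le_top
  rcases eq_or_ne b ∞ with rfl | hb
  · rw [ENNReal.top_pow two_ne_zero, ENNReal.mul_top h1, add_top]; exact le_top
  lift a to ℝ≥0 using ha
  lift b to ℝ≥0 using hb
  rw [← ENNReal.ofReal_coe_nnreal (p := a), ← ENNReal.ofReal_coe_nnreal (p := b),
    ← ENNReal.ofReal_mul a.coe_nonneg, ← ENNReal.ofReal_pow a.coe_nonneg,
    ← ENNReal.ofReal_pow b.coe_nonneg, ← ENNReal.ofReal_mul (inv_pos.2 hθ).le,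
    ← ENNReal.ofReal_mul hθ.le, ← ENNReal.ofReal_add (by positivity) (by positivity),
    ← ENNReal.ofReal_ofNat, ← ENNReal.ofReal_mul (by norm_num)]
  refine ENNReal.ofReal_le_ofReal ?_
  have h3 : θ⁻¹ * (a : ℝ) ^ 2 + θ * b ^ 2 - 2 * (a * b) = θ⁻¹ * (a - θ * b) ^ 2 := by
    field_simp; ring
  have h4 : 0 ≤ θ⁻¹ * ((a : ℝ) - θ * b) ^ 2 := by positivity
  linarith

/-- The deviation `|g - 1|` of a control from `1`. -/
def deviation {𝕏 : Type*} (g : ℝ × 𝕏 → ℝ≥0) (z : ℝ × 𝕏) : ℝ≥0∞ := ENNReal.ofReal |(g z : ℝ) - 1|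

theorem deviation_sq_le {𝕏 : Type*} {g : ℝ × 𝕏 → ℝ≥0} {z : ℝ × 𝕏} (h : g z ≤ 4) :
    deviation g z ^ 2 ≤ 9 * ENNReal.ofReal (entropyFn (g z)) := by
  have h' : (g z : ℝ) ≤ 4 := by exact_mod_cast h
  rw [deviation, ← ENNReal.ofReal_pow (abs_nonneg _), sq_abs, ← ENNReal.ofReal_ofNat,
    ← ENNReal.ofReal_mul (by norm_num)]
  exact ENNReal.ofReal_le_ofReal (sub_one_sq_le_entropyFn (g z).coe_nonneg h')

theorem deviation_le {𝕏 : Type*} {g : ℝ × 𝕏 → ℝ≥0} {z : ℝ × 𝕏} (h : 4 < g z) :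
    deviation g z ≤ g z := by
  have h' : (4 : ℝ) < g z := by exact_mod_cast h
  rw [deviation, ← ENNReal.ofReal_coe_nnreal]
  refine ENNReal.ofReal_le_ofReal ?_
  rw [abs_of_nonneg (by linarith)]
  linarith

section Control

variable {𝕏 : Type*} [MeasurableSpace 𝕏]

theorem measurable_deviation {g : ℝ × 𝕏 → ℝ≥0} (hg : Measurable g) : Measurable (deviation g) := by
  unfold deviation
  exact ((measurable_coe_nnreal_real.comp hg).sub_const 1).norm.ennreal_ofReal

/-- The density that controls a control `g` against a majorant `h`: the entropy of `g`, and `h · g`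
where `g` is large. -/
def controlDensity (g : ℝ × 𝕏 → ℝ≥0) (h : ℝ × 𝕏 → ℝ≥0∞) (z : ℝ × 𝕏) : ℝ≥0∞ :=
  ENNReal.ofReal (entropyFn (g z)) + {z | 4 < g z}.indicator (fun z => h z * g z) z

/-- The integral over `𝕏` of the control density at time `s`. -/
def controlRate (ν : Measure 𝕏) (g : ℝ × 𝕏 → ℝ≥0) (h : ℝ × 𝕏 → ℝ≥0∞) (s : ℝ) : ℝ≥0∞ :=
  ∫⁻ v, controlDensity g h (s, v) ∂ν

/-- Tonelli reduces the time integral to `∫ l(g) ≤ N` plus the integrals of `h₀ g` and `h₁ g` over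
`{g > 4}`. The majorants are known to be measurable only on sets of finite measure, and `{g > 4}` is
one. -/
theorem exists_controlRate_bound {ν : Measure 𝕏} [SFinite ν] {T : ℝ} (hT : 0 ≤ T)
    {h₀ h₁ : ℝ × 𝕏 → ℝ≥0∞} (hh₀ : ExpSqIntegrable (nuT T ν) h₀)
    (hh₁ : ExpSqIntegrable (nuT T ν) h₁) (N : ℕ) :
    ∃ C : ℝ≥0∞, C < ∞ ∧ ∀ g ∈ controlSet T ν N,
      AEMeasurable (controlRate ν g (h₀ + h₁)) (volume.restrict (Icc 0 T)) ∧
      ∫⁻ s in Icc 0 T, controlRate ν g (h₀ + h₁) s ≤ C := by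
  obtain ⟨C₀, hC₀, hb₀⟩ := hh₀.exists_uniform_bound hT N
  obtain ⟨C₁, hC₁, hb₁⟩ := hh₁.exists_uniform_bound hT N
  refine ⟨N + (C₀ + C₁), by finiteness, fun g hg => ?_⟩
  obtain ⟨hm₀, hi₀⟩ := hb₀ g hg
  obtain ⟨hm₁, hi₁⟩ := hb₁ g hg
  have hE := measurableSet_four_lt hg.1
  have hgE : Measurable fun z => (g z : ℝ≥0∞) := hg.1.coe_nnreal_ennreal
  have hgm : Measurable fun z => ENNReal.ofReal (entropyFn (g z)) :=
    (measurable_entropyFn.comp (measurable_coe_nnreal_real.comp hg.1)).ennreal_ofReal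
  have hmd : AEMeasurable (controlDensity g (h₀ + h₁)) (nuT T ν) :=
    hgm.aemeasurable.add ((aemeasurable_indicator_iff hE).2
      ((hm₀.add hm₁).mul hgE.aemeasurable))
  refine ⟨hmd.lintegral_prod_right', ?_⟩
  have h1 : ∫⁻ s in Icc 0 T, controlRate ν g (h₀ + h₁) s =
      ∫⁻ z, controlDensity g (h₀ + h₁) z ∂(nuT T ν) := (lintegral_prod _ hmd).symm
  rw [h1]
  unfold controlDensity
  rw [lintegral_add_left hgm, lintegral_indicator hE]
  refine add_le_add hg.2 ?_
  simp only [Pi.add_apply, add_mul]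
  have hmul : AEMeasurable (fun z => h₀ z * (g z : ℝ≥0∞)) ((nuT T ν).restrict {z | 4 < g z}) :=
    hm₀.mul hgE.aemeasurable
  rw [lintegral_add_left' hmul]
  exact add_le_add hi₀ hi₁

/-- The basic estimate for the jump term. Where `g ≤ 4`, Young's inequality with weight `θ` is
combined with `(g - 1)² ≤ 9 l(g)`; where `g > 4`, `|g - 1| ≤ g` is combined with the pointwise bound
on `a`. The parameter `θ` is matched to the use: `1 + ‖u‖` for growth, `‖u₁ - u₂‖_{-q}` for
monotonicity, and a null sequence for continuity. -/
theorem two_mul_lintegral_mul_deviation_le {ν : Measure 𝕏} {g : ℝ × 𝕏 → ℝ≥0}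
    {h h' : ℝ × 𝕏 → ℝ≥0∞} (hh : ∀ z, h' z ≤ h z) {s : ℝ} {a : 𝕏 → ℝ≥0∞} (ha : Measurable a)
    {c : ℝ≥0∞} (hc : c ≠ ∞) (hac : ∀ v, a v ≤ h' (s, v) * c) {θ : ℝ} (hθ : 0 < θ) :
    2 * ∫⁻ v, a v * deviation g (s, v) ∂ν ≤
      ENNReal.ofReal θ⁻¹ * ∫⁻ v, a v ^ 2 ∂ν +
        (9 * ENNReal.ofReal θ + 2 * c) * controlRate ν g h s := by
  rw [← lintegral_const_mul' _ _ (by finiteness), controlRate,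
    ← lintegral_const_mul' _ _ (by finiteness), ← lintegral_const_mul' _ _ (by finiteness),
    ← lintegral_add_left ((ha.pow_const 2).const_mul _)]
  refine lintegral_mono fun v => ?_
  by_cases hz : 4 < g (s, v)
  · have h1 : controlDensity g h (s, v) =
        ENNReal.ofReal (entropyFn (g (s, v))) + h (s, v) * g (s, v) := by
      rw [controlDensity, indicator_of_mem (show (s, v) ∈ {z | 4 < g z} from hz)]
    refine le_add_left ?_
    rw [h1]
    calc 2 * (a v * deviation g (s, v))
        ≤ 2 * ((h' (s, v) * c) * g (s, v)) := by
          gcongr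
          · exact hac v
          · exact deviation_le hz
      _ ≤ 2 * ((h (s, v) * c) * g (s, v)) := by gcongr; exact hh _
      _ = (2 * c) * (h (s, v) * g (s, v)) := by ring
      _ ≤ _ := by
          gcongr
          · exact le_add_self
          · exact le_add_self
  · have h1 : controlDensity g h (s, v) = ENNReal.ofReal (entropyFn (g (s, v))) := by
      rw [controlDensity, indicator_of_notMem (show (s, v) ∉ {z | 4 < g z} from hz), add_zero]
    rw [h1]
    refine (ENNReal.two_mul_mul_le (a v) (deviation g (s, v)) hθ).trans ?_
    refine add_le_add le_rfl ?_
    calc ENNReal.ofReal θ * deviation g (s, v) ^ 2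
        ≤ ENNReal.ofReal θ * (9 * ENNReal.ofReal (entropyFn (g (s, v)))) := by
          gcongr; exact deviation_sq_le (not_lt.1 hz)
      _ = 9 * ENNReal.ofReal θ * ENNReal.ofReal (entropyFn (g (s, v))) := by ring
      _ ≤ _ := by gcongr; exact le_self_add

theorem measurable_cylinderSigma_of_apply {Φ : Type*} [AddCommGroup Φ] [Module ℝ Φ]
    [UniformSpace Φ] {Z : Type*} [MeasurableSpace Z]
    {U : Z → (Φ →L[ℝ] ℝ)} (hU : ∀ φ, Measurable fun z => U z φ) :
    @Measurable Z (Φ →L[ℝ] ℝ) _ (cylinderSigma Φ) U :=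
  measurable_comap_iff.2 (measurable_pi_iff.2 hU)

theorem measurable_apply_cylinderSigma {Φ : Type*} [AddCommGroup Φ] [Module ℝ Φ] [UniformSpace Φ]
    (φ : Φ) :
    @Measurable (Φ →L[ℝ] ℝ) ℝ (cylinderSigma Φ) _ (fun u => u φ) := by
  let _ := cylinderSigma Φ
  exact (measurable_pi_apply φ).comp
    (comap_measurable (fun (u : Φ →L[ℝ] ℝ) (φ : Φ) => u φ))

section MeasurableCoeffs

variable {Φ : Type*} [AddCommGroup Φ] [Module ℝ Φ] [UniformSpace Φ]
variable {A : ℝ → (Φ →L[ℝ] ℝ) → (Φ →L[ℝ] ℝ)} {G : ℝ → (Φ →L[ℝ] ℝ) → 𝕏 → (Φ →L[ℝ] ℝ)}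

theorem MeasurableCoeffs.measurable_A (h : MeasurableCoeffs A G) {Y : ℝ → (Φ →L[ℝ] ℝ)}
    (hY : ∀ φ, Measurable fun s => Y s φ) (φ : Φ) : Measurable fun s => A s (Y s) φ := by
  let _ := cylinderSigma Φ
  have hY' : Measurable Y := measurable_cylinderSigma_of_apply hY
  exact (measurable_apply_cylinderSigma φ).comp (h.1.comp (measurable_id.prodMk hY'))

theorem MeasurableCoeffs.measurable_G (h : MeasurableCoeffs A G) {Y : ℝ → (Φ →L[ℝ] ℝ)}
    (hY : ∀ φ, Measurable fun s => Y s φ) (φ : Φ) :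
    Measurable fun z : ℝ × 𝕏 => G z.1 (Y z.1) z.2 φ := by
  let _ := cylinderSigma Φ
  have hY' : Measurable Y := measurable_cylinderSigma_of_apply hY
  exact (measurable_apply_cylinderSigma φ).comp (h.2.comp
    (measurable_fst.prodMk ((hY'.comp measurable_fst).prodMk measurable_snd)))

theorem MeasurableCoeffs.measurable_G_apply (h : MeasurableCoeffs A G) (s : ℝ) (u : Φ →L[ℝ] ℝ)
    (φ : Φ) : Measurable fun v => G s u v φ :=
  (h.measurable_G (Y := fun _ => u) (fun _ => measurable_const) φ).comp measurable_prodMk_left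

end MeasurableCoeffs

variable {Φ : Type*} [AddCommGroup Φ] [Module ℝ Φ] [UniformSpace Φ] [IsUniformAddGroup Φ]

/-- By Parseval the squared norm is a countable sum of squared evaluations, so measurability of the
evaluations suffices. -/
theorem CHNS.measurable_rnorm (D : CHNS Φ) {Z : Type*} [MeasurableSpace Z] {r : ℕ}
    {U : Z → (Φ →L[ℝ] ℝ)} (hU : ∀ φ, Measurable fun z => U z φ) (hm : ∀ z, U z ∈ D.neg r) :
    Measurable fun z => D.rnorm r (U z) := by
  have h1 : Measurable fun z => D.rnorm r (U z) ^ 2 := by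
    refine measurable_of_tendsto_metrizable (f := fun n z =>
      ∑ j ∈ Finset.range n, U z (D.basis j) ^ 2 / D.wt r j ^ 2) (fun n => ?_) ?_
    · exact Finset.measurable_sum _ fun j _ => ((hU _).pow_const 2).div_const _
    · rw [tendsto_pi_nhds]
      exact fun z => (D.hasSum_rnorm_sq (hm z)).tendsto_sum_nat
  have h2 := h1.sqrt
  simpa only [Real.sqrt_sq (D.rnorm_nonneg _ _)] using h2

theorem CHNS.measurable_dualNorm (D : CHNS Φ) {Z : Type*} [MeasurableSpace Z] {r : ℕ}
    {U : Z → (Φ →L[ℝ] ℝ)} (hU : ∀ φ, Measurable fun z => U z φ) (hm : ∀ z, U z ∈ D.neg r) :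
    Measurable fun z => D.dualNorm r (U z) := by
  have h := (D.measurable_rnorm hU hm).ennreal_ofReal
  simpa only [D.ofReal_rnorm (hm _)] using h

theorem CHNS.lintegral_enorm_apply_mul_le (D : CHNS Φ) {Z : Type*} [MeasurableSpace Z]
    {μ : Measure Z} {r : ℕ} {U : Z → (Φ →L[ℝ] ℝ)} {m : Z → ℝ} {C : ℝ}
    (hb : ∫⁻ z, D.dualNorm r (U z) * ENNReal.ofReal |m z| ∂μ ≤ ENNReal.ofReal C) (φ : Φ) :
    ∫⁻ z, ‖U z φ * m z‖ₑ ∂μ ≤ ENNReal.ofReal (C * D.nrm r φ) := by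
  calc ∫⁻ z, ‖U z φ * m z‖ₑ ∂μ
      ≤ ∫⁻ z, ENNReal.ofReal (D.nrm r φ) *
          (D.dualNorm r (U z) * ENNReal.ofReal |m z|) ∂μ := by
        refine lintegral_mono fun z => ?_
        rw [Real.enorm_eq_ofReal_abs, abs_mul, ENNReal.ofReal_mul (abs_nonneg _), ← mul_assoc,
          mul_comm (ENNReal.ofReal (D.nrm r φ))]
        gcongr
        exact D.ofReal_abs_le r (U z) φ
    _ = ENNReal.ofReal (D.nrm r φ) * ∫⁻ z, D.dualNorm r (U z) * ENNReal.ofReal |m z| ∂μ :=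
        lintegral_const_mul' _ _ ENNReal.ofReal_ne_top
    _ ≤ ENNReal.ofReal (D.nrm r φ) * ENNReal.ofReal C := by gcongr
    _ = _ := by rw [← ENNReal.ofReal_mul (apply_nonneg _ _), mul_comm]

/-- Weak integrability of `Φ_{-r}`-valued functions against a signed weight. -/
theorem CHNS.integrable_apply_mul (D : CHNS Φ) {Z : Type*} [MeasurableSpace Z] {μ : Measure Z}
    {r : ℕ} {U : Z → (Φ →L[ℝ] ℝ)} (hU : ∀ φ, Measurable fun z => U z φ)
    {m : Z → ℝ} (hm : Measurable m) {C : ℝ} (hC : 0 ≤ C)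
    (hb : ∫⁻ z, D.dualNorm r (U z) * ENNReal.ofReal |m z| ∂μ ≤ ENNReal.ofReal C) (φ : Φ) :
    Integrable (fun z => U z φ * m z) μ ∧ |∫ z, U z φ * m z ∂μ| ≤ C * D.nrm r φ := by
  have h1 := D.lintegral_enorm_apply_mul_le hb φ
  refine ⟨⟨((hU φ).mul hm).aestronglyMeasurable, h1.trans_lt ENNReal.ofReal_lt_top⟩, ?_⟩
  have h2 := enorm_integral_le_lintegral_enorm (μ := μ) (fun z => U z φ * m z)
  rw [Real.enorm_eq_ofReal_abs] at h2
  exact (ENNReal.ofReal_le_ofReal_iff (mul_nonneg hC (apply_nonneg _ _))).1 (h2.trans h1)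

theorem CHNS.exists_weak_integral (D : CHNS Φ) {Z : Type*} [MeasurableSpace Z] {μ : Measure Z}
    {r : ℕ} {U : Z → (Φ →L[ℝ] ℝ)} (hU : ∀ φ, Measurable fun z => U z φ)
    {m : Z → ℝ} (hm : Measurable m) {C : ℝ} (hC : 0 ≤ C)
    (hb : ∫⁻ z, D.dualNorm r (U z) * ENNReal.ofReal |m z| ∂μ ≤ ENNReal.ofReal C) :
    ∃ f : Φ →L[ℝ] ℝ, ∀ φ, f φ = ∫ z, U z φ * m z ∂μ := by
  have hi := D.integrable_apply_mul hU hm hC hb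
  obtain ⟨L, hL⟩ : ∃ L : Φ →ₗ[ℝ] ℝ, ∀ φ, L φ = ∫ z, U z φ * m z ∂μ := by
    refine ⟨⟨⟨fun φ => ∫ z, U z φ * m z ∂μ, fun φ ψ => ?_⟩, fun c φ => ?_⟩, fun φ => rfl⟩
    · simp only [map_add, add_mul]
      exact integral_add (hi φ).1 (hi ψ).1
    · simp only [map_smul, smul_eq_mul, RingHom.id_apply, mul_assoc]
      exact integral_const_mul _ _
  obtain ⟨f, hf⟩ := D.exists_clm r L hC fun φ => by rw [hL]; exact (hi φ).2
  exact ⟨f, fun φ => by rw [hf, hL]⟩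

end Control
end

/-! ### Bounds on the jump part of the drift -/

noncomputable section

variable {Φ : Type*} [AddCommGroup Φ] [Module ℝ Φ] [UniformSpace Φ] [IsUniformAddGroup Φ]
variable {𝕏 : Type*} [MeasurableSpace 𝕏]

theorem CoeffConditionAt.mono_const {D : CHNS Φ} {ν : Measure 𝕏} {T : ℝ}
    {A : ℝ → (Φ →L[ℝ] ℝ) → (Φ →L[ℝ] ℝ)} {G : ℝ → (Φ →L[ℝ] ℝ) → 𝕏 → (Φ →L[ℝ] ℝ)} {p q : ℕ}
    {K k : ℝ} (h : CoeffConditionAt D ν T A G p q K) (hk : K ≤ k) :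
    CoeffConditionAt D ν T A G p q k where
  le := h.le
  A_mem := h.A_mem
  G_mem := h.G_mem
  G_sq_integrable := h.G_sq_integrable
  A_cont := h.A_cont
  G_cont := h.G_cont
  coercive t ht φ := (h.coercive t ht φ).trans (mul_le_mul_of_nonneg_right hk (by positivity))
  A_growth t ht u hu := (h.A_growth t ht u hu).trans (by gcongr)
  G_growth t ht u hu := (h.G_growth t ht u hu).trans (by gcongr)
  monotone t ht u₁ h₁ u₂ h₂ := (h.monotone t ht u₁ h₁ u₂ h₂).trans
    (mul_le_mul_of_nonneg_right hk (by positivity))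

/-- The coefficients satisfy the standing conditions at the levels `p` and `p₁`, with a common
constant `k`. -/
structure SkeletonSetting (D : CHNS Φ) (ν : Measure 𝕏) (T : ℝ)
    (A : ℝ → (Φ →L[ℝ] ℝ) → (Φ →L[ℝ] ℝ)) (G : ℝ → (Φ →L[ℝ] ℝ) → 𝕏 → (Φ →L[ℝ] ℝ))
    (p p₁ q : ℕ) (k : ℝ) : Prop where
  pos : 0 < T
  one_le : 1 ≤ k
  le : p ≤ p₁
  hilbertSchmidt : Summable fun j => D.wt p j ^ 2 / D.wt p₁ j ^ 2
  meas : MeasurableCoeffs A G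
  cond : ∃ q', CoeffConditionAt D ν T A G p q' k
  cond₁ : CoeffConditionAt D ν T A G p₁ q k

/-- The integrable rate attached to a control. -/
def skeletonRate (D : CHNS Φ) (ν : Measure 𝕏) (G : ℝ → (Φ →L[ℝ] ℝ) → 𝕏 → (Φ →L[ℝ] ℝ)) (p q : ℕ)
    (g : ℝ × 𝕏 → ℝ≥0) (s : ℝ) : ℝ≥0∞ :=
  controlRate ν g (growthNorm D G p + lipNorm D G q) s

open scoped Classical in
/-- The functional `φ ↦ ∫ G(s,u,v)[φ] (g(s,v) - 1) ν(dv)`. -/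
def jumpDrift (ν : Measure 𝕏) (G : ℝ → (Φ →L[ℝ] ℝ) → 𝕏 → (Φ →L[ℝ] ℝ)) (g : ℝ × 𝕏 → ℝ≥0)
    (s : ℝ) (u : Φ →L[ℝ] ℝ) : Φ →L[ℝ] ℝ :=
  if h : ∃ f : Φ →L[ℝ] ℝ, ∀ φ, f φ = ∫ v, G s u v φ * ((g (s, v) : ℝ) - 1) ∂ν then h.choose else 0

theorem ENNReal.add_sq_le (a b : ℝ≥0∞) : (a + b) ^ 2 ≤ 2 * a ^ 2 + 2 * b ^ 2 := by
  have h := ENNReal.two_mul_mul_le a b one_pos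
  simp only [inv_one, ENNReal.ofReal_one, one_mul] at h
  calc (a + b) ^ 2 = a ^ 2 + b ^ 2 + 2 * (a * b) := by ring
    _ ≤ a ^ 2 + b ^ 2 + (a ^ 2 + b ^ 2) := by gcongr
    _ = _ := by ring

namespace SkeletonSetting

variable {D : CHNS Φ} {ν : Measure 𝕏} {T : ℝ} {A : ℝ → (Φ →L[ℝ] ℝ) → (Φ →L[ℝ] ℝ)}
  {G : ℝ → (Φ →L[ℝ] ℝ) → 𝕏 → (Φ →L[ℝ] ℝ)} {p p₁ q : ℕ} {k : ℝ} {g : ℝ × 𝕏 → ℝ≥0} {s : ℝ}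

theorem measurable_dualNorm_G (S : SkeletonSetting D ν T A G p p₁ q k) {r : ℕ} {u : Φ →L[ℝ] ℝ}
    (hm : ∀ v, G s u v ∈ D.neg r) : Measurable fun v => D.dualNorm r (G s u v) :=
  D.measurable_dualNorm (fun φ => S.meas.measurable_G_apply s u φ) hm

/-- The choice `θ = 1 + ‖u‖_{-p}` makes both parts linear in `1 + ‖u‖_{-p}`; `11 = 9 + 2` collects
the contributions of small and large `g`. The bound is in `Φ_{-p}` itself, as coercivity requires.
-/
theorem jump_bound (S : SkeletonSetting D ν T A G p p₁ q k) (hs : s ∈ Icc 0 T)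
    (hH : skeletonRate D ν G p q g s < ∞) {u : Φ →L[ℝ] ℝ} (hu : u ∈ D.neg p) :
    ∫⁻ v, D.dualNorm p (G s u v) * deviation g (s, v) ∂ν ≤
      ENNReal.ofReal ((1 + D.rnorm p u) * (k + 11 * (skeletonRate D ν G p q g s).toReal)) := by
  obtain ⟨q', hc⟩ := S.cond
  have hk := S.one_le
  set n := D.rnorm p u with hn
  have hn0 : 0 ≤ n := D.rnorm_nonneg p u
  set ρ := (skeletonRate D ν G p q g s).toReal with hρ
  have hρ0 : 0 ≤ ρ := ENNReal.toReal_nonneg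
  have hρ' : skeletonRate D ν G p q g s = ENNReal.ofReal ρ := (ENNReal.ofReal_toReal hH.ne).symm
  have h1n : 1 + D.dualNorm p u = ENNReal.ofReal (1 + n) := by
    rw [ENNReal.ofReal_add zero_le_one hn0, ENNReal.ofReal_one, hn, D.ofReal_rnorm hu]
  have h1 := two_mul_lintegral_mul_deviation_le (ν := ν) (g := g) (s := s)
    (h := growthNorm D G p + lipNorm D G q) (h' := growthNorm D G p) (fun z => le_self_add)
    (S.measurable_dualNorm_G (hc.G_mem s hs u hu)) (c := ENNReal.ofReal (1 + n))
    ENNReal.ofReal_ne_top (fun v => ?_) (θ := 1 + n) (by positivity)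
  · have h2 := hc.G_growth s hs u hu
    have h3 : ENNReal.ofReal k * (1 + D.dualNorm p u ^ 2) = ENNReal.ofReal (k * (1 + n ^ 2)) := by
      rw [ENNReal.ofReal_mul (by linarith), ENNReal.ofReal_add zero_le_one (sq_nonneg n),
        ENNReal.ofReal_one, ENNReal.ofReal_pow hn0, hn, D.ofReal_rnorm hu]
    rw [h3] at h2
    change _ ≤ _ + _ * skeletonRate D ν G p q g s at h1
    rw [hρ'] at h1
    calc ∫⁻ v, D.dualNorm p (G s u v) * deviation g (s, v) ∂ν
        ≤ 2 * ∫⁻ v, D.dualNorm p (G s u v) * deviation g (s, v) ∂ν := by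
          rw [two_mul]; exact le_self_add
      _ ≤ ENNReal.ofReal (1 + n)⁻¹ * ENNReal.ofReal (k * (1 + n ^ 2)) +
          (9 * ENNReal.ofReal (1 + n) + 2 * ENNReal.ofReal (1 + n)) * ENNReal.ofReal ρ :=
          h1.trans (by gcongr)
      _ = ENNReal.ofReal ((1 + n)⁻¹ * (k * (1 + n ^ 2)) + 11 * (1 + n) * ρ) := by
          have h11 : 9 * ENNReal.ofReal (1 + n) + 2 * ENNReal.ofReal (1 + n) =
              ENNReal.ofReal (11 * (1 + n)) := by
            rw [ENNReal.ofReal_mul (p := 11) (by norm_num), ENNReal.ofReal_ofNat, ← add_mul]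
            norm_num
          have hk0 : 0 ≤ k := by linarith
          rw [h11, ← ENNReal.ofReal_mul (by positivity), ← ENNReal.ofReal_mul (by positivity),
            ← ENNReal.ofReal_add (by positivity) (by positivity)]
      _ ≤ _ := by
          refine ENNReal.ofReal_le_ofReal ?_
          have h4 : (1 + n)⁻¹ * (k * (1 + n ^ 2)) ≤ (1 + n) * k := by
            rw [inv_mul_le_iff₀ (by positivity)]
            nlinarith [mul_nonneg (by linarith : 0 ≤ k) hn0]
          nlinarith
  · have h2 : D.dualNorm p (G s u v) / (1 + D.dualNorm p u) ≤ growthNorm D G p (s, v) :=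
      le_iSup₂ (f := fun u (_ : u ∈ D.neg p) =>
        D.dualNorm p (G s u v) / (1 + D.dualNorm p u)) u hu
    rw [← h1n]
    exact (ENNReal.div_le_iff (by positivity) (by rw [h1n]; exact ENNReal.ofReal_ne_top)).1 h2

/-- A crude consequence of the growth of `G` at level `p₁`. It ensures that the square integral is
finite, so that its real value is meaningful, and for `u₂ = 0` it gives the quadratic growth used in
`jump_bound₁`. -/
theorem sq_diff_bound (S : SkeletonSetting D ν T A G p p₁ q k) (hs : s ∈ Icc 0 T)
    {u₁ u₂ : Φ →L[ℝ] ℝ} (h₁ : u₁ ∈ D.neg p₁) (h₂ : u₂ ∈ D.neg p₁) :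
    ∫⁻ v, D.dualNorm q (G s u₁ v - G s u₂ v) ^ 2 ∂ν ≤
      ENNReal.ofReal (2 * (k * (1 + D.rnorm p₁ u₁ ^ 2)) + 2 * (k * (1 + D.rnorm p₁ u₂ ^ 2))) := by
  have hk := S.one_le
  have hg : ∀ u ∈ D.neg p₁, ∫⁻ v, D.dualNorm p₁ (G s u v) ^ 2 ∂ν ≤
      ENNReal.ofReal (k * (1 + D.rnorm p₁ u ^ 2)) := by
    intro u hu
    refine (S.cond₁.G_growth s hs u hu).trans (le_of_eq ?_)
    rw [ENNReal.ofReal_mul (by linarith), ENNReal.ofReal_add zero_le_one (sq_nonneg _),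
      ENNReal.ofReal_one, ENNReal.ofReal_pow (D.rnorm_nonneg _ _), D.ofReal_rnorm hu]
  calc ∫⁻ v, D.dualNorm q (G s u₁ v - G s u₂ v) ^ 2 ∂ν
      ≤ ∫⁻ v, (2 * D.dualNorm p₁ (G s u₁ v) ^ 2 + 2 * D.dualNorm p₁ (G s u₂ v) ^ 2) ∂ν := by
        refine lintegral_mono fun v => le_trans ?_ (ENNReal.add_sq_le _ _)
        gcongr
        exact (D.dualNorm_mono S.cond₁.le _).trans (D.dualNorm_sub_le p₁ _ _)
    _ = 2 * ∫⁻ v, D.dualNorm p₁ (G s u₁ v) ^ 2 ∂ν + 2 * ∫⁻ v, D.dualNorm p₁ (G s u₂ v) ^ 2 ∂ν := by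
        rw [lintegral_add_left (((S.measurable_dualNorm_G
          (S.cond₁.G_mem s hs u₁ h₁)).pow_const 2).const_mul 2),
          lintegral_const_mul' _ _ (by finiteness), lintegral_const_mul' _ _ (by finiteness)]
    _ ≤ _ := by
        have hk0 : 0 ≤ k := by linarith
        rw [ENNReal.ofReal_add (by positivity) (by positivity),
          ENNReal.ofReal_mul (p := 2) (q := k * (1 + D.rnorm p₁ u₁ ^ 2)) (by norm_num),
          ENNReal.ofReal_mul (p := 2) (q := k * (1 + D.rnorm p₁ u₂ ^ 2)) (by norm_num),
          ENNReal.ofReal_ofNat]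
        gcongr
        · exact hg u₁ h₁
        · exact hg u₂ h₂

theorem jump_diff_bound (S : SkeletonSetting D ν T A G p p₁ q k) (hs : s ∈ Icc 0 T)
    (hH : skeletonRate D ν G p q g s < ∞) {u₁ u₂ : Φ →L[ℝ] ℝ} (h₁ : u₁ ∈ D.neg p₁)
    (h₂ : u₂ ∈ D.neg p₁) {θ : ℝ} (hθ : 0 < θ) :
    ∫⁻ v, D.dualNorm q (G s u₁ v - G s u₂ v) * deviation g (s, v) ∂ν ≤
      ENNReal.ofReal ((θ⁻¹ * (∫⁻ v, D.dualNorm q (G s u₁ v - G s u₂ v) ^ 2 ∂ν).toReal +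
        (9 * θ + 2 * D.rnorm q (u₁ - u₂)) * (skeletonRate D ν G p q g s).toReal) / 2) := by
  have hpq := S.cond₁.le
  set w := u₁ - u₂ with hw
  have hwq : w ∈ D.neg q := D.neg_mono hpq (D.sub_mem_neg h₁ h₂)
  set n := D.rnorm q w with hn
  have hn0 : 0 ≤ n := D.rnorm_nonneg q w
  set ρ := (skeletonRate D ν G p q g s).toReal with hρ
  have hρ0 : 0 ≤ ρ := ENNReal.toReal_nonneg
  have hρ' : skeletonRate D ν G p q g s = ENNReal.ofReal ρ := (ENNReal.ofReal_toReal hH.ne).symm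
  have hΓ : ∫⁻ v, D.dualNorm q (G s u₁ v - G s u₂ v) ^ 2 ∂ν ≠ ∞ :=
    ne_top_of_le_ne_top ENNReal.ofReal_ne_top (S.sq_diff_bound hs h₁ h₂)
  set Γ := ∫⁻ v, D.dualNorm q (G s u₁ v - G s u₂ v) ^ 2 ∂ν with hΓdef
  have hmem : ∀ v, G s u₁ v - G s u₂ v ∈ D.neg q := fun v => D.neg_mono hpq
    (D.sub_mem_neg (S.cond₁.G_mem s hs u₁ h₁ v) (S.cond₁.G_mem s hs u₂ h₂ v))
  have hmeas : Measurable fun v => D.dualNorm q (G s u₁ v - G s u₂ v) :=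
    D.measurable_dualNorm (fun φ => (S.meas.measurable_G_apply s u₁ φ).sub
      (S.meas.measurable_G_apply s u₂ φ)) hmem
  have h1 := two_mul_lintegral_mul_deviation_le (ν := ν) (g := g) (s := s)
    (h := growthNorm D G p + lipNorm D G q) (h' := lipNorm D G q) (fun z => le_add_self)
    hmeas (c := D.dualNorm q w) (ne_of_lt hwq) (fun v => ?_) hθ
  · change _ ≤ _ + _ * skeletonRate D ν G p q g s at h1
    rw [hρ', ← D.ofReal_rnorm hwq, ← hn, ← hΓdef] at h1
    conv at h1 => rhs; rw [← ENNReal.ofReal_toReal hΓ]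
    have h2 : ENNReal.ofReal θ⁻¹ * ENNReal.ofReal Γ.toReal +
        (9 * ENNReal.ofReal θ + 2 * ENNReal.ofReal n) * ENNReal.ofReal ρ =
        2 * ENNReal.ofReal ((θ⁻¹ * Γ.toReal + (9 * θ + 2 * n) * ρ) / 2) := by
      have hΓ0 : 0 ≤ Γ.toReal := ENNReal.toReal_nonneg
      conv_rhs => rw [← ENNReal.ofReal_ofNat, ← ENNReal.ofReal_mul (by norm_num)]
      rw [mul_div_cancel₀ _ (two_ne_zero), ENNReal.ofReal_add (by positivity) (by positivity),
        ENNReal.ofReal_mul (by positivity), ENNReal.ofReal_mul (by positivity),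
        ENNReal.ofReal_add (by positivity) (by positivity), ENNReal.ofReal_mul (by positivity),
        ENNReal.ofReal_mul (by positivity), ENNReal.ofReal_ofNat, ENNReal.ofReal_ofNat]
    rw [h2] at h1
    exact (ENNReal.mul_le_mul_iff_right two_ne_zero ENNReal.ofNat_ne_top).1 h1
  · by_cases hne : u₁ = u₂
    · rw [hne, sub_self, D.dualNorm_zero]; exact zero_le
    have h2 : D.dualNorm q (G s u₁ v - G s u₂ v) / D.dualNorm q (u₁ - u₂) ≤
        lipNorm D G q (s, v) := by
      unfold lipNorm
      exact le_iSup₂_of_le u₁ (D.neg_mono hpq h₁) (le_iSup₂_of_le u₂ (D.neg_mono hpq h₂)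
        (le_iSup_of_le hne le_rfl))
    have hw0 : D.dualNorm q w ≠ 0 := by
      intro h0
      refine hne (D.ext_basis fun j => ?_)
      have h3 := D.abs_le_rnorm hwq (D.basis j)
      rw [CHNS.rnorm, h0, ENNReal.toReal_zero, zero_mul] at h3
      have h4 := abs_nonpos_iff.1 h3
      rw [hw, sub_apply] at h4
      exact sub_eq_zero.1 h4
    exact (ENNReal.div_le_iff hw0 (ne_of_lt hwq)).1 h2

/-- Exponential integrability of the growth norm is available at level `p`, not at `p₁`. Writing
`G(u) = (G(u) - G(0)) + G(0)`, the difference is handled by the Lipschitz norm in `Φ_{-q}`, and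
`G(0)` by the growth norm in `Φ_{-p}`, since `0 ∈ Φ_{-p}`. -/
theorem jump_bound₁ (S : SkeletonSetting D ν T A G p p₁ q k) (hs : s ∈ Icc 0 T)
    (hH : skeletonRate D ν G p q g s < ∞) (hg : Measurable g)
    {u : Φ →L[ℝ] ℝ} (hu : u ∈ D.neg p₁) :
    ∫⁻ v, D.dualNorm q (G s u v) * deviation g (s, v) ∂ν ≤
      ENNReal.ofReal ((1 + D.rnorm p₁ u) *
        (3 * k + 17 * (skeletonRate D ν G p q g s).toReal)) := by
  have hk := S.one_le
  obtain ⟨q', hc⟩ := S.cond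
  set n := D.rnorm p₁ u with hn
  have hn0 : 0 ≤ n := D.rnorm_nonneg p₁ u
  set ρ := (skeletonRate D ν G p q g s).toReal with hρ
  have hρ0 : 0 ≤ ρ := ENNReal.toReal_nonneg
  have h0 := S.jump_bound hs hH (D.zero_mem_neg p)
  have hr0 : ∀ r, D.rnorm r 0 = 0 := fun r => by simp [CHNS.rnorm]
  rw [hr0, add_zero, one_mul, ← hρ] at h0
  have hd := S.jump_diff_bound hs hH hu (D.zero_mem_neg p₁) (θ := 1 + n) (by positivity)
  have hsq := S.sq_diff_bound hs hu (D.zero_mem_neg p₁)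
  rw [hr0, ← hn] at hsq
  rw [sub_zero, ← hρ] at hd
  have hΓ := ENNReal.toReal_le_of_le_ofReal (by positivity) hsq
  set Γ := (∫⁻ v, D.dualNorm q (G s u v - G s 0 v) ^ 2 ∂ν).toReal
  have hqn : D.rnorm q u ≤ n := D.rnorm_mono S.cond₁.le hu
  have hmeas0 : Measurable fun v => D.dualNorm p (G s 0 v) :=
    S.measurable_dualNorm_G (hc.G_mem s hs 0 (D.zero_mem_neg p))
  have hdev : Measurable fun v => deviation g (s, v) :=
    (measurable_deviation hg).comp measurable_prodMk_left
  calc ∫⁻ v, D.dualNorm q (G s u v) * deviation g (s, v) ∂ν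
      ≤ ∫⁻ v, (D.dualNorm q (G s u v - G s 0 v) * deviation g (s, v) +
          D.dualNorm p (G s 0 v) * deviation g (s, v)) ∂ν := by
        refine lintegral_mono fun v => ?_
        rw [← add_mul]
        gcongr
        calc D.dualNorm q (G s u v) = D.dualNorm q (G s u v - G s 0 v + G s 0 v) := by
              rw [sub_add_cancel]
          _ ≤ D.dualNorm q (G s u v - G s 0 v) + D.dualNorm q (G s 0 v) := D.dualNorm_add_le _ _ _
          _ ≤ _ := by gcongr; exact D.dualNorm_mono (S.le.trans S.cond₁.le) _
    _ = ∫⁻ v, D.dualNorm q (G s u v - G s 0 v) * deviation g (s, v) ∂ν +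
          ∫⁻ v, D.dualNorm p (G s 0 v) * deviation g (s, v) ∂ν :=
        lintegral_add_right _ (hmeas0.mul hdev)
    _ ≤ ENNReal.ofReal (((1 + n)⁻¹ * Γ + (9 * (1 + n) + 2 * D.rnorm q u) * ρ) / 2) +
          ENNReal.ofReal (k + 11 * ρ) := add_le_add hd h0
    _ ≤ _ := by
        have hq0 := D.rnorm_nonneg q u
        have hΓ0 : 0 ≤ Γ := ENNReal.toReal_nonneg
        rw [← ENNReal.ofReal_add (by positivity) (by positivity)]
        refine ENNReal.ofReal_le_ofReal ?_
        have h1 : (1 + n)⁻¹ * Γ ≤ 4 * k * (1 + n) := by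
          rw [inv_mul_le_iff₀ (by positivity)]
          nlinarith [mul_nonneg (by linarith : 0 ≤ k) hn0]
        have h2 : (9 * (1 + n) + 2 * D.rnorm q u) * ρ ≤ 11 * (1 + n) * ρ := by
          gcongr; linarith
        have h3 : 0 ≤ k * n := by positivity
        have h4 : 0 ≤ n * ρ := by positivity
        nlinarith

theorem jumpDrift_apply (S : SkeletonSetting D ν T A G p p₁ q k) (hs : s ∈ Icc 0 T)
    (hH : skeletonRate D ν G p q g s < ∞) (hg : Measurable g)
    {u : Φ →L[ℝ] ℝ} (hu : u ∈ D.neg p₁) (φ : Φ) :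
    Integrable (fun v => G s u v φ * ((g (s, v) : ℝ) - 1)) ν ∧
      jumpDrift ν G g s u φ = ∫ v, G s u v φ * ((g (s, v) : ℝ) - 1) ∂ν := by
  have hk := S.one_le
  have hm : Measurable fun v => (g (s, v) : ℝ) - 1 :=
    ((measurable_coe_nnreal_real.comp hg).comp measurable_prodMk_left).sub_const 1
  have hG : ∀ φ, Measurable fun v => G s u v φ := fun φ => S.meas.measurable_G_apply s u φ
  have hC : 0 ≤ (1 + D.rnorm p₁ u) * (3 * k + 17 * (skeletonRate D ν G p q g s).toReal) := by
    have := D.rnorm_nonneg p₁ u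
    have : 0 ≤ (skeletonRate D ν G p q g s).toReal := ENNReal.toReal_nonneg
    positivity
  have hb := S.jump_bound₁ hs hH hg hu
  refine ⟨(D.integrable_apply_mul hG hm hC hb φ).1, ?_⟩
  have hex := D.exists_weak_integral hG hm hC hb
  rw [jumpDrift, dif_pos hex]
  exact hex.choose_spec φ

theorem abs_jumpDrift_apply_le (S : SkeletonSetting D ν T A G p p₁ q k) (hs : s ∈ Icc 0 T)
    (hH : skeletonRate D ν G p q g s < ∞) (hg : Measurable g)
    {u : Φ →L[ℝ] ℝ} (hu : u ∈ D.neg p₁) {r : ℕ} {C : ℝ} (hC : 0 ≤ C)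
    (hb : ∫⁻ v, D.dualNorm r (G s u v) * deviation g (s, v) ∂ν ≤ ENNReal.ofReal C) (φ : Φ) :
    |jumpDrift ν G g s u φ| ≤ C * D.nrm r φ := by
  rw [(S.jumpDrift_apply hs hH hg hu φ).2]
  have hm : Measurable fun v => (g (s, v) : ℝ) - 1 :=
    ((measurable_coe_nnreal_real.comp hg).comp measurable_prodMk_left).sub_const 1
  exact (D.integrable_apply_mul (fun φ => S.meas.measurable_G_apply s u φ) hm hC hb φ).2

theorem abs_jumpDrift_sub_apply_le (S : SkeletonSetting D ν T A G p p₁ q k) (hs : s ∈ Icc 0 T)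
    (hH : skeletonRate D ν G p q g s < ∞) (hg : Measurable g)
    {u₁ u₂ : Φ →L[ℝ] ℝ} (h₁ : u₁ ∈ D.neg p₁) (h₂ : u₂ ∈ D.neg p₁) {θ : ℝ} (hθ : 0 < θ) (φ : Φ) :
    |(jumpDrift ν G g s u₁ - jumpDrift ν G g s u₂) φ| ≤
      (θ⁻¹ * (∫⁻ v, D.dualNorm q (G s u₁ v - G s u₂ v) ^ 2 ∂ν).toReal +
        (9 * θ + 2 * D.rnorm q (u₁ - u₂)) * (skeletonRate D ν G p q g s).toReal) / 2 *
      D.nrm q φ := by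
  obtain ⟨hi₁, he₁⟩ := S.jumpDrift_apply hs hH hg h₁ φ
  obtain ⟨hi₂, he₂⟩ := S.jumpDrift_apply hs hH hg h₂ φ
  rw [sub_apply, he₁, he₂, ← integral_sub hi₁ hi₂]
  have hm : Measurable fun v => (g (s, v) : ℝ) - 1 :=
    ((measurable_coe_nnreal_real.comp hg).comp measurable_prodMk_left).sub_const 1
  have hC : 0 ≤ (θ⁻¹ * (∫⁻ v, D.dualNorm q (G s u₁ v - G s u₂ v) ^ 2 ∂ν).toReal +
        (9 * θ + 2 * D.rnorm q (u₁ - u₂)) * (skeletonRate D ν G p q g s).toReal) / 2 := by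
    have := D.rnorm_nonneg q (u₁ - u₂)
    have : 0 ≤ (skeletonRate D ν G p q g s).toReal := ENNReal.toReal_nonneg
    positivity
  have h := (D.integrable_apply_mul (U := fun v => G s u₁ v - G s u₂ v) (μ := ν)
    (fun φ => (S.meas.measurable_G_apply s u₁ φ).sub (S.meas.measurable_G_apply s u₂ φ)) hm hC
    (S.jump_diff_bound hs hH h₁ h₂ hθ) φ).2
  simpa only [sub_apply, sub_mul] using h

end SkeletonSetting
end

/-! ### The controlled drift satisfies the abstract conditions -/

noncomputable section

variable {Φ : Type*} [AddCommGroup Φ] [Module ℝ Φ] [UniformSpace Φ] [IsUniformAddGroup Φ]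
variable {𝕏 : Type*} [MeasurableSpace 𝕏]

theorem CHNS.dualInner_add_left (D : CHNS Φ) {r : ℕ} {u v w : Φ →L[ℝ] ℝ} (hu : u ∈ D.neg r)
    (hv : v ∈ D.neg r) (hw : w ∈ D.neg r) :
    D.dualInner r (u + v) w = D.dualInner r u w + D.dualInner r v w := by
  refine (D.hasSum_dualInner (D.add_mem_neg hu hv) hw).unique ?_
  refine ((D.hasSum_dualInner hu hw).add (D.hasSum_dualInner hv hw)).congr_fun fun j => ?_
  simp only [_root_.add_apply]
  ring

/-- The drift of the controlled equation. -/
def skeletonDrift (ν : Measure 𝕏) (A : ℝ → (Φ →L[ℝ] ℝ) → (Φ →L[ℝ] ℝ))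
    (G : ℝ → (Φ →L[ℝ] ℝ) → 𝕏 → (Φ →L[ℝ] ℝ)) (g : ℝ × 𝕏 → ℝ≥0) (s : ℝ) (u : Φ →L[ℝ] ℝ) :
    Φ →L[ℝ] ℝ :=
  A s u + jumpDrift ν G g s u

/-- The integrable constant in the growth, coercivity and monotonicity of the controlled drift. -/
def driftConst (D : CHNS Φ) (ν : Measure 𝕏) (G : ℝ → (Φ →L[ℝ] ℝ) → 𝕏 → (Φ →L[ℝ] ℝ)) (p q : ℕ)
    (k : ℝ) (g : ℝ × 𝕏 → ℝ≥0) (s : ℝ) : ℝ :=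
  40 * k * (1 + (skeletonRate D ν G p q g s).toReal)

namespace SkeletonSetting

variable {D : CHNS Φ} {ν : Measure 𝕏} {T : ℝ} {A : ℝ → (Φ →L[ℝ] ℝ) → (Φ →L[ℝ] ℝ)}
  {G : ℝ → (Φ →L[ℝ] ℝ) → 𝕏 → (Φ →L[ℝ] ℝ)} {p p₁ q : ℕ} {k : ℝ} {g : ℝ × 𝕏 → ℝ≥0} {s : ℝ}

theorem jumpDrift_growth (S : SkeletonSetting D ν T A G p p₁ q k) (hs : s ∈ Icc 0 T)
    (hH : skeletonRate D ν G p q g s < ∞) (hg : Measurable g) {u : Φ →L[ℝ] ℝ}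
    (hu : u ∈ D.neg p₁) : jumpDrift ν G g s u ∈ D.neg q ∧ D.rnorm q (jumpDrift ν G g s u) ≤
      (1 + D.rnorm p₁ u) * (3 * k + 17 * (skeletonRate D ν G p q g s).toReal) := by
  have hk := S.one_le
  have hρ0 : 0 ≤ (skeletonRate D ν G p q g s).toReal := ENNReal.toReal_nonneg
  have hn0 := D.rnorm_nonneg p₁ u
  have hC : 0 ≤ (1 + D.rnorm p₁ u) * (3 * k + 17 * (skeletonRate D ν G p q g s).toReal) := by
    positivity
  have hb := S.abs_jumpDrift_apply_le hs hH hg hu hC (S.jump_bound₁ hs hH hg hu)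
  exact ⟨D.mem_neg_of_bound q _ hC hb, D.rnorm_le q _ hC hb⟩

theorem rnorm_A_le (S : SkeletonSetting D ν T A G p p₁ q k) (hs : s ∈ Icc 0 T)
    {u : Φ →L[ℝ] ℝ} (hu : u ∈ D.neg p₁) : D.rnorm q (A s u) ≤ k * (1 + D.rnorm p₁ u) := by
  have hk := S.one_le
  have hn0 := D.rnorm_nonneg p₁ u
  have h := S.cond₁.A_growth s hs u hu
  have h3 : ENNReal.ofReal k * (1 + D.dualNorm p₁ u ^ 2) =
      ENNReal.ofReal (k * (1 + D.rnorm p₁ u ^ 2)) := by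
    rw [ENNReal.ofReal_mul (by linarith), ENNReal.ofReal_add zero_le_one (sq_nonneg _),
      ENNReal.ofReal_one, ENNReal.ofReal_pow hn0, D.ofReal_rnorm hu]
  rw [h3] at h
  have h4 := ENNReal.toReal_le_of_le_ofReal (by positivity) h
  rw [ENNReal.toReal_pow] at h4
  refine le_of_sq_le_sq (h4.trans ?_) (by positivity)
  have h5 : 0 ≤ k * D.rnorm p₁ u := by positivity
  -- `k ≥ 1` allows the square root of the squared growth bound to be taken without changing the
  -- constant.
  have h6 : k ≤ k ^ 2 := by nlinarith
  nlinarith [mul_le_mul_of_nonneg_right h6 (by positivity : 0 ≤ 1 + D.rnorm p₁ u ^ 2)]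

theorem skeletonDrift_growth (S : SkeletonSetting D ν T A G p p₁ q k) (hs : s ∈ Icc 0 T)
    (hH : skeletonRate D ν G p q g s < ∞) (hg : Measurable g) {u : Φ →L[ℝ] ℝ}
    (hu : u ∈ D.neg p₁) : skeletonDrift ν A G g s u ∈ D.neg q ∧
      D.rnorm q (skeletonDrift ν A G g s u) ≤
        driftConst D ν G p q k g s * (1 + D.rnorm p₁ u) := by
  have hk := S.one_le
  obtain ⟨hm, hb⟩ := S.jumpDrift_growth hs hH hg hu
  have hA := S.cond₁.A_mem s hs u hu
  refine ⟨D.add_mem_neg hA hm, (D.rnorm_add_le hA hm).trans ?_⟩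
  refine (add_le_add (S.rnorm_A_le hs hu) hb).trans ?_
  rw [driftConst]
  set ρ := (skeletonRate D ν G p q g s).toReal with hρ
  have hρ0 : 0 ≤ ρ := ENNReal.toReal_nonneg
  have hn0 := D.rnorm_nonneg p₁ u
  have h1 : k + (3 * k + 17 * ρ) ≤ 40 * k * (1 + ρ) := by nlinarith
  nlinarith [mul_le_mul_of_nonneg_right h1 (by positivity : 0 ≤ 1 + D.rnorm p₁ u)]

/-- The test vector `θ_p φ` is the truncation of `φ`, whose `‖·‖_p` norm is at most `n = ‖φ‖_{-p}`.
The jump part therefore contributes at most `2 (1 + n) n (k + 11ρ)`, and `2 (1 + n) n ≤ 3 (1 + n²)`.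
-/
theorem skeletonDrift_coercive (S : SkeletonSetting D ν T A G p p₁ q k) (hs : s ∈ Icc 0 T)
    (hH : skeletonRate D ν G p q g s < ∞) (hg : Measurable g) {m : ℕ} {φ : Φ}
    (hφ : ∀ j, m ≤ j → D.ip 0 φ (D.basis j) = 0) :
    2 * skeletonDrift ν A G g s (D.embed φ) (D.trunc p m (D.embed φ)) ≤
      driftConst D ν G p q k g s * (1 + D.rnorm p (D.embed φ) ^ 2) := by
  have hk := S.one_le
  obtain ⟨q', hc⟩ := S.cond
  have hA := hc.coercive s hs φ
  rw [D.theta_eq_trunc p m φ hφ] at hA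
  change _ ≤ k * (1 + D.rnorm p (D.embed φ) ^ 2) at hA
  have hu := D.embed_mem_neg p φ
  have hρ0 : 0 ≤ (skeletonRate D ν G p q g s).toReal := ENNReal.toReal_nonneg
  have hn0 := D.rnorm_nonneg p (D.embed φ)
  have hC : 0 ≤ (1 + D.rnorm p (D.embed φ)) *
    (k + 11 * (skeletonRate D ν G p q g s).toReal) := by positivity
  have hB := S.abs_jumpDrift_apply_le hs hH hg (D.embed_mem_neg p₁ φ) hC
    (S.jump_bound hs hH hu) (D.trunc p m (D.embed φ))
  have hB' := ((le_abs_self _).trans hB).trans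
    (mul_le_mul_of_nonneg_left (D.nrm_trunc_le m hu) hC)
  rw [skeletonDrift, add_apply, driftConst]
  set ρ := (skeletonRate D ν G p q g s).toReal
  set n := D.rnorm p (D.embed φ)
  have h1 : k + 3 * (k + 11 * ρ) ≤ 40 * k * (1 + ρ) := by nlinarith
  have h2 : 2 * ((1 + n) * n) ≤ 3 * (1 + n ^ 2) := by nlinarith [sq_nonneg (n - 1)]
  nlinarith [mul_le_mul_of_nonneg_right h1 (by positivity : 0 ≤ 1 + n ^ 2),
    mul_le_mul_of_nonneg_right h2 (by positivity : 0 ≤ k + 11 * ρ)]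

/-- With `θ = n = ‖u₁ - u₂‖_{-q}`, twice the jump pairing is at most `Γ + 11ρ n²`, where `Γ = ∫
‖G(u₁) - G(u₂)‖_{-q}² dν`. The monotonicity hypothesis bounds twice the `A`-pairing plus the same
`Γ` by `k n²`, so `Γ` cancels. -/
theorem skeletonDrift_monotone (S : SkeletonSetting D ν T A G p p₁ q k) (hs : s ∈ Icc 0 T)
    (hH : skeletonRate D ν G p q g s < ∞) (hg : Measurable g) {u₁ u₂ : Φ →L[ℝ] ℝ}
    (h₁ : u₁ ∈ D.neg p₁) (h₂ : u₂ ∈ D.neg p₁) :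
    2 * D.dualInner q (skeletonDrift ν A G g s u₁ - skeletonDrift ν A G g s u₂) (u₁ - u₂) ≤
      driftConst D ν G p q k g s * D.rnorm q (u₁ - u₂) ^ 2 := by
  have hk := S.one_le
  have hw := D.neg_mono S.cond₁.le (D.sub_mem_neg h₁ h₂)
  have hAm := D.sub_mem_neg (S.cond₁.A_mem s hs u₁ h₁) (S.cond₁.A_mem s hs u₂ h₂)
  have hBm := D.sub_mem_neg (S.jumpDrift_growth hs hH hg h₁).1 (S.jumpDrift_growth hs hH hg h₂).1
  have hsub : skeletonDrift ν A G g s u₁ - skeletonDrift ν A G g s u₂ =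
      (A s u₁ - A s u₂) + (jumpDrift ν G g s u₁ - jumpDrift ν G g s u₂) := by
    simp only [skeletonDrift]; abel
  rw [hsub, D.dualInner_add_left hAm hBm hw]
  have hA := S.cond₁.monotone s hs u₁ h₁ u₂ h₂
  change _ ≤ k * D.rnorm q (u₁ - u₂) ^ 2 at hA
  have hB := (le_abs_self _).trans (D.abs_dualInner_le hBm hw)
  have hd := fun θ (hθ : 0 < θ) => S.abs_jumpDrift_sub_apply_le hs hH hg h₁ h₂ (θ := θ) hθ
  rw [driftConst]
  set ρ := (skeletonRate D ν G p q g s).toReal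
  set n := D.rnorm q (u₁ - u₂)
  set Γ := (∫⁻ v, D.dualNorm q (G s u₁ v - G s u₂ v) ^ 2 ∂ν).toReal
  have hρ0 : 0 ≤ ρ := ENNReal.toReal_nonneg
  have hn0 : 0 ≤ n := D.rnorm_nonneg _ _
  have hΓ0 : 0 ≤ Γ := ENNReal.toReal_nonneg
  -- The choice `θ = n` needs `n > 0`; when `n = 0` the jump pairing vanishes by Cauchy-Schwarz.
  rcases hn0.eq_or_lt with hn | hn
  · rw [← hn] at hB hA ⊢
    linarith
  · have h1 := D.rnorm_le q _ (by positivity) (hd n hn)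
    have h2 : 2 * ((n⁻¹ * Γ + (9 * n + 2 * n) * ρ) / 2 * n) = Γ + 11 * ρ * n ^ 2 := by
      field_simp; ring
    have h3 : k + 11 * ρ ≤ 40 * k * (1 + ρ) := by nlinarith
    nlinarith [mul_le_mul_of_nonneg_right h1 hn0, mul_le_mul_of_nonneg_right h3 (sq_nonneg n)]

theorem skeletonDrift_continuous (S : SkeletonSetting D ν T A G p p₁ q k) (hs : s ∈ Icc 0 T)
    (hH : skeletonRate D ν G p q g s < ∞) (hg : Measurable g) {u : Φ →L[ℝ] ℝ}
    (hu : u ∈ D.neg p₁) {w : ℕ → (Φ →L[ℝ] ℝ)} (hw : ∀ n, w n ∈ D.neg p₁)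
    (hlim : Tendsto (fun n => D.rnorm p₁ (w n - u)) atTop (𝓝 0)) (φ : Φ) :
    Tendsto (fun n => skeletonDrift ν A G g s (w n) φ) atTop
      (𝓝 (skeletonDrift ν A G g s u φ)) := by
  have hlim' : Tendsto (fun n => D.dualNorm p₁ (w n - u)) atTop (𝓝 0) := by
    have h := ENNReal.tendsto_ofReal hlim
    rw [ENNReal.ofReal_zero] at h
    exact h.congr fun n => D.ofReal_rnorm (D.sub_mem_neg (hw n) hu)
  have hA : Tendsto (fun n => D.dualNorm q (A s (w n) - A s u)) atTop (𝓝 0) := by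
    rw [ENNReal.tendsto_nhds_zero]
    intro ε hε
    obtain ⟨δ, hδ, h⟩ := S.cond₁.A_cont s hs u hu ε hε
    filter_upwards [hlim'.eventually_lt_const hδ] with n hn using (h _ (hw n) hn).le
  have hΓ : Tendsto (fun n => ∫⁻ v, D.dualNorm q (G s (w n) v - G s u v) ^ 2 ∂ν) atTop
      (𝓝 0) := by
    rw [ENNReal.tendsto_nhds_zero]
    intro ε hε
    obtain ⟨δ, hδ, h⟩ := S.cond₁.G_cont s hs u hu ε hε
    filter_upwards [hlim'.eventually_lt_const hδ] with n hn
    refine le_trans (lintegral_mono fun v => ?_) (h _ (hw n) hn).le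
    gcongr
    exact D.dualNorm_mono S.cond₁.le _
  have hA' := (ENNReal.tendsto_toReal ENNReal.zero_ne_top).comp hA
  have hΓ' := (ENNReal.tendsto_toReal ENNReal.zero_ne_top).comp hΓ
  simp only [ENNReal.toReal_zero] at hA' hΓ'
  have hq : Tendsto (fun n => D.rnorm q (w n - u)) atTop (𝓝 0) :=
    squeeze_zero (fun _ => D.rnorm_nonneg _ _)
      (fun n => D.rnorm_mono S.cond₁.le (D.sub_mem_neg (hw n) hu)) hlim
  have hθ : Tendsto (fun n : ℕ => 1 / ((n : ℝ) + 1)) atTop (𝓝 0) :=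
    tendsto_one_div_add_atTop_nhds_zero_nat
  refine Tendsto.add (f := fun n => A s (w n) φ) ?_ ?_
  · rw [tendsto_iff_norm_sub_tendsto_zero]
    refine squeeze_zero (fun _ => norm_nonneg _) (fun n => ?_)
      (by simpa using hA'.mul_const (D.nrm q φ))
    exact D.abs_le_rnorm (D.sub_mem_neg (S.cond₁.A_mem s hs _ (hw n)) (S.cond₁.A_mem s hs _ hu)) φ
  · rw [tendsto_iff_norm_sub_tendsto_zero]
    set ρ := (skeletonRate D ν G p q g s).toReal
    set Γ : ℕ → ℝ := fun n => (∫⁻ v, D.dualNorm q (G s (w n) v - G s u v) ^ 2 ∂ν).toReal with hΓd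
    have hΓ0 : ∀ n, 0 ≤ Γ n := fun n => ENNReal.toReal_nonneg
    have hsq : Tendsto (fun n => √(Γ n)) atTop (𝓝 0) := by
      have h := (Real.continuous_sqrt.tendsto 0).comp hΓ'
      rwa [Real.sqrt_zero] at h
    -- The weight `θ = √Γ_n + 1/(n+1)` is positive even when `Γ_n = 0`, tends to `0`, and satisfies
    -- `θ⁻¹ Γ_n ≤ √Γ_n`; hence every term of the Young bound tends to `0`.
    refine squeeze_zero (fun _ => norm_nonneg _) (g := fun n => (√(Γ n) +
      (9 * (√(Γ n) + 1 / ((n : ℝ) + 1)) + 2 * D.rnorm q (w n - u)) * ρ) / 2 * D.nrm q φ)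
      (fun n => ?_) ?_
    · have hpos : 0 < √(Γ n) + 1 / ((n : ℝ) + 1) := by positivity
      refine (S.abs_jumpDrift_sub_apply_le hs hH hg (hw n) hu hpos φ).trans ?_
      refine mul_le_mul_of_nonneg_right ?_ (apply_nonneg _ _)
      have h1 : (√(Γ n) + 1 / ((n : ℝ) + 1))⁻¹ * Γ n ≤ √(Γ n) := by
        rw [inv_mul_le_iff₀ hpos]
        have h2 := Real.mul_self_sqrt (hΓ0 n)
        have h3 : 0 ≤ 1 / ((n : ℝ) + 1) * √(Γ n) := by positivity
        nlinarith
      simp only [hΓd] at h1 ⊢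
      linarith
    · have h1 := (((hsq.add hθ).const_mul 9).add (hq.const_mul 2)).mul_const ρ
      simpa using ((hsq.add h1).div_const 2).mul_const (D.nrm q φ)

theorem aestronglyMeasurable_skeletonDrift (S : SkeletonSetting D ν T A G p p₁ q k) [SFinite ν]
    (hH : ∀ᵐ s ∂(volume.restrict (Icc 0 T)), skeletonRate D ν G p q g s < ∞) (hg : Measurable g)
    {Y : ℝ → (Φ →L[ℝ] ℝ)} (hY : ∀ φ, Measurable fun s => Y s φ) (hm : ∀ s, Y s ∈ D.neg p₁)
    (φ : Φ) :
    AEStronglyMeasurable (fun s => skeletonDrift ν A G g s (Y s) φ)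
      (volume.restrict (Icc 0 T)) := by
  have h1 : StronglyMeasurable fun z : ℝ × 𝕏 => G z.1 (Y z.1) z.2 φ * ((g z : ℝ) - 1) :=
    ((S.meas.measurable_G hY φ).mul
      ((measurable_coe_nnreal_real.comp hg).sub_const 1)).stronglyMeasurable
  refine ((S.meas.measurable_A hY φ).stronglyMeasurable.aestronglyMeasurable).add ?_
  refine (h1.integral_prod_right' (ν := ν)).aestronglyMeasurable.congr ?_
  filter_upwards [hH, ae_restrict_mem measurableSet_Icc] with s hs hsT
  exact (S.jumpDrift_apply hsT hs hg (hm s) φ).2.symm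

theorem driftConditions (S : SkeletonSetting D ν T A G p p₁ q k) [SFinite ν] (hg : Measurable g)
    (hHm : AEMeasurable (skeletonRate D ν G p q g) (volume.restrict (Icc 0 T)))
    (hHi : ∫⁻ s in Icc 0 T, skeletonRate D ν G p q g s ≠ ∞) :
    DriftConditions D T p p₁ q (skeletonDrift ν A G g) (driftConst D ν G p q k g) := by
  have hk := S.one_le
  have hH := ae_lt_top' hHm hHi
  have hmem := ae_restrict_mem (μ := (volume : Measure ℝ))
    (measurableSet_Icc (a := (0 : ℝ)) (b := T))
  refine ⟨S.pos, S.le, S.cond₁.le, S.hilbertSchmidt, ?_, fun s => ?_, fun Y hY hm φ =>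
    S.aestronglyMeasurable_skeletonDrift hH hg hY hm φ, ?_, ?_, ?_, ?_⟩
  · refine Integrable.const_mul (Integrable.add ?_
      (integrable_toReal_of_lintegral_ne_top hHm hHi)) _
    exact integrableOn_const (by simp)
  · have : 0 ≤ (skeletonRate D ν G p q g s).toReal := ENNReal.toReal_nonneg
    unfold driftConst
    positivity
  · filter_upwards [hH, hmem] with s hs hsT u hu using S.skeletonDrift_growth hsT hs hg hu
  · filter_upwards [hH, hmem] with s hs hsT m φ hφ using S.skeletonDrift_coercive hsT hs hg hφ
  · filter_upwards [hH, hmem] with s hs hsT u₁ h₁ u₂ h₂ using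
      S.skeletonDrift_monotone hsT hs hg h₁ h₂
  · filter_upwards [hH, hmem] with s hs hsT u hu w hw hlim φ using
      S.skeletonDrift_continuous hsT hs hg hu hw hlim φ

end SkeletonSetting
end

/-! ### From the abstract equation back to the controlled equation -/

noncomputable section

namespace SkeletonSetting

variable {Φ : Type*} [AddCommGroup Φ] [Module ℝ Φ] [UniformSpace Φ] [IsUniformAddGroup Φ]
variable {𝕏 : Type*} [MeasurableSpace 𝕏]
variable {D : CHNS Φ} {ν : Measure 𝕏} {T : ℝ} {A : ℝ → (Φ →L[ℝ] ℝ) → (Φ →L[ℝ] ℝ)}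
  {G : ℝ → (Φ →L[ℝ] ℝ) → 𝕏 → (Φ →L[ℝ] ℝ)} {p p₁ q : ℕ} {k : ℝ} {g : ℝ × 𝕏 → ℝ≥0}
  {X₀ : Φ →L[ℝ] ℝ} {X : ℝ → (Φ →L[ℝ] ℝ)}

theorem jumpDrift_ae_eq (S : SkeletonSetting D ν T A G p p₁ q k) (hg : Measurable g)
    (hH : ∀ᵐ s ∂(volume.restrict (Icc 0 T)), skeletonRate D ν G p q g s < ∞)
    (hX : ∀ t ∈ Icc 0 T, X t ∈ D.neg p₁) (φ : Φ) :
    (fun s => jumpDrift ν G g s (X s) φ) =ᵐ[volume.restrict (Icc 0 T)]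
      fun s => ∫ v, G s (X s) v φ * ((g (s, v) : ℝ) - 1) ∂ν := by
  filter_upwards [hH, ae_restrict_mem measurableSet_Icc] with s hs hsT
  exact (S.jumpDrift_apply hsT hs hg (hX s hsT) φ).2

theorem integral_skeletonDrift (S : SkeletonSetting D ν T A G p p₁ q k) (hg : Measurable g)
    (hH : ∀ᵐ s ∂(volume.restrict (Icc 0 T)), skeletonRate D ν G p q g s < ∞)
    (hX : ∀ t ∈ Icc 0 T, X t ∈ D.neg p₁) {φ : Φ}
    (hA : IntegrableOn (fun s => A s (X s) φ) (Icc 0 T))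
    (hG : IntegrableOn (fun s => ∫ v, G s (X s) v φ * ((g (s, v) : ℝ) - 1) ∂ν) (Icc 0 T)) :
    IntegrableOn (fun s => skeletonDrift ν A G g s (X s) φ) (Icc 0 T) ∧
      ∀ t ∈ Icc 0 T, ∫ s in (0 : ℝ)..t, skeletonDrift ν A G g s (X s) φ =
        (∫ s in (0 : ℝ)..t, A s (X s) φ) +
          ∫ s in (0 : ℝ)..t, ∫ v, G s (X s) v φ * ((g (s, v) : ℝ) - 1) ∂ν := by
  have hae := S.jumpDrift_ae_eq hg hH hX φ
  refine ⟨hA.add (hG.congr hae.symm), fun t ht => ?_⟩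
  have h0 : (0 : ℝ) ∈ Icc 0 T := ⟨le_rfl, ht.1.trans ht.2⟩
  rw [← intervalIntegral.integral_add (intervalIntegrable_of_Icc hA h0 ht)
    (intervalIntegrable_of_Icc hG h0 ht)]
  refine intervalIntegral.integral_congr_ae ?_
  filter_upwards [(ae_restrict_iff' measurableSet_Icc).1 hae] with s hs hst
  rw [uIoc_of_le ht.1] at hst
  rw [skeletonDrift, add_apply, hs ⟨hst.1.le, hst.2.trans ht.2⟩]

theorem isDriftSolution (S : SkeletonSetting D ν T A G p p₁ q k) [SFinite ν] (hg : Measurable g)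
    (hH : ∀ᵐ s ∂(volume.restrict (Icc 0 T)), skeletonRate D ν G p q g s < ∞)
    (hX : IsSkeletonSolution D ν T A G X₀ g p₁ X) :
    IsDriftSolution D T p₁ (skeletonDrift ν A G g) X₀ X := by
  have h := fun φ => S.integral_skeletonDrift hg hH hX.mem (hX.A_integrable φ)
    (hX.G_integrable φ).integral_prod_left
  refine ⟨hX.mem, fun t ht => ?_, fun φ => (h φ).1, fun t ht φ => ?_⟩
  · have h1 := (ENNReal.tendsto_toReal ENNReal.zero_ne_top).comp (hX.cont t ht)
    rwa [ENNReal.toReal_zero] at h1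
  · rw [(h φ).2 t ht, hX.eqn t ht φ, add_assoc]

/-- Tonelli: for almost every `s` the integral over `𝕏` is bounded by `jump_bound₁`, and that bound
is integrable in time because `X` is bounded in `Φ_{-p₁}`. -/
theorem integrable_jump (S : SkeletonSetting D ν T A G p p₁ q k) [SFinite ν] (hg : Measurable g)
    (hHm : AEMeasurable (skeletonRate D ν G p q g) (volume.restrict (Icc 0 T)))
    (hHi : ∫⁻ s in Icc 0 T, skeletonRate D ν G p q g s ≠ ∞)
    (hX : ∀ t ∈ Icc 0 T, X t ∈ D.neg p₁) (hXm : ∀ φ, Measurable fun t => X t φ) {R : ℝ}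
    (hR : ∀ t ∈ Icc 0 T, D.rnorm p₁ (X t) ≤ R) (φ : Φ) :
    Integrable (fun z : ℝ × 𝕏 => G z.1 (X z.1) z.2 φ * ((g z : ℝ) - 1)) (nuT T ν) := by
  have hk := S.one_le
  have hmeas : Measurable fun z : ℝ × 𝕏 => G z.1 (X z.1) z.2 φ * ((g z : ℝ) - 1) :=
    (S.meas.measurable_G hXm φ).mul ((measurable_coe_nnreal_real.comp hg).sub_const 1)
  refine ⟨hmeas.aestronglyMeasurable, ?_⟩
  have hint : IntegrableOn (fun s => (1 + R) *
      (3 * k + 17 * (skeletonRate D ν G p q g s).toReal) * D.nrm q φ) (Icc 0 T) :=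
    ((Integrable.add (integrableOn_const (by simp))
      ((integrable_toReal_of_lintegral_ne_top hHm hHi).const_mul 17)).const_mul _).mul_const _
  rw [HasFiniteIntegral, nuT, lintegral_prod _ hmeas.enorm.aemeasurable]
  refine lt_of_le_of_lt (lintegral_mono_ae ?_) (hint.lintegral_lt_top)
  filter_upwards [ae_lt_top' hHm hHi, ae_restrict_mem measurableSet_Icc] with s hs hsT
  have hρ0 : 0 ≤ (skeletonRate D ν G p q g s).toReal := ENNReal.toReal_nonneg
  refine (D.lintegral_enorm_apply_mul_le (U := G s (X s))
    (S.jump_bound₁ hsT hs hg (hX s hsT)) φ).trans (ENNReal.ofReal_le_ofReal ?_)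
  have := hR s hsT
  have : 0 ≤ D.nrm q φ := apply_nonneg _ _
  gcongr

theorem isSkeletonSolution (S : SkeletonSetting D ν T A G p p₁ q k) [SFinite ν]
    (hg : Measurable g)
    (hHm : AEMeasurable (skeletonRate D ν G p q g) (volume.restrict (Icc 0 T)))
    (hHi : ∫⁻ s in Icc 0 T, skeletonRate D ν G p q g s ≠ ∞)
    (hX : IsDriftSolution D T p₁ (skeletonDrift ν A G g) X₀ X)
    (hXm : ∀ φ, Measurable fun t => X t φ) : IsSkeletonSolution D ν T A G X₀ g p₁ X := by
  have hk := S.one_le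
  obtain ⟨R, hR⟩ := hX.exists_bound
  have hG := S.integrable_jump hg hHm hHi hX.mem hXm hR
  have hA : ∀ φ, IntegrableOn (fun s => A s (X s) φ) (Icc 0 T) := by
    intro φ
    refine Integrable.mono' (g := fun _ => k * (1 + R) * D.nrm q φ) (integrableOn_const (by simp))
      (S.meas.measurable_A hXm φ).aestronglyMeasurable ?_
    filter_upwards [ae_restrict_mem measurableSet_Icc] with s hs
    refine (D.abs_le_rnorm (S.cond₁.A_mem s hs _ (hX.mem s hs)) φ).trans ?_
    refine mul_le_mul_of_nonneg_right ((S.rnorm_A_le hs (hX.mem s hs)).trans ?_) (apply_nonneg _ _)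
    have := hR s hs
    gcongr
  refine ⟨hX.mem, fun t ht => ?_, hA, hG, fun t ht φ => ?_⟩
  · have h1 := ENNReal.tendsto_ofReal (hX.cont t ht)
    rw [ENNReal.ofReal_zero] at h1
    refine h1.congr' ?_
    filter_upwards [self_mem_nhdsWithin] with s hs
    exact D.ofReal_rnorm (D.sub_mem_neg (hX.mem s hs) (hX.mem t ht))
  · rw [hX.eqn t ht φ, (S.integral_skeletonDrift hg (ae_lt_top' hHm hHi) hX.mem (hA φ)
      (hG φ).integral_prod_left).2 t ht, add_assoc]

theorem exists_solution (S : SkeletonSetting D ν T A G p p₁ q k) [SFinite ν] (hg : Measurable g)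
    (hHm : AEMeasurable (skeletonRate D ν G p q g) (volume.restrict (Icc 0 T)))
    (hHi : ∫⁻ s in Icc 0 T, skeletonRate D ν G p q g s ≠ ∞) (hX₀ : X₀ ∈ D.neg p) :
    ∃ X, IsSkeletonSolution D ν T A G X₀ g p₁ X ∧ (∀ t ∈ Icc 0 T, D.dualNorm p (X t) ≤
      ENNReal.ofReal √((D.rnorm p X₀ ^ 2 + 3) *
        Real.exp (2 * ∫ s in (0 : ℝ)..T, 3 * driftConst D ν G p q k g s))) ∧
      ∀ Y, IsSkeletonSolution D ν T A G X₀ g p₁ Y → EqOn Y X (Icc 0 T) := by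
  have h := S.driftConditions hg hHm hHi
  obtain ⟨X, hX, hm, hmeas, hb⟩ := h.exists_solution hX₀
  refine ⟨X, S.isSkeletonSolution hg hHm hHi hX hmeas, fun t ht => ?_, fun Y hY =>
    h.unique (S.isDriftSolution hg (ae_lt_top' hHm hHi) hY) hX⟩
  rw [← D.ofReal_rnorm (hm t)]
  exact ENNReal.ofReal_le_ofReal (hb t ht)

theorem integral_driftConst_le (S : SkeletonSetting D ν T A G p p₁ q k)
    (hHm : AEMeasurable (skeletonRate D ν G p q g) (volume.restrict (Icc 0 T))) {C : ℝ≥0∞}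
    (hC : C < ∞) (hHi : ∫⁻ s in Icc 0 T, skeletonRate D ν G p q g s ≤ C) :
    ∫ s in (0 : ℝ)..T, 3 * driftConst D ν G p q k g s ≤ 3 * (40 * k * (T + C.toReal)) := by
  have hk := S.one_le
  have hT := S.pos
  have hi := integrable_toReal_of_lintegral_ne_top hHm (hHi.trans_lt hC).ne
  have h1 : ∫ s in Icc 0 T, (skeletonRate D ν G p q g s).toReal ≤ C.toReal := by
    rw [integral_toReal hHm (ae_lt_top' hHm (hHi.trans_lt hC).ne)]
    exact ENNReal.toReal_mono hC.ne hHi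
  simp only [driftConst]
  rw [intervalIntegral.integral_const_mul, intervalIntegral.integral_const_mul,
    intervalIntegral.integral_of_le hT.le, ← integral_Icc_eq_integral_Ioc,
    integral_add (integrable_const 1) hi]
  have h2 : ∫ _ in Icc 0 T, (1 : ℝ) = T := by simp [hT.le]
  rw [h2]
  gcongr

end SkeletonSetting
end

theorem mainTheorem2
    {Φ : Type*} [AddCommGroup Φ] [Module ℝ Φ] [UniformSpace Φ] [IsUniformAddGroup Φ]
    (D : CHNS Φ)
    {𝕏 : Type*} [TopologicalSpace 𝕏] [PolishSpace 𝕏] [LocallyCompactSpace 𝕏]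
    [MeasurableSpace 𝕏] [BorelSpace 𝕏]
    (ν : Measure 𝕏) [IsFiniteMeasureOnCompacts ν]
    (T : ℝ) (hT : 0 < T)
    (A : ℝ → (Φ →L[ℝ] ℝ) → (Φ →L[ℝ] ℝ)) (G : ℝ → (Φ →L[ℝ] ℝ) → 𝕏 → (Φ →L[ℝ] ℝ))
    (hmeas : MeasurableCoeffs A G)
    (p₀ : ℕ) (q : ℕ → ℕ) (K : ℕ → ℝ)
    (hAG : ∀ r, p₀ ≤ r → CoeffConditionAt D ν T A G r (q r) (K r))
    (p p₁ : ℕ) (hp : p₀ ≤ p) (hp₁ : p ≤ p₁) (hHS : D.InjectionHS p p₁)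
    (hexp : ExpSqIntegrable (nuT T ν) (growthNorm D G p))
    (hlip : ExpSqIntegrable (nuT T ν) (lipNorm D G (q p₁)))
    (X₀ : Φ →L[ℝ] ℝ) (hX₀ : X₀ ∈ D.neg p) :
    (∀ g ∈ controls T ν,
      ∃ X, IsSkeletonSolution D ν T A G X₀ g p₁ X ∧
        ∀ Y, IsSkeletonSolution D ν T A G X₀ g p₁ Y → EqOn Y X (Icc 0 T)) ∧
    (∀ N : ℕ, ∃ C : ℝ≥0, ∀ g ∈ controlSet T ν N, ∀ X,
      IsSkeletonSolution D ν T A G X₀ g p₁ X → ∀ t ∈ Icc 0 T, D.dualNorm p (X t) ≤ C) := by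
  -- A common constant, at least `1`, that dominates `K p` and `K p₁` whatever their signs.
  have S : SkeletonSetting D ν T A G p p₁ (q p₁) (1 + |K p| + |K p₁|) :=
    { pos := hT
      one_le := by linarith [abs_nonneg (K p), abs_nonneg (K p₁)]
      le := hp₁
      hilbertSchmidt := D.summable_of_injectionHS hHS
      meas := hmeas
      cond := ⟨q p, (hAG p hp).mono_const
        (by linarith [le_abs_self (K p), abs_nonneg (K p₁)])⟩
      cond₁ := (hAG p₁ (hp.trans hp₁)).mono_const
        (by linarith [le_abs_self (K p₁), abs_nonneg (K p)]) }
  set k := 1 + |K p| + |K p₁|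
  have hk := S.one_le
  have hrate := exists_controlRate_bound hT.le hexp hlip
  constructor
  · intro g hg
    simp only [controls, mem_iUnion] at hg
    obtain ⟨N, -, hgN⟩ := hg
    obtain ⟨C, hC, hb⟩ := hrate N
    obtain ⟨hm, hi⟩ := hb g hgN
    obtain ⟨X, hX, -, huniq⟩ := S.exists_solution hgN.1 hm (hi.trans_lt hC).ne hX₀
    exact ⟨X, hX, huniq⟩
  · intro N
    obtain ⟨C, hC, hb⟩ := hrate N
    refine ⟨Real.toNNReal √((D.rnorm p X₀ ^ 2 + 3) *
      Real.exp (2 * (3 * (40 * k * (T + C.toReal))))), fun g hg X hX t ht => ?_⟩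
    obtain ⟨hm, hi⟩ := hb g hg
    -- By uniqueness an arbitrary solution coincides on `[0,T]` with the constructed one and
    -- inherits its bound in `Φ_{-p}`, which depends on `g` only through the integral of
    -- `driftConst`.
    obtain ⟨Z, -, hZ, huniq⟩ := S.exists_solution hg.1 hm (hi.trans_lt hC).ne hX₀
    rw [huniq X hX ht]
    refine (hZ t ht).trans (ENNReal.ofReal_le_ofReal (Real.sqrt_le_sqrt ?_))
    gcongr
    exact S.integral_driftConst_le hm hC hi
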